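/- **Setting.** Let $b\colon\mathbb R\to\mathbb R$, $\sigma\colon\mathbb R\to[0,\infty)$, $m\in\mathbb N\cup\{0\}$, and $-\infty=\xi_0<\xi_1<\dots<\xi_m<\xi_{m+1}=\infty$. Suppose that there are constants $L_b,K_b,L_\sigma,\gamma,\eta\in(0,\infty)$ such that - on each open interval $(\xi_k,\xi_{k+1})$, $k\in\{0,\dots,m\}$, the drift $b$ is absolutely continuous (on compact subintervals), one-sided Lipschitz with coefficient $L_b$, i.e. $(x-y)(b(x)-b(y))\le L_b|x-y|^2$, and satisfies $|b(x)-b(y)|\le K_b(e^{\gamma|x|^\eta}+e^{\gamma|y|^\eta})|x-y|$; - $|\sigma(x)-\sigma(y)|\le L_\sigma|x-y|$ for all $x,y\in\mathbb R$; - $\sigma(\xi_k)\ne0$ for all $k\in\{1,\dots,m\}$. **Transformation.** Set $\phi(u)=(1+u)^3(1-u)^3$ for $|u|\le1$ and $\phi(u)=0$ otherwise, $\alpha_k=\tfrac12\sigma(\xi_k)^{-2}(b(\xi_k-)-b(\xi_k+))$, and fix $c_0>0$ with $c_0<\frac1{6|\alpha_k|}$ for $1\le k\le m$ and $c_0<\frac12(\xi_{k+1}-\xi_k)$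 for $1\le k\le m-1$ (with $1/0=\infty$). Define $$G(x)=x+\sum_{k=1}^m\alpha_k\,\phi\Big(\frac{x-\xi_k}{c_0}\Big)(x-\xi_k)|x-\xi_k|,$$ $$\tilde b=(bG')\circ G^{-1}+\tfrac12(\sigma^2G'')\circ G^{-1},\qquad \tilde\sigma=(\sigma G')\circ G^{-1},$$ where $\tilde b$ is extended continuously to the points $G(\xi_k)$. **Scheme.** Let $T>0$, $x_0\in\mathbb R$, and let $(W_t)_{t\in[0,T]}$ be a standard Brownian motion. For $N\in\mathbb N$ with $N>T$ set $h=T/N$, $A_h=4\sqrt{-h\log h}$, $\tau^h_k=\inf\{t\ge kh:|W_t-W_{kh}|>A_h\}$, $\Delta W_{k+1}=W_{(k+1)h}-W_{kh}$ and $\Delta W^h_{k+1}=W_{(k+1)h\wedge\tau^h_k}-W_{kh}$. A transformed monotone semi-implicit Euler–Maruyama scheme is a family of random variables $(X^h_{kh})_{0\le k\le N}$ with, almost surely, $X^h_0=x_0$ and $$X^h_{(k+1)h}=G^{-1}\Big(G(X^h_{kh})+\tilde b(G(X^h_{(k+1)h}))\,h+\tilde\sigma(G(X^h_{kh}))\,\Delta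 W^h_{k+1}\Big),\qquad 0\le k\le N-1.$$ A transformed semi-implicit Euler–Maruyama scheme $\tilde X^h$ is defined in the same way, with $\Delta W_{k+1}$ in place of $\Delta W^h_{k+1}$. **Proposition 4.10.** Suppose in addition that the monotonicity condition $$x\,b(x)\vee|\sigma(x)|^2\le\alpha+\beta|x|^2\qquad\text{for all }x\in\mathbb R$$ holds with constants $\alpha,\beta>0$, and let $p\ge1$. Then there exists a constant $C(p,T)>0$, which may depend on $b,\sigma$, the constants above and $x_0$, but not on $N$ (nor on the Brownian motion), such that for every $N\in\mathbb N$ with $N>T$ and $N>4\beta T\vee2L_bT$, and $h=T/N$, every such $X^h$ and every such $\tilde X^h$ satisfies $$\mathbb E\Big[\sup_{k\in\{0,\dots,N\}}|X^h_{kh}|^p\Big]\le C(p,T),\qquad \mathbb E\Big[\sup_{k\in\{0,\dots,N\}}|\tilde X^h_{kh}|^p\Big]\le C(p,T).$$ -/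

import Mathlib

open MeasureTheory ProbabilityTheory Filter Topology
open scoped NNReal ENNReal

namespace TransformedEuler

noncomputable section

/-- The open pieces of `ℝ` cut out by `ξ 0 < ⋯ < ξ (m - 1)`: for `0 < k < m` the piece is
`(ξ (k - 1), ξ k)`, for `k = 0` it is unbounded below, and for `k = m` it is unbounded above. -/
def piece {m : ℕ} (ξ : Fin m → ℝ) (k : Fin (m + 1)) : Set ℝ :=
  {x | (∀ i : Fin m, (i : ℕ) < k → ξ i < x) ∧ (∀ i : Fin m, (k : ℕ) ≤ i → x < ξ i)}

/-- The standing assumption on the coefficients: the drift `b` is, on each open piece,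
absolutely continuous (on compact subintervals), one-sided Lipschitz with constant `Lb`, and locally
Lipschitz with exponential growth; the diffusion coefficient `σ` is nonnegative, globally Lipschitz,
and does not vanish at the exceptional points `ξ`. -/
structure CoefficientAssumption (b σ : ℝ → ℝ) {m : ℕ} (ξ : Fin m → ℝ)
    (Lb Kb Lσ γ η : ℝ) : Prop where
  strictMono : StrictMono ξ
  Lb_pos : 0 < Lb
  Kb_pos : 0 < Kb
  Lσ_pos : 0 < Lσ
  γ_pos : 0 < γ
  η_pos : 0 < η
  absolutelyContinuous : ∀ k, ∀ x ∈ piece ξ k, ∀ y ∈ piece ξ k, AbsolutelyContinuousOnInterval b x y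
  oneSidedLipschitz : ∀ k, ∀ x ∈ piece ξ k, ∀ y ∈ piece ξ k,
    (x - y) * (b x - b y) ≤ Lb * |x - y| ^ 2
  expGrowth : ∀ k, ∀ x ∈ piece ξ k, ∀ y ∈ piece ξ k,
    |b x - b y| ≤ Kb * (Real.exp (γ * |x| ^ η) + Real.exp (γ * |y| ^ η)) * |x - y|
  diffusion_nonneg : ∀ x, 0 ≤ σ x
  diffusion_lipschitz : ∀ x y, |σ x - σ y| ≤ Lσ * |x - y|
  diffusion_ne_zero : ∀ i, σ (ξ i) ≠ 0

/-- The monotonicity condition `x b(x) ∨ |σ(x)|² ≤ α + β |x|²` for all `x`. -/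
def MonotonicityCondition (b σ : ℝ → ℝ) (α β : ℝ) : Prop :=
  ∀ x : ℝ, max (x * b x) (|σ x| ^ 2) ≤ α + β * |x| ^ 2

/-! ### The transformation of space -/

/-- The bump `φ(u) = (1 + u)³ (1 - u)³` for `|u| ≤ 1`, and `0` otherwise. -/
def bump (u : ℝ) : ℝ := if |u| ≤ 1 then (1 + u) ^ 3 * (1 - u) ^ 3 else 0

/-- `φ((x - ξ) / c₀) (x - ξ) |x - ξ|`. -/
def localBump (c₀ ξ x : ℝ) : ℝ := bump ((x - ξ) / c₀) * (x - ξ) * |x - ξ|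

/-- The coefficient `½ σ(ξ)⁻² (b(ξ-) - b(ξ+))`. -/
def jumpCoeff (b σ : ℝ → ℝ) (ξ : ℝ) : ℝ :=
  1 / 2 * (σ ξ ^ 2)⁻¹ * (Function.leftLim b ξ - Function.rightLim b ξ)

/-- The transformation `G(x) = x + ∑ₖ αₖ φ((x - ξₖ) / c₀) (x - ξₖ) |x - ξₖ|`, where `αₖ` is
`jumpCoeff b σ (ξ k)`. -/
def G (b σ : ℝ → ℝ) {m : ℕ} (ξ : Fin m → ℝ) (c₀ : ℝ) (x : ℝ) : ℝ :=
  x + ∑ k, jumpCoeff b σ (ξ k) * localBump c₀ (ξ k) x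

/-- Admissible localisation radii:
`0 < c₀ < minₖ 1 / (6 |αₖ|) ∧ minₖ ½ (ξₖ₊₁ - ξₖ)`, with `1 / 0 = ∞` and empty minima `∞`. -/
structure AdmissibleRadius (b σ : ℝ → ℝ) {m : ℕ} (ξ : Fin m → ℝ) (c₀ : ℝ) : Prop where
  pos : 0 < c₀
  lt_jump : ∀ k, 6 * |jumpCoeff b σ (ξ k)| * c₀ < 1
  lt_gap : ∀ i j : Fin m, (j : ℕ) = i + 1 → c₀ < 1 / 2 * (ξ j - ξ i)

/-- The inverse function of `G` (a bijection of `ℝ` when the radius is admissible). -/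
def GInv (b σ : ℝ → ℝ) {m : ℕ} (ξ : Fin m → ℝ) (c₀ : ℝ) : ℝ → ℝ :=
  Function.invFun (G b σ ξ c₀)

/-- The expression `b G' + ½ σ² G''`, meaningful away from the points `ξ`. -/
def preDrift (b σ : ℝ → ℝ) {m : ℕ} (ξ : Fin m → ℝ) (c₀ : ℝ) (x : ℝ) : ℝ :=
  b x * deriv (G b σ ξ c₀) x + 1 / 2 * (σ x ^ 2 * deriv (deriv (G b σ ξ c₀)) x)

open Classical in
/-- The continuous function `b G' + ½ σ² G''` on `ℝ`. At the points `ξ`, where `G''` does not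
exist in general, it is defined by continuous extension. -/
def extendedDrift (b σ : ℝ → ℝ) {m : ℕ} (ξ : Fin m → ℝ) (c₀ : ℝ) (x : ℝ) : ℝ :=
  if x ∈ Set.range ξ then limUnder (𝓝[≠] x) (preDrift b σ ξ c₀) else preDrift b σ ξ c₀ x

/-- The transformed drift `(b G') ∘ G⁻¹ + ½ (σ² G'') ∘ G⁻¹`. -/
def transformedDrift (b σ : ℝ → ℝ) {m : ℕ} (ξ : Fin m → ℝ) (c₀ : ℝ) (z : ℝ) : ℝ :=
  extendedDrift b σ ξ c₀ (GInv b σ ξ c₀ z)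

/-- The transformed diffusion coefficient `(σ G') ∘ G⁻¹`. -/
def transformedDiffusion (b σ : ℝ → ℝ) {m : ℕ} (ξ : Fin m → ℝ) (c₀ : ℝ) (z : ℝ) : ℝ :=
  σ (GInv b σ ξ c₀ z) * deriv (G b σ ξ c₀) (GInv b σ ξ c₀ z)

/-! ### Brownian motion and its (truncated) increments -/

/-- `(W t)` for `t ∈ [0, T]` is a standard Brownian motion: its finite-dimensional laws are those of
Brownian motion and its paths are almost surely continuous. Nothing is said about `t > T`. -/
structure IsBrownianMotionOn {Ω : Type*} [MeasurableSpace Ω] (T : ℝ≥0) (W : ℝ≥0 → Ω → ℝ)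
    (P : Measure Ω) : Prop where
  hasLaw : ∀ I : Finset ℝ≥0, (∀ t ∈ I, t ≤ T) →
    HasLaw (fun ω ↦ I.restrict (W · ω)) (BrownianReal.projectiveFamily I) P
  continuous_paths : ∀ᵐ ω ∂P, ContinuousOn (W · ω) (Set.Icc 0 T)

/-- The truncation level `A_h = 4 √(-h log h)`. -/
def truncLevel (h : ℝ≥0) : ℝ := 4 * √(-(h : ℝ) * Real.log h)

/-- `τ = inf {t ≥ k h : |W t - W (k h)| > A_h}`, with `inf ∅ = ∞`. -/
def truncTime {Ω : Type*} (W : ℝ≥0 → Ω → ℝ) (h : ℝ≥0) (k : ℕ) (ω : Ω) : ℝ≥0∞ :=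
  ⨅ (t : ℝ≥0) (_ : k * h ≤ t ∧ truncLevel h < |W t ω - W (k * h) ω|), (t : ℝ≥0∞)

/-- The truncated increment `W ((k + 1) h ∧ τ) - W (k h)`. -/
def truncIncrement {Ω : Type*} (W : ℝ≥0 → Ω → ℝ) (h : ℝ≥0) (k : ℕ) (ω : Ω) : ℝ :=
  W (min (((k + 1) * h : ℝ≥0) : ℝ≥0∞) (truncTime W h k ω)).toNNReal ω - W (k * h) ω

/-- The increment `W ((k + 1) h) - W (k h)`. -/
def increment {Ω : Type*} (W : ℝ≥0 → Ω → ℝ) (h : ℝ≥0) (k : ℕ) (ω : Ω) : ℝ :=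
  W ((k + 1) * h) ω - W (k * h) ω

/-! ### The scheme -/

/-- The random variables `X 0, …, X N` (with `X k` the value at time `k h`) form a transformed
semi-implicit Euler--Maruyama scheme with step size `h`, started at `x₀`, where `ΔW k` is the
increment used in the step from `k h` to `(k + 1) h`. -/
structure IsTransformedScheme {Ω : Type*} [MeasurableSpace Ω] (P : Measure Ω)
    (b σ : ℝ → ℝ) {m : ℕ} (ξ : Fin m → ℝ) (c₀ x₀ : ℝ) (N : ℕ) (h : ℝ≥0)
    (ΔW : ℕ → Ω → ℝ) (X : ℕ → Ω → ℝ) : Prop where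
  aemeasurable : ∀ k ≤ N, AEMeasurable (X k) P
  initial : ∀ᵐ ω ∂P, X 0 ω = x₀
  step : ∀ k < N, ∀ᵐ ω ∂P, X (k + 1) ω = GInv b σ ξ c₀
    (G b σ ξ c₀ (X k ω) + transformedDrift b σ ξ c₀ (G b σ ξ c₀ (X (k + 1) ω)) * h
      + transformedDiffusion b σ ξ c₀ (G b σ ξ c₀ (X k ω)) * ΔW k ω)

end

end TransformedEuler

/-!
The process `Z = G(X)` solves the implicit scheme `Z' = Z + b̃(Z') h + σ̃(Z) D`, and `G` differs
from the identity by a bounded function, so it suffices to bound the moments of `sup |Z|`.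

The transformed coefficients are well behaved. The factor `jumpCoeff` in `G` is chosen so that the
jump of `½ σ² G''` at an exceptional point cancels the jump of `b` (`tendsto_preDrift`). Hence the
transformed drift is continuous, and the one-sided Lipschitz bounds on the pieces combine to a
global one (`exists_extendedDrift_sub_le`), with a constant that may be larger than `Lb`. Outside
a bounded set `G` is the identity, so `z b̃(z) ≤ a + β z²` with the original `β`
(`exists_mul_transformedDrift_le`), and `σ̃` has linear growth.

For the scheme, squaring `Z' - b̃(Z') h = Z + σ̃(Z) D` and using `4 β h < 1` shows that `1 + Z²`
grows in each step at most by the factor `1 + 2 a D + O(D² + h)`, where `a` is a bounded function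
of `Z` (`one_add_sq_le_of_step`). For its `q`-th power the same holds with the remainder
`O((h + D²) (1 + D²) ^ q)`. When `h` is small compared to the one-sided Lipschitz constant of `b̃`,
the implicit equation has at most one solution, so `Z` is adapted to the noise. Then `(1 + Z²) ^ q`
is dominated by a product which is a nonnegative submartingale with second moment at most
`(1 + O(h)) ^ N`, and Doob's inequality concludes. The step sizes allowed by `Lb` alone need not be
that small, and `Z` may then anticipate the noise. This concerns only finitely many `N`, for which
the pathwise bound by `∏ (1 + D²)` is enough (`exists_lintegral_iSup_implicitScheme_le`).

All that is used of the noise is `IsNoise`: independence of the past, mean zero, and moments of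
order `h`. For Brownian increments this is immediate. A truncated increment is the almost sure
limit of random walks along dyadic grids, stopped when they leave `[-A_h, A_h]`
(`tendsto_stoppedWalk_truncIncrement`). For these walks independence and mean zero are elementary,
and Doob's inequality bounds the moments by those of the full increment, whatever the truncation
level. All three properties pass to the limit (`isNoise_truncIncrement`).
-/

namespace TransformedEuler

noncomputable section

/-! ### Noise with independent increments and Doob's inequality -/

section

theorem half_sq_partialSups_le (s : ℕ → ℝ) (n : ℕ) :
    (partialSups s n) ^ 2 / 2 ≤ partialSups s n * s n
      - ∑ i ∈ Finset.range n, partialSups s i * (s (i + 1) - s i) := by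
  induction n with
  | zero => simp; nlinarith [sq_nonneg (s 0)]
  | succ n ih =>
    rw [Finset.sum_range_succ, partialSups_add_one]
    have h1 : s n ≤ partialSups s n := le_partialSups s n
    rcases le_total (s (n + 1)) (partialSups s n) with h | h
    · rw [sup_eq_left.2 h]; nlinarith
    · rw [sup_eq_right.2 h]
      nlinarith [sq_nonneg (s (n + 1) - partialSups s n)]

/-- A pathwise form of Doob's `L²` maximal inequality. If `s` is a path of a nonnegative
submartingale, the sum on the right has nonnegative expectation. -/
theorem sq_partialSups_le (s : ℕ → ℝ) (n : ℕ) :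
    (partialSups s n) ^ 2 ≤ 4 * s n ^ 2
      - 4 * ∑ i ∈ Finset.range n, partialSups s i * (s (i + 1) - s i) := by
  have := half_sq_partialSups_le s n
  nlinarith [sq_nonneg (partialSups s n - 2 * s n)]

theorem partialSups_nonneg {s : ℕ → ℝ} (hs : ∀ k, 0 ≤ s k) (n : ℕ) : 0 ≤ partialSups s n :=
  (hs n).trans (le_partialSups s n)

theorem partialSups_le_sum {s : ℕ → ℝ} (hs : ∀ k, 0 ≤ s k) (n : ℕ) :
    partialSups s n ≤ ∑ i ∈ Finset.range (n + 1), s i :=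
  partialSups_le _ _ _ fun j hj ↦
    Finset.single_le_sum (f := s) (fun i _ ↦ hs i) (Finset.mem_range.2 (by omega))

variable {Ω : Type*}

/-- The σ-algebra generated by `D 0, …, D (k - 1)`: the information available before step `k`. -/
@[reducible]
def past (D : ℕ → Ω → ℝ) (k : ℕ) : MeasurableSpace Ω :=
  MeasurableSpace.comap (fun ω (i : Fin k) ↦ D i ω) inferInstance

theorem measurable_past {D : ℕ → Ω → ℝ} {i k : ℕ} (h : i < k) : Measurable[past D k] (D i) :=
  (measurable_pi_apply (⟨i, h⟩ : Fin k)).comp (comap_measurable fun ω (i : Fin k) ↦ D i ω)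

theorem past_mono (D : ℕ → Ω → ℝ) {j k : ℕ} (h : j ≤ k) : past D j ≤ past D k := by
  refine Measurable.comap_le ?_
  exact (@measurable_pi_iff _ _ _ (past D k) _ _).2 fun i ↦ measurable_past (i.2.trans_le h)

theorem measurable_partialSups {m : MeasurableSpace Ω} {S : ℕ → Ω → ℝ} {k : ℕ}
    (h : ∀ i ≤ k, Measurable (S i)) : Measurable fun ω ↦ partialSups (S · ω) k := by
  induction k with
  | zero => simpa using h 0 le_rfl
  | succ k ih =>
    simp only [partialSups_add_one]
    exact (ih fun i hi ↦ h i (by omega)).sup (h _ le_rfl)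

variable [mΩ : MeasurableSpace Ω] {P : Measure Ω}

theorem past_le {D : ℕ → Ω → ℝ} (hD : ∀ k, Measurable (D k)) (k : ℕ) : past D k ≤ mΩ :=
  Measurable.comap_le (measurable_pi_iff.2 fun i ↦ hD i)

theorem indepFun_of_past {D : ℕ → Ω → ℝ} {k : ℕ} {f : Ω → ℝ}
    (hi : IndepFun (fun ω (i : Fin k) ↦ D i ω) (D k) P) (hf : Measurable[past D k] f) :
    IndepFun f (D k) P := by
  rw [IndepFun_iff_Indep] at hi ⊢
  exact indep_of_indep_of_le_left hi (Measurable.comap_le hf)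

/-- Doob's `L²` maximal inequality for a nonnegative adapted process `S` whose increments dominate
`a k * D k`, where `D` is a centred independent noise and `a` is predictable. Such an `S` is a
submartingale for the filtration `past D`. -/
theorem integral_sq_partialSups_le [IsProbabilityMeasure P] {D : ℕ → Ω → ℝ}
    (hD : ∀ k, Measurable (D k)) {N : ℕ}
    (hi : ∀ k < N, IndepFun (fun ω (i : Fin k) ↦ D i ω) (D k) P)
    (hint : ∀ k < N, Integrable (D k) P) (hmean : ∀ k < N, ∫ ω, D k ω ∂P = 0)
    {S a : ℕ → Ω → ℝ} (hS : ∀ k ≤ N, Measurable[past D k] (S k))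
    (ha : ∀ k < N, Measurable[past D k] (a k)) (hS0 : ∀ k ω, 0 ≤ S k ω)
    (hS2 : ∀ k ≤ N, MemLp (S k) 2 P) (ha2 : ∀ k < N, MemLp (a k) 2 P)
    (hstep : ∀ k < N, ∀ ω, S k ω + a k ω * D k ω ≤ S (k + 1) ω) :
    MemLp (fun ω ↦ partialSups (S · ω) N) 2 P ∧
      ∫ ω, (partialSups (S · ω) N) ^ 2 ∂P ≤ 4 * ∫ ω, S N ω ^ 2 ∂P := by
  have hMm : ∀ k ≤ N, Measurable[past D k] fun ω ↦ partialSups (S · ω) k := fun k hk ↦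
    measurable_partialSups fun i hik ↦ (hS i (hik.trans hk)).mono (past_mono D hik) le_rfl
  have hM2 : ∀ k ≤ N, MemLp (fun ω ↦ partialSups (S · ω) k) 2 P := by
    intro k hk
    have h1 : MemLp (fun ω ↦ ∑ i ∈ Finset.range (k + 1), S i ω) 2 P :=
      memLp_finsetSum _ fun i hi ↦ hS2 i (by have := Finset.mem_range.1 hi; omega)
    refine h1.mono ((hMm k hk).mono (past_le hD k) le_rfl).aestronglyMeasurable
      (ae_of_all _ fun ω ↦ ?_)
    rw [Real.norm_of_nonneg (partialSups_nonneg (hS0 · ω) k),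
      Real.norm_of_nonneg (Finset.sum_nonneg fun i _ ↦ hS0 i ω)]
    exact partialSups_le_sum (hS0 · ω) k
  refine ⟨hM2 N le_rfl, ?_⟩
  have hMS : ∀ k < N, Integrable
      (fun ω ↦ partialSups (S · ω) k * (S (k + 1) ω - S k ω)) P := fun k hk ↦
    (hM2 k hk.le).integrable_mul ((hS2 (k + 1) hk).sub (hS2 k hk.le))
  have hnn : ∀ k < N, 0 ≤ ∫ ω, partialSups (S · ω) k * (S (k + 1) ω - S k ω) ∂P := by
    intro k hk
    have hMa : Measurable[past D k] fun ω ↦ partialSups (S · ω) k * a k ω :=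
      (hMm k hk.le).mul (ha k hk)
    have hind := indepFun_of_past (hi k hk) hMa
    have hMai : Integrable (fun ω ↦ partialSups (S · ω) k * a k ω) P :=
      (hM2 k hk.le).integrable_mul (ha2 k hk)
    have h0 : ∫ ω, (partialSups (S · ω) k * a k ω) * D k ω ∂P = 0 := by
      rw [hind.integral_fun_mul_eq_mul_integral hMai.aestronglyMeasurable
        (hint k hk).aestronglyMeasurable, hmean k hk, mul_zero]
    rw [← h0]
    refine integral_mono (hind.integrable_mul hMai (hint k hk)) (hMS k hk) fun ω ↦ ?_
    have h1 := partialSups_nonneg (hS0 · ω) k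
    have h2 := hstep k hk ω
    simp only
    rw [mul_assoc]
    exact mul_le_mul_of_nonneg_left (by linarith) h1
  have hsum : Integrable (fun ω ↦ ∑ i ∈ Finset.range N,
      partialSups (S · ω) i * (S (i + 1) ω - S i ω)) P :=
    integrable_finsetSum _ fun i hi ↦ hMS i (Finset.mem_range.1 hi)
  calc ∫ ω, (partialSups (S · ω) N) ^ 2 ∂P
      ≤ ∫ ω, (4 * S N ω ^ 2 - 4 * ∑ i ∈ Finset.range N,
          partialSups (S · ω) i * (S (i + 1) ω - S i ω)) ∂P := by
        refine integral_mono (hM2 N le_rfl).integrable_sq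
          (((hS2 N le_rfl).integrable_sq.const_mul 4).sub (hsum.const_mul 4)) fun ω ↦ ?_
        exact sq_partialSups_le (S · ω) N
    _ ≤ _ := by
        rw [integral_sub ((hS2 N le_rfl).integrable_sq.const_mul 4) (hsum.const_mul 4),
          integral_const_mul, integral_const_mul,
          integral_finsetSum _ fun i hi ↦ hMS i (Finset.mem_range.1 hi)]
        have := Finset.sum_nonneg fun i hi ↦ hnn i (Finset.mem_range.1 hi)
        linarith

/-- The properties of the driving noise `D 0, …, D (N - 1)` of a scheme with step size `h` that the
moment bound uses: each `D k` is independent of its predecessors and centred, and all its moments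
are of the order `h` of the step size, with constants `K` that are the same for all `N` and `h`. The
weight `(h + D²) (1 + D²) ^ Q` is the shape in which the remainder of an expansion of the scheme
appears. -/
structure IsNoise (P : Measure Ω) (N : ℕ) (h : ℝ) (K : ℕ → ℝ) (D : ℕ → Ω → ℝ) : Prop where
  aemeasurable : ∀ k < N, AEMeasurable (D k) P
  indep : ∀ k < N, IndepFun (fun ω (i : Fin k) ↦ D i ω) (D k) P
  integrable : ∀ k < N, ∀ Q : ℕ, Integrable (fun ω ↦ (1 + D k ω ^ 2) ^ Q) P
  mean : ∀ k < N, ∫ ω, D k ω ∂P = 0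
  moment : ∀ k < N, ∀ Q : ℕ, ∫ ω, (h + D k ω ^ 2) * (1 + D k ω ^ 2) ^ Q ∂P ≤ K Q * h

theorem IsNoise.exists_measurable {N : ℕ} {h : ℝ} {K : ℕ → ℝ} {D : ℕ → Ω → ℝ}
    (hN : IsNoise P N h K D) :
    ∃ D' : ℕ → Ω → ℝ, (∀ k, Measurable (D' k)) ∧ (∀ k < N, D k =ᵐ[P] D' k) ∧
      IsNoise P N h K D' := by
  classical
  let D' : ℕ → Ω → ℝ := fun k ↦ if hk : k < N then (hN.aemeasurable k hk).mk else 0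
  have hD' : ∀ k, Measurable (D' k) := fun k ↦ by
    by_cases hk : k < N
    · simpa [D', hk] using (hN.aemeasurable k hk).measurable_mk
    · simpa [D', hk] using measurable_zero
  have heq : ∀ k < N, D k =ᵐ[P] D' k := fun k hk ↦ by
    simpa [D', hk] using (hN.aemeasurable k hk).ae_eq_mk
  refine ⟨D', hD', heq, fun k _ ↦ (hD' k).aemeasurable, fun k hk ↦ ?_, fun k hk Q ↦ ?_,
    fun k hk ↦ ?_, fun k hk Q ↦ ?_⟩
  · refine (hN.indep k hk).congr ?_ (heq k hk)
    have : ∀ᵐ ω ∂P, ∀ i : Fin k, D i ω = D' i ω := ae_all_iff.2 fun i ↦ heq i (i.2.trans hk)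
    filter_upwards [this] with ω hω using funext hω
  · refine (hN.integrable k hk Q).congr ?_
    filter_upwards [heq k hk] with ω hω using by rw [hω]
  · rw [← hN.mean k hk]
    exact integral_congr_ae (heq k hk).symm
  · rw [← integral_congr_ae (f := fun ω ↦ (h + D k ω ^ 2) * (1 + D k ω ^ 2) ^ Q)]
    · exact hN.moment k hk Q
    · filter_upwards [heq k hk] with ω hω using by rw [hω]

theorem IsNoise.integrable_weight {N : ℕ} {h : ℝ} {K : ℕ → ℝ} {D : ℕ → Ω → ℝ}
    (hN : IsNoise P N h K D) {k : ℕ} (hk : k < N) (Q : ℕ) :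
    Integrable (fun ω ↦ (h + D k ω ^ 2) * (1 + D k ω ^ 2) ^ Q) P := by
  refine ((hN.integrable k hk (Q + 1)).sub ((hN.integrable k hk Q).const_mul (1 - h))).congr
    (ae_of_all _ fun ω ↦ ?_)
  simp only [Pi.sub_apply]
  ring

theorem IsNoise.integrable_self {N : ℕ} {h : ℝ} {K : ℕ → ℝ} {D : ℕ → Ω → ℝ}
    (hN : IsNoise P N h K D) {k : ℕ} (hk : k < N) : Integrable (D k) P := by
  refine (hN.integrable k hk 1).mono' (hN.aemeasurable k hk).aestronglyMeasurable
    (ae_of_all _ fun ω ↦ ?_)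
  rw [Real.norm_eq_abs, pow_one, abs_le]
  constructor <;> nlinarith [sq_nonneg (D k ω - 1), sq_nonneg (D k ω + 1)]

/-- Second moment of a product `S N` of factors `1 + a k * D k + O((h + (D k)²) (1 + (D k)²) ^ Q)`
with predictable bounded `a`: since `D k` is centred and independent of the past, each factor
multiplies the second moment by at most `1 + O(h)`. -/
theorem IsNoise.integral_sq_prod_le [IsProbabilityMeasure P] {N : ℕ} {h : ℝ} {K : ℕ → ℝ}
    {D : ℕ → Ω → ℝ} (hN : IsNoise P N h K D) (hD : ∀ k, Measurable (D k))
    (h0 : 0 < h) (h1 : h ≤ 1) {B : ℝ} (hB : 0 ≤ B) (Q : ℕ) {S a : ℕ → Ω → ℝ}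
    (hS0 : ∀ ω, S 0 ω = 1) (ha : ∀ k < N, Measurable[past D k] (a k))
    (haB : ∀ k < N, ∀ ω, |a k ω| ≤ B)
    (hS : ∀ k < N, ∀ ω, S (k + 1) ω =
      S k ω * (1 + a k ω * D k ω + B * ((h + D k ω ^ 2) * (1 + D k ω ^ 2) ^ Q))) :
    ∀ k ≤ N, Measurable[past D k] (S k) ∧ Integrable (fun ω ↦ S k ω ^ 2) P ∧
      ∫ ω, S k ω ^ 2 ∂P ≤
        (1 + (2 * B * K Q + 2 * B ^ 2 * K 0 + 2 * B ^ 2 * K (2 * Q + 1)) * h) ^ k := by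
  intro k
  induction k with
  | zero =>
    intro _
    have : S 0 = fun _ ↦ 1 := funext hS0
    simp only [this]
    exact ⟨measurable_const, by simp, by simp⟩
  | succ k ih =>
    intro hk
    obtain ⟨hm, hI, hle⟩ := ih (by omega)
    have hkN : k < N := hk
    set R : ℝ → ℝ := fun d ↦ 2 * B * ((h + d ^ 2) * (1 + d ^ 2) ^ Q)
      + 2 * B ^ 2 * ((h + d ^ 2) * (1 + d ^ 2) ^ 0)
      + 2 * B ^ 2 * ((h + d ^ 2) * (1 + d ^ 2) ^ (2 * Q + 1)) with hR
    have hRm : Measurable R := by rw [hR]; fun_prop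
    set C := 2 * B * K Q + 2 * B ^ 2 * K 0 + 2 * B ^ 2 * K (2 * Q + 1) with hC
    have hRi : Integrable (fun ω ↦ R (D k ω)) P :=
      (((hN.integrable_weight hkN Q).const_mul _).add
        ((hN.integrable_weight hkN 0).const_mul _)).add
        ((hN.integrable_weight hkN (2 * Q + 1)).const_mul _)
    have hRle : ∫ ω, R (D k ω) ∂P ≤ C * h := by
      simp only [hR]
      rw [integral_add, integral_add, integral_const_mul, integral_const_mul, integral_const_mul]
      · have e1 := hN.moment k hkN Q
        have e2 := hN.moment k hkN 0
        have e3 := hN.moment k hkN (2 * Q + 1)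
        have hB2 : 0 ≤ 2 * B ^ 2 := by positivity
        have := mul_le_mul_of_nonneg_left e1 (by positivity : 0 ≤ 2 * B)
        have := mul_le_mul_of_nonneg_left e2 hB2
        have := mul_le_mul_of_nonneg_left e3 hB2
        rw [hC]; linarith
      · exact (hN.integrable_weight hkN Q).const_mul _
      · exact (hN.integrable_weight hkN 0).const_mul _
      · exact ((hN.integrable_weight hkN Q).const_mul _).add
          ((hN.integrable_weight hkN 0).const_mul _)
      · exact (hN.integrable_weight hkN (2 * Q + 1)).const_mul _
    -- The part of the square that is linear in `D k` is kept exactly, since it has mean zero.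
    have hpt : ∀ ω, S (k + 1) ω ^ 2 ≤
        S k ω ^ 2 + (S k ω ^ 2 * (2 * a k ω)) * D k ω + S k ω ^ 2 * R (D k ω) := by
      intro ω
      rw [hS k hkN, mul_pow]
      have hd : 0 ≤ D k ω ^ 2 := sq_nonneg _
      have hda : (a k ω * D k ω) ^ 2 ≤ B ^ 2 * (h + D k ω ^ 2) := by
        rw [mul_pow]
        have : a k ω ^ 2 ≤ B ^ 2 := sq_le_sq' (by linarith [(abs_le.1 (haB k hkN ω)).1])
          (abs_le.1 (haB k hkN ω)).2
        nlinarith [sq_nonneg B]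
      set d := D k ω
      set x := a k ω * d
      set r := (h + d ^ 2) * (1 + d ^ 2) ^ Q with hr
      have hr2 : r ^ 2 ≤ (h + d ^ 2) * (1 + d ^ 2) ^ (2 * Q + 1) := by
        rw [hr, mul_pow, ← pow_mul, mul_comm Q 2, pow_succ _ (2 * Q), sq (h + d ^ 2)]
        have : (0:ℝ) ≤ (1 + d ^ 2) ^ (2 * Q) := by positivity
        have h2 : (h + d ^ 2) * (h + d ^ 2) ≤ (h + d ^ 2) * (1 + d ^ 2) :=
          mul_le_mul_of_nonneg_left (by linarith) (by linarith)
        nlinarith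
      have hx : (1 + x + B * r) ^ 2 ≤ 1 + 2 * x + R d := by
        have : R d = 2 * B * r + 2 * B ^ 2 * (h + d ^ 2)
            + 2 * B ^ 2 * ((h + d ^ 2) * (1 + d ^ 2) ^ (2 * Q + 1)) := by
          simp only [hR, hr, pow_zero, mul_one]
        rw [this]
        have : B ^ 2 * r ^ 2 ≤ B ^ 2 * ((h + d ^ 2) * (1 + d ^ 2) ^ (2 * Q + 1)) :=
          mul_le_mul_of_nonneg_left hr2 (sq_nonneg B)
        nlinarith [sq_nonneg (x - B * r)]
      have := mul_le_mul_of_nonneg_left hx (sq_nonneg (S k ω))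
      calc _ ≤ _ := this
        _ = _ := by ring
    have hle' := past_le hD (k + 1)
    have hle0 := past_le hD k
    have hDk : Measurable[past D (k + 1)] (D k) := measurable_past (Nat.lt_succ_self k)
    have hSm : Measurable[past D (k + 1)] (S (k + 1)) := by
      have e : S (k + 1) = fun ω ↦ S k ω * (1 + a k ω * D k ω
        + B * ((h + D k ω ^ 2) * (1 + D k ω ^ 2) ^ Q)) := funext (hS k hkN)
      rw [e]
      have m1 := hm.mono (past_mono D (Nat.le_succ k)) le_rfl
      have m2 := (ha k hkN).mono (past_mono D (Nat.le_succ k)) le_rfl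
      have hg : Measurable fun d : ℝ ↦ B * ((h + d ^ 2) * (1 + d ^ 2) ^ Q) := by fun_prop
      exact m1.mul ((measurable_const.add (m2.mul hDk)).add (hg.comp hDk))
    have hm2 : Measurable[past D k] fun ω ↦ S k ω ^ 2 := hm.pow_const 2
    have hma : Measurable[past D k] fun ω ↦ S k ω ^ 2 * (2 * a k ω) :=
      hm2.mul ((ha k hkN).const_mul 2)
    have ind1 := indepFun_of_past (hN.indep k hkN) hma
    have ind2 : IndepFun (fun ω ↦ S k ω ^ 2) (fun ω ↦ R (D k ω)) P :=
      (indepFun_of_past (hN.indep k hkN) hm2).comp measurable_id hRm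
    have hia : Integrable (fun ω ↦ S k ω ^ 2 * (2 * a k ω)) P := by
      refine hI.mul_bdd (c := 2 * B)
        (((ha k hkN).mono hle0 le_rfl).const_mul 2).aestronglyMeasurable (ae_of_all _ fun ω ↦ ?_)
      rw [norm_mul, Real.norm_eq_abs, Real.norm_eq_abs, abs_two]
      linarith [haB k hkN ω]
    have hDi := hN.integrable_self hkN
    have i1 : Integrable (fun ω ↦ (S k ω ^ 2 * (2 * a k ω)) * D k ω) P :=
      ind1.integrable_mul hia hDi
    have i2 : Integrable (fun ω ↦ S k ω ^ 2 * R (D k ω)) P := ind2.integrable_mul hI hRi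
    have itot : Integrable (fun ω ↦ S k ω ^ 2 + (S k ω ^ 2 * (2 * a k ω)) * D k ω
      + S k ω ^ 2 * R (D k ω)) P := (hI.add i1).add i2
    have hInew : Integrable (fun ω ↦ S (k + 1) ω ^ 2) P := by
      refine itot.mono' ((hSm.mono hle' le_rfl).pow_const 2).aestronglyMeasurable
        (ae_of_all _ fun ω ↦ ?_)
      rw [Real.norm_of_nonneg (sq_nonneg _)]
      exact hpt ω
    refine ⟨hSm, hInew, ?_⟩
    have hS2 : 0 ≤ ∫ ω, S k ω ^ 2 ∂P := integral_nonneg fun ω ↦ sq_nonneg _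
    have hRnn : 0 ≤ ∫ ω, R (D k ω) ∂P := integral_nonneg fun ω ↦ by
      simp only [hR, Pi.zero_apply]; positivity
    calc ∫ ω, S (k + 1) ω ^ 2 ∂P ≤ _ := integral_mono hInew itot hpt
      _ = (∫ ω, S k ω ^ 2 ∂P) * (1 + ∫ ω, R (D k ω) ∂P) := by
        rw [integral_add (f := fun ω ↦ S k ω ^ 2 + S k ω ^ 2 * (2 * a k ω) * D k ω) (hI.add i1) i2,
          integral_add hI i1,
          ind1.integral_fun_mul_eq_mul_integral hia.aestronglyMeasurable hDi.aestronglyMeasurable,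
          ind2.integral_fun_mul_eq_mul_integral hI.aestronglyMeasurable hRi.aestronglyMeasurable,
          hN.mean k hkN]
        ring
      _ ≤ (1 + C * h) ^ k * (1 + C * h) := by
        gcongr
        exact hS2.trans hle
      _ = _ := (pow_succ _ _).symm

end

/-! ### Moments of an abstract implicit scheme -/

section

theorem sq_div_le {A z s : ℝ} (hs : s ^ 2 ≤ A * (1 + z ^ 2)) : (z * s / (1 + z ^ 2)) ^ 2 ≤ A := by
  have hv : 0 < 1 + z ^ 2 := by positivity
  rw [div_pow, div_le_iff₀ (by positivity), mul_pow]
  have h2 : 0 ≤ s ^ 2 := sq_nonneg s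
  nlinarith [mul_le_mul_of_nonneg_right hs hv.le]

/-- Growth of `1 + z²` in one implicit step from `z` to `z'`. The implicit drift contributes
`2 h z' bz ≤ 2 h (a₀ + β z'²)`, which is absorbed in the left-hand side because `4 β h ≤ 1`, and the
diffusion contributes a term linear in the noise `d` with bounded coefficient. -/
theorem one_add_sq_le_of_step {a₀ β A h z z' s d bz : ℝ} (ha₀ : 0 ≤ a₀) (hβ : 0 ≤ β)
    (hh : 0 < h) (h1 : h ≤ 1) (hβh : 4 * β * h ≤ 1) (hb : z' * bz ≤ a₀ + β * z' ^ 2)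
    (hs : s ^ 2 ≤ A * (1 + z ^ 2)) (hstep : z' = z + bz * h + s * d) :
    1 + z' ^ 2 ≤ (1 + z ^ 2) * (1 + 2 * (z * s / (1 + z ^ 2)) * d
      + (1 + 2 * A + 2 * a₀ + 4 * β * (1 + A + 2 * a₀)) * (d ^ 2 + h)) := by
  have hv : 0 < 1 + z ^ 2 := by positivity
  have ha2 := sq_div_le hs
  have hA : 0 ≤ A := (sq_nonneg _).trans ha2
  set a := z * s / (1 + z ^ 2) with ha
  have hav : a * (1 + z ^ 2) = z * s := div_mul_cancel₀ _ hv.ne'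
  set y := 1 + 2 * a * d + A * d ^ 2 + 2 * a₀ * h with hy
  have e0 : (z + s * d) ^ 2 = (z' - bz * h) ^ 2 := by rw [hstep]; ring
  -- Squaring `z' - bz * h = z + s * d` and dropping `(bz * h) ^ 2` controls the implicit drift.
  have e1 : z' ^ 2 ≤ (z + s * d) ^ 2 + 2 * h * (a₀ + β * z' ^ 2) := by
    rw [e0]; nlinarith [sq_nonneg (bz * h), mul_le_mul_of_nonneg_left hb hh.le]
  have e2 : (z + s * d) ^ 2 + 1 ≤ (1 + z ^ 2) * (1 + 2 * a * d + A * d ^ 2) := by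
    have : s ^ 2 * d ^ 2 ≤ A * (1 + z ^ 2) * d ^ 2 := mul_le_mul_of_nonneg_right hs (sq_nonneg d)
    have : (1 + z ^ 2) * (2 * a * d) = 2 * z * s * d := by linear_combination 2 * d * hav
    nlinarith
  have e3 : (1 + z' ^ 2) * (1 - 2 * β * h) ≤ (1 + z ^ 2) * y := by
    have : 2 * a₀ * h ≤ (1 + z ^ 2) * (2 * a₀ * h) :=
      le_mul_of_one_le_left (by positivity) (by nlinarith [sq_nonneg z])
    have : 0 ≤ β * h := by positivity
    nlinarith
  have hβh0 : 0 ≤ β * h := by positivity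
  have e4 : (1:ℝ) ≤ (1 - 2 * β * h) * (1 + 4 * β * h) := by nlinarith
  have hlin : 2 * a * d ≤ A + d ^ 2 := by nlinarith [sq_nonneg (a - d)]
  have hlast : y * (1 + 4 * β * h) ≤ 1 + 2 * a * d
      + (1 + 2 * A + 2 * a₀ + 4 * β * (1 + A + 2 * a₀)) * (d ^ 2 + h) := by
    have hy' : y ≤ 1 + A + 2 * a₀ + (1 + A) * d ^ 2 := by
      have := mul_le_mul_of_nonneg_left h1 (by positivity : 0 ≤ 2 * a₀)
      linarith
    have h2 := mul_le_mul_of_nonneg_right hy' (by linarith : 0 ≤ 4 * β * h)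
    have h3 := mul_le_mul_of_nonneg_left hβh (by positivity : 0 ≤ (1 + A) * d ^ 2)
    have : 0 ≤ a₀ * d ^ 2 := by positivity
    have : 0 ≤ A * h := by positivity
    have : 0 ≤ β * (1 + A + 2 * a₀) * d ^ 2 := by positivity
    nlinarith
  calc 1 + z' ^ 2 ≤ (1 + z' ^ 2) * ((1 - 2 * β * h) * (1 + 4 * β * h)) :=
        le_mul_of_one_le_right (by positivity) e4
    _ = (1 + z' ^ 2) * (1 - 2 * β * h) * (1 + 4 * β * h) := by ring
    _ ≤ (1 + z ^ 2) * y * (1 + 4 * β * h) :=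
        mul_le_mul_of_nonneg_right e3 (by linarith)
    _ = (1 + z ^ 2) * (y * (1 + 4 * β * h)) := by ring
    _ ≤ _ := mul_le_mul_of_nonneg_left hlast hv.le

theorem one_add_le_of_sq_le {A h a d : ℝ} (hA : 0 ≤ A) (h1 : h ≤ 1) (ha : a ^ 2 ≤ A) :
    1 + 2 * a * d + A * (d ^ 2 + h) ≤ (1 + 2 * A) * (1 + d ^ 2) := by
  have := mul_le_mul_of_nonneg_left h1 hA
  nlinarith [sq_nonneg (a - d), mul_nonneg hA (sq_nonneg d)]

/-- Expansion of the `q`-th power of the one-step growth factor: the term linear in `d` is kept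
exactly, and everything else is of the order `(h + d²) (1 + d²) ^ q`. -/
theorem exists_pow_le {A : ℝ} (hA : 0 ≤ A) (q : ℕ) :
    ∃ C, 0 ≤ C ∧ ∀ h a d : ℝ, 0 < h → h ≤ 1 → a ^ 2 ≤ A →
      0 ≤ 1 + 2 * a * d + A * (d ^ 2 + h) →
      (1 + 2 * a * d + A * (d ^ 2 + h)) ^ q ≤
        1 + (2 * q * a) * d + C * ((h + d ^ 2) * (1 + d ^ 2) ^ q) := by
  induction q with
  | zero =>
    refine ⟨0, le_rfl, fun h a d _ _ _ _ ↦ by simp⟩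
  | succ q ih =>
    obtain ⟨C, hC, ih⟩ := ih
    refine ⟨A + 4 * q * A + q * A * (A + 1) + C * (1 + 2 * A), by positivity,
      fun h a d h0 h1 ha hx ↦ ?_⟩
    have hup := one_add_le_of_sq_le (d := d) hA h1 ha
    have hq : (0:ℝ) ≤ q := Nat.cast_nonneg q
    have h2 := mul_le_mul_of_nonneg_left (ih h a d h0 h1 ha hx) hx
    rw [pow_succ', Nat.cast_succ]
    refine h2.trans ?_
    set x := 2 * a * d + A * (d ^ 2 + h) with hxdef
    set r := h + d ^ 2 with hr
    have hr0 : 0 ≤ r := by positivity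
    have hp : (1:ℝ) ≤ (1 + d ^ 2) ^ q := one_le_pow₀ (by nlinarith [sq_nonneg d])
    set p := (1 + d ^ 2) ^ q with hpdef
    have hd2 : (0:ℝ) ≤ d ^ 2 := sq_nonneg d
    have hr1 : r * (1 + d ^ 2) ≤ r * ((1 + d ^ 2) ^ (q + 1)) := by
      rw [pow_succ _ q, ← hpdef]
      refine mul_le_mul_of_nonneg_left ?_ hr0
      nlinarith
    have hr2 : r ≤ r * (1 + d ^ 2) := le_mul_of_one_le_right hr0 (by linarith)
    have e1 : 2 * a * d * x ≤ 4 * A * r + A * (A + 1) * (r * (1 + d ^ 2)) := by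
      have i1 : a ^ 2 * d ^ 2 ≤ A * d ^ 2 := mul_le_mul_of_nonneg_right ha hd2
      have i2 : 2 * a * d ≤ (A + 1) * (1 + d ^ 2) := by
        nlinarith [sq_nonneg (a - d), mul_nonneg hA hd2]
      have i3 := mul_le_mul_of_nonneg_right i2 (mul_nonneg hA hr0)
      have i4 : A * d ^ 2 ≤ A * r := mul_le_mul_of_nonneg_left (by rw [hr]; linarith) hA
      have : 2 * a * d * x = 4 * (a ^ 2 * d ^ 2) + 2 * a * d * (A * r) := by rw [hxdef, hr]; ring
      rw [this]; nlinarith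
    have e2 : (1 + 2 * a * d + A * (d ^ 2 + h)) * (C * (r * p)) ≤
        C * (1 + 2 * A) * (r * (1 + d ^ 2) ^ (q + 1)) := by
      have := mul_le_mul_of_nonneg_right hup (by positivity : 0 ≤ C * (r * p))
      rw [pow_succ _ q, ← hpdef]
      linarith
    have e3 : A * r ≤ A * (r * (1 + d ^ 2) ^ (q + 1)) :=
      mul_le_mul_of_nonneg_left (hr2.trans hr1) hA
    have e4 := mul_le_mul_of_nonneg_left e1 hq
    have e5 : (q:ℝ) * (A * (A + 1) * (r * (1 + d ^ 2))) ≤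
        q * (A * (A + 1) * (r * (1 + d ^ 2) ^ (q + 1))) := by gcongr
    have e6 : (q:ℝ) * (4 * A * r) ≤ q * (4 * A * (r * (1 + d ^ 2) ^ (q + 1))) := by
      have := hr2.trans hr1
      gcongr
    have : (1 + 2 * a * d + A * (d ^ 2 + h)) * (1 + 2 * q * a * d + C * (r * p)) =
        1 + (2 * (q + 1) * a) * d + A * r + q * (2 * a * d * x)
          + (1 + 2 * a * d + A * (d ^ 2 + h)) * (C * (r * p)) := by rw [hxdef, hr]; ring
    rw [this]
    linarith

theorem prod_le_sum_pow {N : ℕ} (hN : 0 < N) {x : ℕ → ℝ} (hx : ∀ i, 0 ≤ x i) :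
    ∏ i ∈ Finset.range N, x i ≤ ∑ i ∈ Finset.range N, x i ^ N := by
  obtain ⟨j, hj, hmax⟩ := Finset.exists_max_image (Finset.range N) x ⟨0, Finset.mem_range.2 hN⟩
  calc ∏ i ∈ Finset.range N, x i ≤ ∏ _i ∈ Finset.range N, x j :=
        Finset.prod_le_prod (fun i _ ↦ hx i) hmax
    _ = x j ^ N := by simp
    _ ≤ _ := Finset.single_le_sum (f := fun i ↦ x i ^ N) (fun i _ ↦ pow_nonneg (hx i) N) hj

/-- Applied to `y ↦ y - h * bt y`, this makes an implicit scheme explicit, and hence adapted. -/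
theorem exists_measurable_leftInverse {f : ℝ → ℝ} (hf : StrictMono f) :
    ∃ g : ℝ → ℝ, Measurable g ∧ ∀ y, g (f y) = y := by
  have he : MeasurableEmbedding f := hf.monotone.measurable.measurableEmbedding hf.injective
  obtain ⟨g, hg, hgf⟩ := he.exists_measurable_extend measurable_id fun _ ↦ ⟨0⟩
  exact ⟨g, hg, fun y ↦ congrFun hgf y⟩

variable {Ω : Type*} [mΩ : MeasurableSpace Ω] {P : Measure Ω}

theorem IsNoise.integral_one_add_sq_pow_le [IsProbabilityMeasure P] {N : ℕ} {h : ℝ} {K : ℕ → ℝ}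
    {D : ℕ → Ω → ℝ} (hN : IsNoise P N h K D) (h0 : 0 < h) (h1 : h ≤ 1) {k : ℕ} (hk : k < N)
    (Q : ℕ) : ∫ ω, (1 + D k ω ^ 2) ^ Q ∂P ≤ 1 + ∑ i ∈ Finset.range Q, |K i| := by
  induction Q with
  | zero => simp
  | succ Q ih =>
    have e : ∫ ω, (1 + D k ω ^ 2) ^ (Q + 1) ∂P = ∫ ω, (h + D k ω ^ 2) * (1 + D k ω ^ 2) ^ Q ∂P
        + (1 - h) * ∫ ω, (1 + D k ω ^ 2) ^ Q ∂P := by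
      rw [← integral_const_mul, ← integral_add (hN.integrable_weight hk Q)
        ((hN.integrable k hk Q).const_mul _)]
      refine integral_congr_ae (ae_of_all _ fun ω ↦ ?_)
      simp only
      ring
    have hnn : 0 ≤ ∫ ω, (1 + D k ω ^ 2) ^ Q ∂P := integral_nonneg fun ω ↦ by
      simp only [Pi.zero_apply]; positivity
    have hm := hN.moment k hk Q
    have hK : K Q * h ≤ |K Q| := by nlinarith [le_abs_self (K Q), abs_nonneg (K Q)]
    rw [e, Finset.sum_range_succ]
    nlinarith

/-- The moment bound for an adapted process `Z` such that `1 + Z²` grows in each step by a factor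
`1 + 2 a D + O(D² + h)`: the power `(1 + Z²) ^ q` is dominated by a product of nonnegative factors
`F k`, which is a submartingale, so that Doob's inequality applies. The bound depends on `N` and `h`
only through `T = N h`. -/
theorem IsNoise.exists_lintegral_iSup_le_of_adapted.{u} (K : ℕ → ℝ) {A : ℝ} (hA : 0 ≤ A) (q : ℕ)
    (z₀ T : ℝ) :
    ∃ C : ℝ, ∀ (Ω : Type u) [MeasurableSpace Ω] (P : Measure Ω) [IsProbabilityMeasure P]
      (N : ℕ) (h : ℝ) (D : ℕ → Ω → ℝ), 0 < h → h ≤ 1 → N * h = T → IsNoise P N h K D →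
      (∀ k, Measurable (D k)) → ∀ (Z : ℕ → Ω → ℝ) (a : ℝ → ℝ), Measurable a →
      (∀ x, a x ^ 2 ≤ A) → (∀ k ≤ N, Measurable[past D k] (Z k)) → (∀ ω, Z 0 ω = z₀) →
      (∀ k < N, ∀ᵐ ω ∂P, 1 + Z (k + 1) ω ^ 2 ≤ (1 + Z k ω ^ 2) *
        (1 + 2 * a (Z k ω) * D k ω + A * (D k ω ^ 2 + h))) →
      ∫⁻ ω, ⨆ k : Fin (N + 1), ENNReal.ofReal ((1 + Z k ω ^ 2) ^ (2 * q)) ∂P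
        ≤ ENNReal.ofReal C := by
  obtain ⟨Cq, hCq, hpow⟩ := exists_pow_le hA q
  set B : ℝ := Cq + 2 * q * (1 + A) + q ^ 2 * A with hBdef
  have hB : 0 ≤ B := by positivity
  set Λ : ℝ := 2 * B * K q + 2 * B ^ 2 * K 0 + 2 * B ^ 2 * K (2 * q + 1) with hΛ
  refine ⟨(1 + z₀ ^ 2) ^ (2 * q) * (4 * Real.exp (|Λ| * T)), ?_⟩
  intro Ω _ P _ N h D h0 h1 hNT hN hD Z a ham haA hZm hZ0 hstep
  let F : ℕ → Ω → ℝ := fun k ω ↦ 1 + (2 * q * a (Z k ω)) * D k ω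
    + B * ((h + D k ω ^ 2) * (1 + D k ω ^ 2) ^ q)
  have hρ : ∀ d : ℝ, d ^ 2 ≤ (h + d ^ 2) * (1 + d ^ 2) ^ q := fun d ↦ by
    have h2 : (1:ℝ) ≤ (1 + d ^ 2) ^ q := one_le_pow₀ (by nlinarith [sq_nonneg d])
    nlinarith [sq_nonneg d, mul_nonneg h0.le (sub_nonneg.2 h2)]
  -- `B ≥ q² A` makes `F k` at least the perfect square `(1 + q a (D k))²`.
  have hF0 : ∀ k ω, 0 ≤ F k ω := fun k ω ↦ by
    have e1 := mul_le_mul_of_nonneg_left (hρ (D k ω)) hB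
    have e2 : (q:ℝ) ^ 2 * a (Z k ω) ^ 2 ≤ B := by
      have := mul_le_mul_of_nonneg_left (haA (Z k ω)) (sq_nonneg (q:ℝ))
      have : 0 ≤ 2 * q * (1 + A) := by positivity
      rw [hBdef]; linarith
    have e3 := mul_le_mul_of_nonneg_right e2 (sq_nonneg (D k ω))
    simp only [F]
    nlinarith [sq_nonneg (1 + q * a (Z k ω) * D k ω)]
  -- `S` is stopped at `N`, as the hypotheses say nothing about `Z k` and `D k` beyond.
  let S : ℕ → Ω → ℝ := fun k ω ↦ ∏ i ∈ Finset.range (min k N), F i ω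
  have hS0 : ∀ k ω, 0 ≤ S k ω := fun k ω ↦ Finset.prod_nonneg fun i _ ↦ hF0 i ω
  have hSs : ∀ k < N, ∀ ω, S (k + 1) ω = S k ω * F k ω := fun k hk ω ↦ by
    simp only [S]
    rw [min_eq_left hk, min_eq_left hk.le, Finset.prod_range_succ]
  have ham' : ∀ k < N, Measurable[past D k] fun ω ↦ 2 * q * a (Z k ω) := fun k hk ↦
    (ham.comp (hZm k hk.le)).const_mul _
  have haB : ∀ k < N, ∀ ω, |2 * q * a (Z k ω)| ≤ B := fun k _ ω ↦ by
    have e1 : |a (Z k ω)| ≤ 1 + A := by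
      have := haA (Z k ω)
      rw [abs_le]; constructor <;> nlinarith [sq_nonneg (a (Z k ω) - 1), sq_nonneg (a (Z k ω) + 1)]
    rw [abs_mul, abs_of_nonneg (by positivity : (0:ℝ) ≤ 2 * q)]
    have := mul_le_mul_of_nonneg_left e1 (by positivity : (0:ℝ) ≤ 2 * q)
    have : 0 ≤ (q:ℝ) ^ 2 * A := by positivity
    rw [hBdef]; linarith
  have hgrow := hN.integral_sq_prod_le hD h0 h1 hB q (S := S) (a := fun k ω ↦ 2 * q * a (Z k ω))
    (fun ω ↦ by simp [S]) ham' haB hSs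
  have hSL2 : ∀ k ≤ N, MemLp (S k) 2 P := fun k hk ↦
    (memLp_two_iff_integrable_sq
      ((hgrow k hk).1.mono (past_le hD k) le_rfl).aestronglyMeasurable).2 (hgrow k hk).2.1
  obtain ⟨hM2, hMle⟩ := integral_sq_partialSups_le (S := S)
    (a := fun k ω ↦ S k ω * (2 * q * a (Z k ω))) hD hN.indep
    (fun k hk ↦ hN.integrable_self hk) hN.mean (fun k hk ↦ (hgrow k hk).1)
    (fun k hk ↦ (hgrow k hk.le).1.mul (ham' k hk)) hS0 hSL2
    (fun k hk ↦ by
      refine (hSL2 k hk.le).of_le_mul (c := B) ?_ (ae_of_all _ fun ω ↦ ?_)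
      · exact (((hgrow k hk.le).1.mul (ham' k hk)).mono (past_le hD k) le_rfl).aestronglyMeasurable
      · rw [norm_mul, mul_comm]
        exact mul_le_mul_of_nonneg_right (haB k hk ω) (norm_nonneg _))
    (fun k hk ω ↦ by
      rw [hSs k hk]
      have e1 := (sq_nonneg _).trans (hρ (D k ω))
      have := mul_nonneg (hS0 k ω) (mul_nonneg hB e1)
      simp only [F]
      linarith)
  have hall : ∀ᵐ ω ∂P, ∀ k < N, 1 + Z (k + 1) ω ^ 2 ≤ (1 + Z k ω ^ 2) *
        (1 + 2 * a (Z k ω) * D k ω + A * (D k ω ^ 2 + h)) := by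
    rw [ae_all_iff]
    intro k
    by_cases hk : k < N
    · filter_upwards [hstep k hk] with ω hω _ using hω
    · exact ae_of_all _ fun ω h ↦ absurd h hk
  have hdom : ∀ᵐ ω ∂P, ∀ k ≤ N, (1 + Z k ω ^ 2) ^ q ≤ (1 + z₀ ^ 2) ^ q * S k ω := by
    filter_upwards [hall] with ω hω k
    induction k with
    | zero => intro _; simp [S, hZ0]
    | succ k ih =>
      intro hk
      have hkN : k < N := hk
      have hs := hω k hkN
      have hv : 0 < 1 + Z k ω ^ 2 := by positivity
      have hx : 0 ≤ 1 + 2 * a (Z k ω) * D k ω + A * (D k ω ^ 2 + h) := by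
        by_contra hneg
        have := mul_neg_of_pos_of_neg hv (not_le.1 hneg)
        nlinarith [sq_nonneg (Z (k + 1) ω)]
      have e1 := hpow h _ (D k ω) h0 h1 (haA (Z k ω)) hx
      have e2 : 1 + (2 * q * a (Z k ω)) * D k ω + Cq * ((h + D k ω ^ 2) * (1 + D k ω ^ 2) ^ q)
          ≤ F k ω := by
        have e1 := (sq_nonneg _).trans (hρ (D k ω))
        have : Cq ≤ B := by
          have : 0 ≤ 2 * q * (1 + A) + q ^ 2 * A := by positivity
          rw [hBdef]; linarith
        simp only [F]
        gcongr
      calc (1 + Z (k + 1) ω ^ 2) ^ q ≤ _ := pow_le_pow_left₀ (by positivity) hs q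
        _ ≤ (1 + Z k ω ^ 2) ^ q * F k ω := by
          rw [mul_pow]
          exact mul_le_mul_of_nonneg_left (e1.trans e2) (by positivity)
        _ ≤ (1 + z₀ ^ 2) ^ q * S k ω * F k ω := mul_le_mul_of_nonneg_right (ih hkN.le) (hF0 k ω)
        _ = _ := by rw [hSs k hkN, mul_assoc]
  calc ∫⁻ ω, ⨆ k : Fin (N + 1), ENNReal.ofReal ((1 + Z k ω ^ 2) ^ (2 * q)) ∂P
      ≤ ∫⁻ ω, ENNReal.ofReal ((1 + z₀ ^ 2) ^ (2 * q) * (partialSups (S · ω) N) ^ 2) ∂P := by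
        refine lintegral_mono_ae ?_
        filter_upwards [hdom] with ω hω
        refine iSup_le fun k ↦ ENNReal.ofReal_le_ofReal ?_
        rw [mul_comm 2 q, pow_mul, pow_mul, ← mul_pow]
        refine pow_le_pow_left₀ (by positivity) ((hω k (by omega)).trans ?_) 2
        exact mul_le_mul_of_nonneg_left (le_partialSups_of_le (S · ω) (by omega : (k:ℕ) ≤ N))
          (by positivity)
    _ = ENNReal.ofReal (∫ ω, (1 + z₀ ^ 2) ^ (2 * q) * (partialSups (S · ω) N) ^ 2 ∂P) :=
        (ofReal_integral_eq_lintegral_ofReal (hM2.integrable_sq.const_mul _)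
          (ae_of_all _ fun ω ↦ by simp only [Pi.zero_apply]; positivity)).symm
    _ ≤ _ := by
        refine ENNReal.ofReal_le_ofReal ?_
        rw [integral_const_mul]
        refine mul_le_mul_of_nonneg_left (hMle.trans ?_) (by positivity)
        refine mul_le_mul_of_nonneg_left ((hgrow N le_rfl).2.2.trans ?_) (by norm_num)
        have hb : |1 + Λ * h| ≤ Real.exp (|Λ| * h) := by
          refine (abs_add_le _ _).trans ?_
          rw [abs_one, abs_mul, abs_of_pos h0, add_comm]
          exact Real.add_one_le_exp (|Λ| * h)
        calc (1 + Λ * h) ^ N ≤ |1 + Λ * h| ^ N := (le_abs_self _).trans_eq (abs_pow _ _)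
          _ ≤ Real.exp (|Λ| * h) ^ N := pow_le_pow_left₀ (abs_nonneg _) hb N
          _ = Real.exp (|Λ| * T) := by rw [← Real.exp_nat_mul, ← hNT]; ring_nf

/-- A bound for a fixed number `N` of steps that does not need `Z` to be adapted: each step
multiplies `1 + Z²` by at most `O(1 + (D k)²)`. -/
theorem IsNoise.exists_lintegral_iSup_le_of_steps.{u} (K : ℕ → ℝ) {A : ℝ} (hA : 0 ≤ A) (q : ℕ)
    (z₀ : ℝ) {N : ℕ} (hNpos : 0 < N) :
    ∃ C : ℝ, 0 ≤ C ∧ ∀ (Ω : Type u) [MeasurableSpace Ω] (P : Measure Ω) [IsProbabilityMeasure P]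
      (h : ℝ) (D : ℕ → Ω → ℝ), 0 < h → h ≤ 1 → IsNoise P N h K D →
      ∀ (Z : ℕ → Ω → ℝ) (a : ℝ → ℝ), (∀ x, a x ^ 2 ≤ A) → (∀ᵐ ω ∂P, Z 0 ω = z₀) →
      (∀ k < N, ∀ᵐ ω ∂P, 1 + Z (k + 1) ω ^ 2 ≤ (1 + Z k ω ^ 2) *
        (1 + 2 * a (Z k ω) * D k ω + A * (D k ω ^ 2 + h))) →
      ∫⁻ ω, ⨆ k : Fin (N + 1), ENNReal.ofReal ((1 + Z k ω ^ 2) ^ (2 * q)) ∂P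
        ≤ ENNReal.ofReal C := by
  set L : ℝ := ((1 + z₀ ^ 2) * (1 + 2 * A) ^ N) ^ (2 * q) with hL
  have hL0 : 0 ≤ L := by positivity
  refine ⟨L * (N * (1 + ∑ i ∈ Finset.range (2 * q * N), |K i|)), by positivity, ?_⟩
  intro Ω _ P _ h D h0 h1 hN Z a haA hZ0 hstep
  have hall : ∀ᵐ ω ∂P, ∀ k < N, 1 + Z (k + 1) ω ^ 2 ≤ (1 + Z k ω ^ 2) *
        (1 + 2 * a (Z k ω) * D k ω + A * (D k ω ^ 2 + h)) := by
    rw [ae_all_iff]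
    intro k
    by_cases hk : k < N
    · filter_upwards [hstep k hk] with ω hω _ using hω
    · exact ae_of_all _ fun ω h ↦ absurd h hk
  have hdom : ∀ᵐ ω ∂P, ∀ k ≤ N, 1 + Z k ω ^ 2 ≤
      (1 + z₀ ^ 2) * (1 + 2 * A) ^ k * ∏ i ∈ Finset.range k, (1 + D i ω ^ 2) := by
    filter_upwards [hall, hZ0] with ω hω h0ω k
    induction k with
    | zero => intro _; simp [h0ω]
    | succ k ih =>
      intro hk
      calc 1 + Z (k + 1) ω ^ 2 ≤ _ := hω k hk
        _ ≤ (1 + Z k ω ^ 2) * ((1 + 2 * A) * (1 + D k ω ^ 2)) :=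
          mul_le_mul_of_nonneg_left (one_add_le_of_sq_le hA h1 (haA _)) (by positivity)
        _ ≤ ((1 + z₀ ^ 2) * (1 + 2 * A) ^ k * ∏ i ∈ Finset.range k, (1 + D i ω ^ 2)) *
            ((1 + 2 * A) * (1 + D k ω ^ 2)) :=
          mul_le_mul_of_nonneg_right (ih (by omega)) (by positivity)
        _ = _ := by rw [Finset.prod_range_succ, pow_succ]; ring
  have hint : Integrable (fun ω ↦ ∑ i ∈ Finset.range N, (1 + D i ω ^ 2) ^ (2 * q * N)) P :=
    integrable_finsetSum _ fun i hi ↦ hN.integrable i (Finset.mem_range.1 hi) _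
  calc ∫⁻ ω, ⨆ k : Fin (N + 1), ENNReal.ofReal ((1 + Z k ω ^ 2) ^ (2 * q)) ∂P
      ≤ ∫⁻ ω, ENNReal.ofReal (L * ∑ i ∈ Finset.range N, (1 + D i ω ^ 2) ^ (2 * q * N)) ∂P := by
        refine lintegral_mono_ae ?_
        filter_upwards [hdom] with ω hω
        refine iSup_le fun k ↦ ENNReal.ofReal_le_ofReal ?_
        have hkN : (k : ℕ) ≤ N := by omega
        have e1 : 1 + Z k ω ^ 2 ≤
            (1 + z₀ ^ 2) * (1 + 2 * A) ^ N * ∏ i ∈ Finset.range N, (1 + D i ω ^ 2) := by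
          refine (hω k hkN).trans ?_
          have p1 : (1 + 2 * A) ^ (k : ℕ) ≤ (1 + 2 * A) ^ N :=
            pow_le_pow_right₀ (by linarith) hkN
          have p2 : ∏ i ∈ Finset.range k, (1 + D i ω ^ 2) ≤
              ∏ i ∈ Finset.range N, (1 + D i ω ^ 2) :=
            Finset.prod_le_prod_of_subset_of_one_le (Finset.range_mono hkN)
              (fun i _ ↦ by positivity) fun i _ _ ↦ by nlinarith [sq_nonneg (D i ω)]
          gcongr
        refine (pow_le_pow_left₀ (by positivity) e1 _).trans ?_
        rw [mul_pow, ← Finset.prod_pow]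
        refine mul_le_mul_of_nonneg_left ((prod_le_sum_pow hNpos fun i ↦ by positivity).trans_eq ?_)
          hL0
        exact Finset.sum_congr rfl fun i _ ↦ (pow_mul _ _ _).symm
    _ = ENNReal.ofReal (∫ ω, L * ∑ i ∈ Finset.range N, (1 + D i ω ^ 2) ^ (2 * q * N) ∂P) :=
        (ofReal_integral_eq_lintegral_ofReal (hint.const_mul _)
          (ae_of_all _ fun ω ↦ by simp only [Pi.zero_apply]; positivity)).symm
    _ ≤ _ := by
        refine ENNReal.ofReal_le_ofReal ?_
        rw [integral_const_mul, integral_finsetSum _ fun i hi ↦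
          hN.integrable i (Finset.mem_range.1 hi) _]
        refine mul_le_mul_of_nonneg_left ?_ hL0
        refine (Finset.sum_le_sum fun i hi ↦ hN.integral_one_add_sq_pow_le h0 h1
          (Finset.mem_range.1 hi) (2 * q * N)).trans_eq ?_
        rw [Finset.sum_const, Finset.card_range, nsmul_eq_mul]

/-- The moment bound for the implicit scheme `Z' = Z + bt(Z') h + st(Z) D` driven by a noise.

If `L T < N`, where `L` is the one-sided Lipschitz constant of `bt`, then the implicit equation has
at most one solution, so `Z` is adapted to the noise. For the finitely many remaining `N`, where
solutions need not be unique and `Z` may anticipate the noise, the pathwise bound suffices. -/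
theorem exists_lintegral_iSup_implicitScheme_le.{u} (K : ℕ → ℝ) {bt st : ℝ → ℝ}
    (hst : Measurable st) {a₀ β A L T : ℝ} (ha₀ : 0 ≤ a₀) (hβ : 0 ≤ β) (hT : 0 < T)
    (hb : ∀ z, z * bt z ≤ a₀ + β * z ^ 2) (hs : ∀ z, st z ^ 2 ≤ A * (1 + z ^ 2))
    (hL : ∀ x y, x ≤ y → bt y - bt x ≤ L * (y - x)) (z₀ : ℝ) (q : ℕ) :
    ∃ C : ℝ, 0 ≤ C ∧ ∀ (Ω : Type u) [MeasurableSpace Ω] (P : Measure Ω)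
      [IsProbabilityMeasure P] (N : ℕ) (D : ℕ → Ω → ℝ), T < N → 4 * β * T < N →
      IsNoise P N (T / N) K D → ∀ Z : ℕ → Ω → ℝ, (∀ᵐ ω ∂P, Z 0 ω = z₀) →
      (∀ k < N, ∀ᵐ ω ∂P, Z (k + 1) ω = Z k ω + bt (Z (k + 1) ω) * (T / N)
        + st (Z k ω) * D k ω) →
      ∫⁻ ω, ⨆ k : Fin (N + 1), ENNReal.ofReal ((1 + Z k ω ^ 2) ^ (2 * q)) ∂P
        ≤ ENNReal.ofReal C := by
  have hA : 0 ≤ A := by have := (sq_nonneg _).trans (hs 0); simpa using this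
  set A' : ℝ := 1 + 2 * A + 2 * a₀ + 4 * β * (1 + A + 2 * a₀) with hA'
  have hA'0 : 0 ≤ A' := by positivity
  have hAA' : A ≤ A' := by
    have : 0 ≤ 4 * β * (1 + A + 2 * a₀) := by positivity
    rw [hA']; linarith
  let a : ℝ → ℝ := fun z ↦ z * st z / (1 + z ^ 2)
  have ham : Measurable a := by
    have h1 : Measurable fun z : ℝ ↦ 1 + z ^ 2 := by fun_prop
    exact (measurable_id.mul hst).div h1
  have haA : ∀ z, a z ^ 2 ≤ A' := fun z ↦ (sq_div_le (hs z)).trans hAA'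
  have hsteps := fun N : ℕ ↦
    fun hN : 0 < N ↦ IsNoise.exists_lintegral_iSup_le_of_steps.{u} K hA'0 q z₀ hN
  choose! C₁ hC₁ hC₁' using hsteps
  obtain ⟨C₂, hC₂⟩ := IsNoise.exists_lintegral_iSup_le_of_adapted.{u} K hA'0 q z₀ T
  obtain ⟨N₀, hN₀⟩ := exists_nat_gt (L * T)
  refine ⟨(∑ N ∈ Finset.range N₀, |C₁ N|) + |C₂|, by positivity, ?_⟩
  intro Ω _ P _ N D hTN hβN hN Z hZ0 hstep
  have hNpos : (0:ℝ) < N := hT.trans hTN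
  have hNpos' : 0 < N := by exact_mod_cast hNpos
  set h : ℝ := T / N with hh
  have h0 : 0 < h := div_pos hT hNpos
  have h1 : h ≤ 1 := ((div_lt_one hNpos).2 hTN).le
  have hNh : N * h = T := mul_div_cancel₀ T hNpos.ne'
  have hβh : 4 * β * h ≤ 1 := by
    rw [hh, ← mul_div_assoc]; exact ((div_lt_one hNpos).2 hβN).le
  have hgrow : ∀ k < N, ∀ᵐ ω ∂P, 1 + Z (k + 1) ω ^ 2 ≤ (1 + Z k ω ^ 2) *
        (1 + 2 * a (Z k ω) * D k ω + A' * (D k ω ^ 2 + h)) := fun k hk ↦ by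
    filter_upwards [hstep k hk] with ω hω
    exact one_add_sq_le_of_step ha₀ hβ h0 h1 hβh (hb _) (hs _) hω
  rcases lt_or_ge N N₀ with hlt | hge
  · refine (hC₁' N hNpos' Ω P h D h0 h1 hN Z a haA hZ0 hgrow).trans (ENNReal.ofReal_le_ofReal ?_)
    have := Finset.single_le_sum (f := fun N ↦ |C₁ N|) (fun i _ ↦ abs_nonneg _)
      (Finset.mem_range.2 hlt)
    have := le_abs_self (C₁ N)
    have := abs_nonneg C₂
    linarith
  · obtain ⟨D', hD', hDD', hN'⟩ := hN.exists_measurable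
    have hLh : L * h < 1 := by
      rw [hh, ← mul_div_assoc, div_lt_one hNpos]
      exact hN₀.trans_le (by exact_mod_cast hge)
    have hmono : StrictMono fun y ↦ y - bt y * h := fun x y hxy ↦ by
      have e1 := mul_le_mul_of_nonneg_right (hL x y hxy.le) h0.le
      have e2 := mul_lt_mul_of_pos_right hLh (sub_pos.2 hxy)
      simp only
      nlinarith
    obtain ⟨g, hg, hgf⟩ := exists_measurable_leftInverse hmono
    let Z' : ℕ → Ω → ℝ := fun k ω ↦
      Nat.rec z₀ (fun j z ↦ g (z + st z * D' j ω)) k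
    have hZ'm : ∀ k ≤ N, Measurable[past D' k] (Z' k) := by
      intro k
      induction k with
      | zero => intro _; exact measurable_const
      | succ k ih =>
        intro hk
        have m1 := (ih (by omega)).mono (past_mono D' (Nat.le_succ k)) le_rfl
        exact hg.comp (m1.add ((hst.comp m1).mul (measurable_past (Nat.lt_succ_self k))))
    have heq : ∀ k ≤ N, Z k =ᵐ[P] Z' k := by
      intro k
      induction k with
      | zero => intro _; exact hZ0
      | succ k ih =>
        intro hk
        filter_upwards [ih (by omega), hstep k hk, hDD' k hk] with ω e1 e2 e3
        have : Z' (k + 1) ω = g (Z' k ω + st (Z' k ω) * D' k ω) := rfl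
        rw [this, ← e1, ← e3, ← hgf (Z (k + 1) ω)]
        congr 1
        linarith
    have hgrow' : ∀ k < N, ∀ᵐ ω ∂P, 1 + Z' (k + 1) ω ^ 2 ≤ (1 + Z' k ω ^ 2) *
        (1 + 2 * a (Z' k ω) * D' k ω + A' * (D' k ω ^ 2 + h)) := fun k hk ↦ by
      filter_upwards [hgrow k hk, heq k hk.le, heq (k + 1) hk, hDD' k hk] with ω e1 e2 e3 e4
      rwa [← e2, ← e3, ← e4]
    have hcongr : ∫⁻ ω, ⨆ k : Fin (N + 1), ENNReal.ofReal ((1 + Z k ω ^ 2) ^ (2 * q)) ∂P =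
        ∫⁻ ω, ⨆ k : Fin (N + 1), ENNReal.ofReal ((1 + Z' k ω ^ 2) ^ (2 * q)) ∂P := by
      refine lintegral_congr_ae ?_
      have : ∀ᵐ ω ∂P, ∀ k : Fin (N + 1), Z k ω = Z' k ω :=
        ae_all_iff.2 fun k ↦ heq k (by omega)
      filter_upwards [this] with ω hω
      simp only [hω]
    rw [hcongr]
    refine (hC₂ Ω P N h D' h0 h1 hNh hN' hD' Z' a ham haA hZ'm (fun _ ↦ rfl) hgrow').trans
      (ENNReal.ofReal_le_ofReal ?_)
    have := Finset.sum_nonneg fun i (_ : i ∈ Finset.range N₀) ↦ abs_nonneg (C₁ i)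
    have := le_abs_self C₂
    linarith

end

/-! ### The bump profile and its derivatives -/

section

/-- The function `max 0 (1 - u²)`, whose cube is `bump`. -/
def cap (u : ℝ) : ℝ := max 0 (1 - u ^ 2)

theorem cap_nonneg (u : ℝ) : 0 ≤ cap u := le_max_left _ _

theorem cap_le_one (u : ℝ) : cap u ≤ 1 := max_le zero_le_one (by nlinarith [sq_nonneg u])

theorem cap_of_abs_le {u : ℝ} (hu : |u| ≤ 1) : cap u = 1 - u ^ 2 :=
  max_eq_right (sub_nonneg.2 ((sq_le_one_iff_abs_le_one u).2 hu))

theorem cap_of_one_le_abs {u : ℝ} (hu : 1 ≤ |u|) : cap u = 0 :=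
  max_eq_left (sub_nonpos.2 ((one_le_sq_iff_one_le_abs u).2 hu))

theorem bump_eq_cap_pow (u : ℝ) : bump u = cap u ^ 3 := by
  unfold bump
  split_ifs with h
  · rw [cap_of_abs_le h]; ring
  · rw [cap_of_one_le_abs (not_le.1 h).le]; norm_num

theorem continuous_cap : Continuous cap := by unfold cap; fun_prop

theorem hasDerivAt_self_mul_abs (t : ℝ) : HasDerivAt (fun t : ℝ ↦ t * |t|) (2 * |t|) t := by
  rcases eq_or_ne t 0 with rfl | ht
  · rw [hasDerivAt_iff_tendsto_slope]
    have : Tendsto (fun t : ℝ ↦ |t|) (𝓝[≠] 0) (𝓝 (2 * |0|)) := by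
      have h : Tendsto (fun t : ℝ ↦ |t|) (𝓝 0) (𝓝 |0|) := continuous_abs.tendsto 0
      simpa using h.mono_left nhdsWithin_le_nhds
    refine this.congr' ?_
    filter_upwards [self_mem_nhdsWithin] with y hy
    rw [slope_def_field]
    simp only [abs_zero, mul_zero, sub_zero]
    field_simp [show y ≠ 0 from hy]
  · refine ((hasDerivAt_id t).mul (hasDerivAt_abs ht)).congr_deriv ?_
    rw [id, self_mul_sign]; ring

theorem hasDerivAt_cap_sq (u : ℝ) : HasDerivAt (fun u ↦ cap u ^ 2) (2 * cap u * (-2 * u)) u := by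
  have e : (fun u ↦ cap u ^ 2) =
      fun u ↦ ((1 - u ^ 2) ^ 2 + (1 - u ^ 2) * |1 - u ^ 2|) / 2 := by
    funext u
    rcases le_total 0 (1 - u ^ 2) with h | h
    · rw [cap, max_eq_right h, abs_of_nonneg h]; ring
    · rw [cap, max_eq_left h, abs_of_nonpos h]; ring
  rw [e]
  have h1 : HasDerivAt (fun u : ℝ ↦ 1 - u ^ 2) (-2 * u) u := by
    exact ((hasDerivAt_pow 2 u).const_sub 1).congr_deriv (by simp)
  have h2 := (hasDerivAt_self_mul_abs (1 - u ^ 2)).comp u h1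
  refine (((h1.pow 2).add h2).div_const 2).congr_deriv ?_
  rcases le_total 0 (1 - u ^ 2) with h | h
  · rw [cap, max_eq_right h, abs_of_nonneg h]; simp
  · rw [cap, max_eq_left h, abs_of_nonpos h]; simp; ring

theorem hasDerivAt_cap_cube (u : ℝ) :
    HasDerivAt (fun u ↦ cap u ^ 3) (3 * cap u ^ 2 * (-2 * u)) u := by
  have e' : ∀ u, cap u * (1 - u ^ 2) = cap u ^ 2 := fun u ↦ by
    rcases le_total 0 (1 - u ^ 2) with h | h
    · rw [cap, max_eq_right h]; ring
    · rw [cap, max_eq_left h]; ring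
  have e : (fun u ↦ cap u ^ 3) = fun u ↦ cap u ^ 2 * (1 - u ^ 2) := by
    funext u
    linear_combination -(cap u) * e' u
  rw [e]
  have h1 : HasDerivAt (fun u : ℝ ↦ 1 - u ^ 2) (-2 * u) u := by
    exact ((hasDerivAt_pow 2 u).const_sub 1).congr_deriv (by simp)
  refine ((hasDerivAt_cap_sq u).mul h1).congr_deriv ?_
  linear_combination (-4 * u) * e' u

/-- The profile `φ(u) u |u|` of `localBump`, for radius `1` and centre `0`. -/
def profile (u : ℝ) : ℝ := cap u ^ 3 * (u * |u|)

/-- The derivative of `profile`. -/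
def profileDeriv (u : ℝ) : ℝ := |u| * (2 * cap u ^ 3 - 6 * u ^ 2 * cap u ^ 2)

/-- The second derivative of `profile` at `u ≠ 0`, up to the factor `sign u`. This even function is
continuous, so that the second derivative jumps at `0` from `-2` to `2`. -/
def profileCurv (u : ℝ) : ℝ := 2 * cap u ^ 3 - 30 * u ^ 2 * cap u ^ 2 + 24 * u ^ 4 * cap u

theorem hasDerivAt_profile (u : ℝ) : HasDerivAt profile (profileDeriv u) u := by
  refine ((hasDerivAt_cap_cube u).mul (hasDerivAt_self_mul_abs u)).congr_deriv ?_
  unfold profileDeriv; ring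

theorem hasDerivAt_profileDeriv {u : ℝ} (hu : u ≠ 0) :
    HasDerivAt profileDeriv (SignType.sign u * profileCurv u) u := by
  have h2 : HasDerivAt (fun u ↦ 2 * cap u ^ 3 - 6 * u ^ 2 * cap u ^ 2)
      (2 * (3 * cap u ^ 2 * (-2 * u)) - (6 * (2 * u) * cap u ^ 2
        + 6 * u ^ 2 * (2 * cap u * (-2 * u)))) u := by
    refine ((hasDerivAt_cap_cube u).const_mul 2).sub
      (HasDerivAt.mul (((hasDerivAt_pow 2 u).const_mul 6).congr_deriv (by simp))
        (hasDerivAt_cap_sq u))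
  refine ((hasDerivAt_abs hu).mul h2).congr_deriv ?_
  have : |u| = SignType.sign u * u := (sign_mul_self u).symm
  rw [this]; unfold profileCurv; ring

theorem profile_eq_zero {u : ℝ} (hu : 1 ≤ |u|) : profile u = 0 := by
  simp [profile, cap_of_one_le_abs hu]

theorem profileDeriv_eq_zero {u : ℝ} (hu : 1 ≤ |u|) : profileDeriv u = 0 := by
  simp [profileDeriv, cap_of_one_le_abs hu]

theorem profileCurv_eq_zero {u : ℝ} (hu : 1 ≤ |u|) : profileCurv u = 0 := by
  simp [profileCurv, cap_of_one_le_abs hu]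

theorem continuous_profileDeriv : Continuous profileDeriv := by
  have := continuous_cap
  unfold profileDeriv; fun_prop

theorem continuous_profileCurv : Continuous profileCurv := by
  have := continuous_cap
  unfold profileCurv; fun_prop

/-- The constant `6` is the one in `AdmissibleRadius.lt_jump`. -/
theorem abs_profileDeriv_le (u : ℝ) : |profileDeriv u| ≤ 6 := by
  rcases le_total 1 |u| with h | h
  · rw [profileDeriv_eq_zero h]; norm_num
  · have hu2 : u ^ 2 ≤ 1 := (sq_le_one_iff_abs_le_one u).2 h
    have hc := cap_of_abs_le h
    have e : profileDeriv u = |u| * (2 * cap u ^ 2 * (cap u - 3 * u ^ 2)) := by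
      unfold profileDeriv; ring
    have h1 : |cap u - 3 * u ^ 2| ≤ 3 := by
      rw [hc, abs_le]; constructor <;> nlinarith [sq_nonneg u]
    have h2 : cap u ^ 2 ≤ 1 := pow_le_one₀ (cap_nonneg u) (cap_le_one u)
    rw [e, abs_mul, abs_abs, abs_mul, abs_of_nonneg (by positivity : 0 ≤ 2 * cap u ^ 2)]
    calc |u| * (2 * cap u ^ 2 * |cap u - 3 * u ^ 2|) ≤ 1 * (2 * 1 * 3) := by gcongr
      _ = 6 := by norm_num

/-- A locally Lipschitz function, cut off to zero outside `[-1, 1]` in a continuous way, is bounded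
and globally Lipschitz. -/
theorem exists_lipschitz_of_clamp {f g : ℝ → ℝ} (hg : LocallyLipschitz g)
    (hfg : ∀ u, |u| ≤ 1 → f u = g u) (hf0 : ∀ u, 1 ≤ |u| → f u = 0) :
    ∃ K : ℝ, 0 ≤ K ∧ (∀ u, |f u| ≤ K) ∧ ∀ u v, |f u - f v| ≤ K * |u - v| := by
  obtain ⟨K, hK⟩ := hg.locallyLipschitzOn.exists_lipschitzOnWith_of_compact
    (isCompact_Icc (a := (-1:ℝ)) (b := 1))
  have hcl : ∀ u, max (-1) (min 1 u) ∈ Set.Icc (-1:ℝ) 1 := fun u ↦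
    ⟨le_max_left _ _, max_le (by norm_num) (min_le_left _ _)⟩
  have hfc : ∀ u, f u = g (max (-1) (min 1 u)) := fun u ↦ by
    rcases le_total |u| 1 with h | h
    · rw [hfg u h]
      rw [abs_le] at h
      rw [min_eq_right h.2, max_eq_right h.1]
    · rw [hf0 u h]
      rcases le_abs.1 h with h | h
      · rw [min_eq_left h, max_eq_right (by norm_num), ← hfg 1 (by norm_num), hf0 1 (by norm_num)]
      · rw [min_eq_right (by linarith), max_eq_left (by linarith), ← hfg (-1) (by norm_num),
          hf0 (-1) (by norm_num)]
  have hlip : ∀ u v, |f u - f v| ≤ K * |u - v| := fun u v ↦ by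
    rw [hfc, hfc]
    have := hK.dist_le_mul _ (hcl u) _ (hcl v)
    rw [Real.dist_eq, Real.dist_eq] at this
    refine this.trans (mul_le_mul_of_nonneg_left ?_ K.2)
    rw [max_comm (-1), max_comm (-1)]
    exact (abs_max_sub_max_le_abs _ _ _).trans (by simpa using abs_min_sub_min_le_max 1 u 1 v)
  refine ⟨2 * K, by positivity, fun u ↦ ?_, fun u v ↦ (hlip u v).trans ?_⟩
  · rcases le_total |u| 1 with h | h
    · have := hlip u 1
      rw [hf0 1 (by norm_num), sub_zero] at this
      refine this.trans ?_
      have : |u - 1| ≤ 2 := by rw [abs_le] at h ⊢; constructor <;> linarith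
      nlinarith [K.2]
    · rw [hf0 u h]; simp
  · have : 0 ≤ K * |u - v| := by positivity
    linarith

theorem exists_lipschitz_profileDeriv :
    ∃ K : ℝ, 0 ≤ K ∧ (∀ u, |profileDeriv u| ≤ K) ∧
      ∀ u v, |profileDeriv u - profileDeriv v| ≤ K * |u - v| := by
  refine exists_lipschitz_of_clamp
    (g := fun u ↦ |u| * (2 * (1 - u ^ 2) ^ 3 - 6 * u ^ 2 * (1 - u ^ 2) ^ 2)) ?_
    (fun u hu ↦ by rw [profileDeriv, cap_of_abs_le hu]) fun u hu ↦ profileDeriv_eq_zero hu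
  have h1 : LocallyLipschitz fun u : ℝ ↦ |u| := lipschitzWith_one_norm.locallyLipschitz
  have h2 : LocallyLipschitz fun u : ℝ ↦ 2 * (1 - u ^ 2) ^ 3 - 6 * u ^ 2 * (1 - u ^ 2) ^ 2 :=
    ContDiff.locallyLipschitz (𝕂 := ℝ) (by fun_prop)
  have h3 : LocallyLipschitz fun x : ℝ × ℝ ↦ x.1 * x.2 :=
    ContDiff.locallyLipschitz (𝕂 := ℝ) (by fun_prop)
  exact h3.comp (h1.prodMk h2)

theorem exists_lipschitz_profileCurv :
    ∃ K : ℝ, 0 ≤ K ∧ (∀ u, |profileCurv u| ≤ K) ∧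
      ∀ u v, |profileCurv u - profileCurv v| ≤ K * |u - v| := by
  refine exists_lipschitz_of_clamp
    (g := fun u ↦ 2 * (1 - u ^ 2) ^ 3 - 30 * u ^ 2 * (1 - u ^ 2) ^ 2 + 24 * u ^ 4 * (1 - u ^ 2))
    (ContDiff.locallyLipschitz (𝕂 := ℝ) (by fun_prop))
    (fun u hu ↦ by rw [profileCurv, cap_of_abs_le hu]) fun u hu ↦ profileCurv_eq_zero hu

end

/-! ### The transformation of space -/

section

/-- An explicit formula for the derivative of `G`. -/
def Gderiv (b σ : ℝ → ℝ) {m : ℕ} (ξ : Fin m → ℝ) (c₀ x : ℝ) : ℝ :=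
  1 + ∑ k, jumpCoeff b σ (ξ k) * (c₀ * profileDeriv ((x - ξ k) / c₀))

/-- An explicit formula for the second derivative of `G` away from the points `ξ`. At `ξ k` it jumps
by `4 * jumpCoeff b σ (ξ k)`. -/
def Gcurv (b σ : ℝ → ℝ) {m : ℕ} (ξ : Fin m → ℝ) (c₀ x : ℝ) : ℝ :=
  ∑ k, jumpCoeff b σ (ξ k) *
    (SignType.sign (x - ξ k) * profileCurv ((x - ξ k) / c₀))

variable {b σ : ℝ → ℝ} {m : ℕ} {ξ : Fin m → ℝ} {c₀ : ℝ}

theorem localBump_eq (hc : 0 < c₀) (z x : ℝ) :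
    localBump c₀ z x = c₀ ^ 2 * profile ((x - z) / c₀) := by
  rw [localBump, bump_eq_cap_pow, profile, abs_div, abs_of_pos hc]
  field_simp

theorem hasDerivAt_G (hc : 0 < c₀) (x : ℝ) : HasDerivAt (G b σ ξ c₀) (Gderiv b σ ξ c₀ x) x := by
  unfold G Gderiv
  refine (hasDerivAt_id' x).add (HasDerivAt.fun_sum fun k _ ↦ ?_)
  have e : localBump c₀ (ξ k) = fun x ↦ c₀ ^ 2 * profile ((x - ξ k) / c₀) :=
    funext fun x ↦ localBump_eq hc _ x
  rw [e]
  have h1 : HasDerivAt (fun x ↦ (x - ξ k) / c₀) (1 / c₀) x :=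
    ((hasDerivAt_id' x).sub_const _).div_const _
  refine ((((hasDerivAt_profile _).comp x h1).const_mul (c₀ ^ 2)).const_mul _).congr_deriv ?_
  field_simp

theorem deriv_G (hc : 0 < c₀) : deriv (G b σ ξ c₀) = Gderiv b σ ξ c₀ :=
  funext fun x ↦ (hasDerivAt_G hc x).deriv

theorem hasDerivAt_Gderiv (hc : 0 < c₀) {x : ℝ} (hx : x ∉ Set.range ξ) :
    HasDerivAt (Gderiv b σ ξ c₀) (Gcurv b σ ξ c₀ x) x := by
  unfold Gderiv Gcurv
  refine (HasDerivAt.fun_sum fun k _ ↦ ?_).const_add 1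
  have h1 : HasDerivAt (fun x ↦ (x - ξ k) / c₀) (1 / c₀) x :=
    ((hasDerivAt_id' x).sub_const _).div_const _
  have hne : x - ξ k ≠ 0 := fun h ↦ hx ⟨k, (sub_eq_zero.1 h).symm⟩
  refine ((((hasDerivAt_profileDeriv (div_ne_zero hne hc.ne')).comp x h1).const_mul
    c₀).const_mul _).congr_deriv ?_
  have : SignType.sign ((x - ξ k) / c₀) = SignType.sign (x - ξ k) := by
    rw [div_eq_mul_inv, sign_mul, sign_pos (inv_pos.2 hc), mul_one]
  rw [this]
  field_simp

theorem preDrift_eq (hc : 0 < c₀) {x : ℝ} (hx : x ∉ Set.range ξ) :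
    preDrift b σ ξ c₀ x =
      b x * Gderiv b σ ξ c₀ x + 1 / 2 * (σ x ^ 2 * Gcurv b σ ξ c₀ x) := by
  rw [preDrift, deriv_G hc, (hasDerivAt_Gderiv hc hx).deriv]

theorem two_mul_lt_sub (hξ : StrictMono ξ) (h : AdmissibleRadius b σ ξ c₀) {i j : Fin m}
    (hij : i < j) : 2 * c₀ < ξ j - ξ i := by
  have hi : (i : ℕ) + 1 < m := by omega
  have h1 := h.lt_gap i ⟨i + 1, hi⟩ rfl
  have h2 : ξ ⟨i + 1, hi⟩ ≤ ξ j := hξ.monotone (Fin.le_def.2 hij)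
  linarith

/-- The supports of the local bumps are disjoint. -/
theorem one_lt_abs_div (hξ : StrictMono ξ) (h : AdmissibleRadius b σ ξ c₀) {i j : Fin m}
    (hij : i ≠ j) {x : ℝ} (hx : |x - ξ i| ≤ c₀) : 1 < |(x - ξ j) / c₀| := by
  rw [abs_div, abs_of_pos h.pos, lt_div_iff₀ h.pos, one_mul]
  rw [abs_le] at hx
  rcases lt_or_gt_of_ne hij with hlt | hlt
  · have := two_mul_lt_sub hξ h hlt
    rw [lt_abs]; right; linarith
  · have := two_mul_lt_sub hξ h hlt
    rw [lt_abs]; left; linarith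

/-- The smallness of the radius keeps the derivative of `G` uniformly away from `0`. -/
theorem exists_abs_Gderiv_sub_one_le (hξ : StrictMono ξ) (h : AdmissibleRadius b σ ξ c₀) :
    ∃ ρ : ℝ, 0 ≤ ρ ∧ ρ < 1 ∧ ∀ x, |Gderiv b σ ξ c₀ x - 1| ≤ ρ := by
  obtain ⟨ρ, h0, h1, hρ⟩ : ∃ ρ : ℝ, 0 ≤ ρ ∧ ρ < 1 ∧
      ∀ k, 6 * |jumpCoeff b σ (ξ k)| * c₀ ≤ ρ := by
    rcases Nat.eq_zero_or_pos m with rfl | hm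
    · exact ⟨0, le_rfl, zero_lt_one, fun k ↦ k.elim0⟩
    · have : Nonempty (Fin m) := ⟨⟨0, hm⟩⟩
      obtain ⟨j, hj⟩ := Finite.exists_max fun k ↦ 6 * |jumpCoeff b σ (ξ k)| * c₀
      have := h.pos
      exact ⟨_, by positivity, h.lt_jump j, hj⟩
  refine ⟨ρ, h0, h1, fun x ↦ ?_⟩
  rw [Gderiv, add_sub_cancel_left]
  by_cases hx : ∃ k, |x - ξ k| ≤ c₀
  · obtain ⟨k, hk⟩ := hx
    rw [Finset.sum_eq_single k]
    · rw [abs_mul, abs_mul, abs_of_pos h.pos]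
      refine le_trans ?_ (hρ k)
      have := mul_le_mul_of_nonneg_left (abs_profileDeriv_le ((x - ξ k) / c₀))
        (mul_nonneg (abs_nonneg (jumpCoeff b σ (ξ k))) h.pos.le)
      linarith
    · intro j _ hj
      rw [profileDeriv_eq_zero (one_lt_abs_div hξ h hj.symm hk).le]; simp
    · simp
  · rw [Finset.sum_eq_zero]
    · simpa using h0
    · intro k _
      have hk : c₀ ≤ |x - ξ k| := le_of_not_ge fun hk ↦ hx ⟨k, hk⟩
      rw [profileDeriv_eq_zero]
      · simp
      · rwa [abs_div, abs_of_pos h.pos, one_le_div h.pos]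

theorem Gderiv_nonneg (hξ : StrictMono ξ) (h : AdmissibleRadius b σ ξ c₀) (x : ℝ) :
    0 ≤ Gderiv b σ ξ c₀ x := by
  obtain ⟨ρ, _, h1, hρ⟩ := exists_abs_Gderiv_sub_one_le hξ h
  have := (abs_le.1 (hρ x)).1
  linarith

theorem Gderiv_le_two (hξ : StrictMono ξ) (h : AdmissibleRadius b σ ξ c₀) (x : ℝ) :
    Gderiv b σ ξ c₀ x ≤ 2 := by
  obtain ⟨ρ, _, h1, hρ⟩ := exists_abs_Gderiv_sub_one_le hξ h
  have := (abs_le.1 (hρ x)).2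
  linarith

theorem exists_mul_sub_le_G_sub (hξ : StrictMono ξ) (h : AdmissibleRadius b σ ξ c₀) :
    ∃ c : ℝ, 0 < c ∧ ∀ x y, x ≤ y → c * (y - x) ≤ G b σ ξ c₀ y - G b σ ξ c₀ x := by
  obtain ⟨ρ, _, h1, hρ⟩ := exists_abs_Gderiv_sub_one_le hξ h
  refine ⟨1 - ρ, sub_pos.2 h1, fun x y hxy ↦ ?_⟩
  refine mul_sub_le_image_sub_of_le_deriv (fun x ↦ (hasDerivAt_G h.pos x).differentiableAt)
    (fun x ↦ ?_) hxy
  rw [deriv_G h.pos]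
  have := (abs_le.1 (hρ x)).1
  linarith

/-- Outside some ball, a point lies in the support of no local bump. There `G` is the identity. -/
theorem exists_radius (ξ : Fin m → ℝ) (hc : 0 < c₀) :
    ∃ R : ℝ, 0 < R ∧ (∀ k, |ξ k| < R) ∧ ∀ x, R ≤ |x| → ∀ k, 1 ≤ |(x - ξ k) / c₀| := by
  have hle : ∀ k, |ξ k| ≤ ∑ k, |ξ k| := fun k ↦
    Finset.single_le_sum (f := fun k ↦ |ξ k|) (fun _ _ ↦ abs_nonneg _) (Finset.mem_univ k)
  refine ⟨c₀ + ∑ k, |ξ k|, by positivity, fun k ↦ by linarith [hle k], fun x hx k ↦ ?_⟩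
  rw [abs_div, abs_of_pos hc, one_le_div hc]
  have := abs_sub_abs_le_abs_sub x (ξ k)
  linarith [hle k]

theorem G_eq_self (hc : 0 < c₀) {x : ℝ} (hx : ∀ k, 1 ≤ |(x - ξ k) / c₀|) : G b σ ξ c₀ x = x := by
  rw [G, Finset.sum_eq_zero fun k _ ↦ ?_, add_zero]
  rw [localBump_eq hc, profile_eq_zero (hx k)]; simp

theorem Gderiv_eq_one {x : ℝ} (hx : ∀ k, 1 ≤ |(x - ξ k) / c₀|) : Gderiv b σ ξ c₀ x = 1 := by
  rw [Gderiv, Finset.sum_eq_zero fun k _ ↦ ?_, add_zero]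
  rw [profileDeriv_eq_zero (hx k)]; simp

theorem Gcurv_eq_zero {x : ℝ} (hx : ∀ k, 1 ≤ |(x - ξ k) / c₀|) : Gcurv b σ ξ c₀ x = 0 := by
  rw [Gcurv, Finset.sum_eq_zero fun k _ ↦ ?_]
  rw [profileCurv_eq_zero (hx k)]; simp

theorem continuous_G (hc : 0 < c₀) : Continuous (G b σ ξ c₀) :=
  continuous_iff_continuousAt.2 fun x ↦ (hasDerivAt_G hc x).continuousAt

theorem strictMono_G (hξ : StrictMono ξ) (h : AdmissibleRadius b σ ξ c₀) :
    StrictMono (G b σ ξ c₀) := by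
  obtain ⟨c, hc, hG⟩ := exists_mul_sub_le_G_sub hξ h
  intro x y hxy
  have := hG x y hxy.le
  nlinarith [sub_pos.2 hxy]

theorem surjective_G (hc : 0 < c₀) : Function.Surjective (G b σ ξ c₀) := by
  obtain ⟨R, hR, -, hid⟩ := exists_radius ξ hc
  refine (continuous_G hc).surjective ?_ ?_
  · refine tendsto_id.congr' ?_
    filter_upwards [eventually_ge_atTop R] with x hx
    exact (G_eq_self hc (hid x (hx.trans (le_abs_self x)))).symm
  · refine tendsto_id.congr' ?_
    filter_upwards [eventually_le_atBot (-R)] with x hx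
    exact (G_eq_self hc (hid x ((le_neg.1 hx).trans (neg_le_abs x)))).symm

theorem GInv_G (hξ : StrictMono ξ) (h : AdmissibleRadius b σ ξ c₀) (x : ℝ) :
    GInv b σ ξ c₀ (G b σ ξ c₀ x) = x :=
  Function.leftInverse_invFun (strictMono_G hξ h).injective x

theorem G_GInv (hc : 0 < c₀) (z : ℝ) : G b σ ξ c₀ (GInv b σ ξ c₀ z) = z :=
  Function.rightInverse_invFun (surjective_G hc) z

theorem monotone_GInv (hξ : StrictMono ξ) (h : AdmissibleRadius b σ ξ c₀) :
    Monotone (GInv b σ ξ c₀) := by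
  intro x y hxy
  rw [← (strictMono_G hξ h).le_iff_le, G_GInv h.pos, G_GInv h.pos]
  exact hxy

theorem exists_abs_G_sub_le (hc : 0 < c₀) : ∃ C : ℝ, 0 ≤ C ∧ ∀ x, |G b σ ξ c₀ x - x| ≤ C := by
  obtain ⟨R, hR, -, hid⟩ := exists_radius ξ hc
  have hcont : Continuous fun x ↦ G b σ ξ c₀ x - x := (continuous_G hc).sub continuous_id
  obtain ⟨C, hC⟩ := (isCompact_Icc (a := -R) (b := R)).exists_bound_of_continuousOn
    hcont.continuousOn
  refine ⟨max C 0, le_max_right _ _, fun x ↦ ?_⟩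
  rcases le_total R |x| with h | h
  · rw [G_eq_self hc (hid x h)]; simp
  · exact (hC x (abs_le.1 h)).trans (le_max_left _ _)

theorem continuous_Gderiv : Continuous (Gderiv b σ ξ c₀) := by
  have := continuous_profileDeriv
  unfold Gderiv; fun_prop

theorem exists_lipschitz_Gderiv (b σ : ℝ → ℝ) (ξ : Fin m → ℝ) (hc : 0 < c₀) :
    ∃ K : ℝ, 0 ≤ K ∧ ∀ x y, |Gderiv b σ ξ c₀ x - Gderiv b σ ξ c₀ y| ≤ K * |x - y| := by
  obtain ⟨K, hK, -, hlip⟩ := exists_lipschitz_profileDeriv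
  refine ⟨∑ k, |jumpCoeff b σ (ξ k)| * K, by positivity, fun x y ↦ ?_⟩
  rw [Gderiv, Gderiv, add_sub_add_left_eq_sub, ← Finset.sum_sub_distrib, Finset.sum_mul]
  refine (Finset.abs_sum_le_sum_abs _ _).trans (Finset.sum_le_sum fun k _ ↦ ?_)
  rw [← mul_sub, ← mul_sub, abs_mul, abs_mul, abs_of_pos hc, mul_assoc]
  refine mul_le_mul_of_nonneg_left ?_ (abs_nonneg _)
  refine (mul_le_mul_of_nonneg_left (hlip _ _) hc.le).trans_eq ?_
  rw [← sub_div, abs_div, abs_of_pos hc, sub_sub_sub_cancel_right]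
  field_simp

theorem exists_lipschitz_Gcurv (b σ : ℝ → ℝ) (ξ : Fin m → ℝ) (hc : 0 < c₀) :
    ∃ K : ℝ, 0 ≤ K ∧ (∀ x, |Gcurv b σ ξ c₀ x| ≤ K) ∧
      ∀ x y, x ≤ y → (∀ i, ξ i ∉ Set.Icc x y) →
        |Gcurv b σ ξ c₀ y - Gcurv b σ ξ c₀ x| ≤ K * (y - x) := by
  obtain ⟨K, hK, hbd, hlip⟩ := exists_lipschitz_profileCurv
  have hs : ∀ x : ℝ, |(SignType.sign x : ℝ)| ≤ 1 := fun x ↦ by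
    rcases lt_trichotomy x 0 with h | h | h <;> simp [h]
  refine ⟨∑ k, |jumpCoeff b σ (ξ k)| * (K + K / c₀), by positivity, fun x ↦ ?_, fun x y hxy hI ↦ ?_⟩
  · refine (Finset.abs_sum_le_sum_abs _ _).trans (Finset.sum_le_sum fun k _ ↦ ?_)
    rw [abs_mul, abs_mul]
    refine mul_le_mul_of_nonneg_left ?_ (abs_nonneg _)
    have := mul_le_mul (hs (x - ξ k)) (hbd ((x - ξ k) / c₀)) (abs_nonneg _) zero_le_one
    have : 0 ≤ K / c₀ := by positivity
    linarith
  · rw [Gcurv, Gcurv, ← Finset.sum_sub_distrib, Finset.sum_mul]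
    refine (Finset.abs_sum_le_sum_abs _ _).trans (Finset.sum_le_sum fun k _ ↦ ?_)
    have hsign : SignType.sign (y - ξ k) = SignType.sign (x - ξ k) := by
      rcases lt_or_ge (ξ k) x with h | h
      · rw [sign_pos (by linarith), sign_pos (by linarith)]
      · have : y < ξ k := lt_of_not_ge fun h' ↦ hI k ⟨h, h'⟩
        rw [sign_neg (by linarith), sign_neg (by linarith)]
    rw [hsign, ← mul_sub, ← mul_sub, abs_mul, abs_mul, mul_assoc]
    refine mul_le_mul_of_nonneg_left ?_ (abs_nonneg _)
    have h1 := hlip ((y - ξ k) / c₀) ((x - ξ k) / c₀)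
    rw [← sub_div, abs_div, abs_of_pos hc, sub_sub_sub_cancel_right,
      abs_of_nonneg (sub_nonneg.2 hxy)] at h1
    have h2 := mul_le_mul (hs (x - ξ k)) h1 (abs_nonneg _) zero_le_one
    have h3 : K * ((y - x) / c₀) = K / c₀ * (y - x) := by ring
    have h4 : 0 ≤ K * (y - x) := mul_nonneg hK (sub_nonneg.2 hxy)
    linarith

end

/-! ### The transformed drift -/

section

variable {b σ : ℝ → ℝ} {m : ℕ} {ξ : Fin m → ℝ} {c₀ Lb Kb Lσ γ η : ℝ}

/-- Two points not separated by an exceptional point lie in a common piece. -/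
theorem exists_piece (hξ : StrictMono ξ) {x y : ℝ} (hxy : x ≤ y) (h : ∀ i, ξ i ∉ Set.Icc x y) :
    ∃ k, x ∈ piece ξ k ∧ y ∈ piece ξ k := by
  classical
  have key : ∃ k : Fin (m + 1), ∀ i : Fin m, ((i : ℕ) < k ↔ ξ i < x) := by
    let s := (Finset.univ.filter fun i : Fin m ↦ ξ i < x).sup fun i ↦ (i : ℕ) + 1
    have hs : s ≤ m := Finset.sup_le fun i _ ↦ i.2
    refine ⟨⟨s, Nat.lt_succ_of_le hs⟩, fun i ↦ ⟨fun hi ↦ ?_, fun hi ↦ ?_⟩⟩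
    · obtain ⟨j, hj, hij⟩ := Finset.lt_sup_iff.1 (show (i : ℕ) < s from hi)
      have hle : i ≤ j := Fin.le_def.2 (Nat.lt_succ_iff.1 hij)
      exact (hξ.monotone hle).trans_lt (Finset.mem_filter.1 hj).2
    · exact Finset.le_sup (f := fun i : Fin m ↦ (i : ℕ) + 1)
        (Finset.mem_filter.2 ⟨Finset.mem_univ i, hi⟩)
  obtain ⟨k, hk⟩ := key
  have hlt : ∀ i : Fin m, (k : ℕ) ≤ i → y < ξ i := fun i hi ↦ by
    have h1 : x ≤ ξ i := not_lt.1 fun hlt ↦ absurd ((hk i).2 hlt) (not_lt.2 hi)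
    exact lt_of_not_ge fun h2 ↦ h i ⟨h1, h2⟩
  exact ⟨k, ⟨fun i hi ↦ (hk i).1 hi, fun i hi ↦ hxy.trans_lt (hlt i hi)⟩,
    fun i hi ↦ ((hk i).1 hi).trans_le hxy, hlt⟩

namespace CoefficientAssumption

theorem drift_sub_le (hA : CoefficientAssumption b σ ξ Lb Kb Lσ γ η)
    {x y : ℝ} (hxy : x ≤ y) (h : ∀ i, ξ i ∉ Set.Icc x y) :
    b y - b x ≤ Lb * (y - x) := by
  obtain ⟨k, hx, hy⟩ := exists_piece hA.strictMono hxy h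
  rcases hxy.eq_or_lt with rfl | hlt
  · simp
  · have h1 := hA.oneSidedLipschitz k y hy x hx
    rw [sq_abs] at h1
    have h2 : 0 < y - x := sub_pos.2 hlt
    by_contra hcon
    nlinarith [mul_lt_mul_of_pos_left (not_le.1 hcon) h2]

theorem abs_drift_sub_le_of_mem_piece (hA : CoefficientAssumption b σ ξ Lb Kb Lσ γ η)
    {R : ℝ} {k : Fin (m + 1)} {x y : ℝ} (hx : x ∈ piece ξ k)
    (hy : y ∈ piece ξ k) (hxR : |x| ≤ R) (hyR : |y| ≤ R) :
    |b x - b y| ≤ Kb * (2 * Real.exp (γ * R ^ η)) * |x - y| := by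
  refine (hA.expGrowth k x hx y hy).trans ?_
  have h0 := hA.Kb_pos
  have h1 := hA.γ_pos
  have h2 := hA.η_pos
  have e1 : |x| ^ η ≤ R ^ η := Real.rpow_le_rpow (abs_nonneg _) hxR h2.le
  have e2 : |y| ^ η ≤ R ^ η := Real.rpow_le_rpow (abs_nonneg _) hyR h2.le
  rw [two_mul]
  gcongr

theorem exists_lipschitz_drift (hA : CoefficientAssumption b σ ξ Lb Kb Lσ γ η)
    (R : ℝ) : ∃ K : ℝ≥0, ∀ x y, x ≤ y → |x| ≤ R → |y| ≤ R →
    (∀ i, ξ i ∉ Set.Icc x y) → |b y - b x| ≤ K * |y - x| := by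
  refine ⟨⟨Kb * (2 * Real.exp (γ * R ^ η)), ?_⟩, fun x y hxy hx hy h ↦ ?_⟩
  · have := hA.Kb_pos; positivity
  · obtain ⟨k, hxk, hyk⟩ := exists_piece hA.strictMono hxy h
    exact hA.abs_drift_sub_le_of_mem_piece hyk hxk hy hx

theorem exists_abs_drift_le (hA : CoefficientAssumption b σ ξ Lb Kb Lσ γ η) (R : ℝ) :
    ∃ B : ℝ, 0 ≤ B ∧ ∀ x, x ∉ Set.range ξ → |x| ≤ R → |b x| ≤ B := by
  have hk : ∀ k : Fin (m + 1), ∃ B : ℝ, 0 ≤ B ∧ ∀ x ∈ piece ξ k, |x| ≤ R → |b x| ≤ B := by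
    intro k
    by_cases hne : ∃ x₀ ∈ piece ξ k, |x₀| ≤ R
    · obtain ⟨x₀, hx₀, hR₀⟩ := hne
      have hKb := hA.Kb_pos
      have hR : 0 ≤ R := (abs_nonneg _).trans hR₀
      refine ⟨|b x₀| + Kb * (2 * Real.exp (γ * R ^ η)) * (R + R), by positivity, fun x hx hxR ↦ ?_⟩
      have h1 := hA.abs_drift_sub_le_of_mem_piece hx hx₀ hxR hR₀
      have h2 : |x - x₀| ≤ R + R := (abs_sub _ _).trans (add_le_add hxR hR₀)
      have h3 := abs_sub_abs_le_abs_sub (b x) (b x₀)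
      have h4 := mul_le_mul_of_nonneg_left h2
        (by positivity : 0 ≤ Kb * (2 * Real.exp (γ * R ^ η)))
      linarith
    · exact ⟨0, le_rfl, fun x hx hxR ↦ absurd ⟨x, hx, hxR⟩ hne⟩
  choose B hB hB' using hk
  refine ⟨∑ k, B k, Finset.sum_nonneg fun k _ ↦ hB k, fun x hx hxR ↦ ?_⟩
  obtain ⟨k, hxk, -⟩ := exists_piece hA.strictMono (le_refl x) fun i hi ↦
    hx ⟨i, le_antisymm hi.2 hi.1⟩
  exact (hB' k x hxk hxR).trans (Finset.single_le_sum (fun k _ ↦ hB k) (Finset.mem_univ k))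

theorem eventually_nhdsGT_notMem (ξ : Fin m → ℝ) (x : ℝ) :
    ∀ᶠ z in 𝓝[>] x, ∀ i, ξ i ∉ Set.Ioc x z := by
  rw [eventually_all]
  intro i
  rcases le_or_gt (ξ i) x with h | h
  · exact Eventually.of_forall fun z hz ↦ absurd hz.1 (not_lt.2 h)
  · filter_upwards [Ioo_mem_nhdsGT h] with z hz hi using absurd hi.2 (not_le.2 hz.2)

theorem eventually_nhdsLT_notMem (ξ : Fin m → ℝ) (x : ℝ) :
    ∀ᶠ z in 𝓝[<] x, ∀ i, ξ i ∉ Set.Ico z x := by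
  rw [eventually_all]
  intro i
  rcases le_or_gt x (ξ i) with h | h
  · exact Eventually.of_forall fun z hz ↦ absurd hz.2 (not_lt.2 h)
  · filter_upwards [Ioo_mem_nhdsLT h] with z hz hi using absurd hi.1 (not_le.2 hz.1)

/-- Between exceptional points the drift is Lipschitz on bounded intervals, so it extends to a
continuous function. In particular it has one-sided limits everywhere. -/
theorem exists_continuous_eqOn (hA : CoefficientAssumption b σ ξ Lb Kb Lσ γ η)
    {p q : ℝ} (h : ∀ i, ξ i ∉ Set.Ioo p q) :
    ∃ g : ℝ → ℝ, Continuous g ∧ Set.EqOn b g (Set.Ioo p q) := by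
  obtain ⟨K, hK⟩ := hA.exists_lipschitz_drift (max |p| |q|)
  have hb : ∀ x ∈ Set.Ioo p q, |x| ≤ max |p| |q| := fun x hx ↦
    abs_le_max_abs_abs hx.1.le hx.2.le
  have hL : LipschitzOnWith K b (Set.Ioo p q) := by
    refine LipschitzOnWith.of_dist_le_mul fun x hx y hy ↦ ?_
    rw [Real.dist_eq, Real.dist_eq]
    rcases le_total x y with hxy | hxy
    · rw [abs_sub_comm (b x), abs_sub_comm x]
      exact hK x y hxy (hb x hx) (hb y hy) fun i hi ↦ h i ⟨hx.1.trans_le hi.1, hi.2.trans_lt hy.2⟩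
    · exact hK y x hxy (hb y hy) (hb x hx) fun i hi ↦ h i ⟨hy.1.trans_le hi.1, hi.2.trans_lt hx.2⟩
  obtain ⟨g, hg, hgb⟩ := hL.extend_real
  exact ⟨g, hg.continuous, hgb⟩

theorem tendsto_rightLim (hA : CoefficientAssumption b σ ξ Lb Kb Lσ γ η)
    (x : ℝ) : Tendsto b (𝓝[>] x) (𝓝 (Function.rightLim b x)) := by
  obtain ⟨z, hz, hxz⟩ := ((eventually_nhdsGT_notMem ξ x).and self_mem_nhdsWithin).exists
  obtain ⟨g, hg, hgb⟩ := hA.exists_continuous_eqOn (p := x) (q := z) fun i hi ↦ hz i ⟨hi.1, hi.2.le⟩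
  have : Tendsto b (𝓝[>] x) (𝓝 (g x)) := by
    refine ((hg.tendsto x).mono_left nhdsWithin_le_nhds).congr' ?_
    filter_upwards [Ioo_mem_nhdsGT hxz] with y hy using (hgb hy).symm
  rwa [rightLim_eq_of_tendsto this]

theorem tendsto_leftLim (hA : CoefficientAssumption b σ ξ Lb Kb Lσ γ η)
    (x : ℝ) : Tendsto b (𝓝[<] x) (𝓝 (Function.leftLim b x)) := by
  obtain ⟨z, hz, hxz⟩ := ((eventually_nhdsLT_notMem ξ x).and self_mem_nhdsWithin).exists
  obtain ⟨g, hg, hgb⟩ := hA.exists_continuous_eqOn (p := z) (q := x) fun i hi ↦ hz i ⟨hi.1.le, hi.2⟩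
  have : Tendsto b (𝓝[<] x) (𝓝 (g x)) := by
    refine ((hg.tendsto x).mono_left nhdsWithin_le_nhds).congr' ?_
    filter_upwards [Ioo_mem_nhdsLT hxz] with y hy using (hgb hy).symm
  rwa [leftLim_eq_of_tendsto this]

theorem continuous_diffusion (hA : CoefficientAssumption b σ ξ Lb Kb Lσ γ η) : Continuous σ :=
  (LipschitzWith.of_dist_le_mul (K := ⟨Lσ, hA.Lσ_pos.le⟩) fun x y ↦
    hA.diffusion_lipschitz x y).continuous

theorem notMem_range_eventually (ξ : Fin m → ℝ) {x : ℝ} (hx : x ∉ Set.range ξ) :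
    ∀ᶠ y in 𝓝 x, y ∉ Set.range ξ :=
  (Set.finite_range ξ).isClosed.isOpen_compl.mem_nhds hx

theorem eventually_nhdsNE_notMem_range (ξ : Fin m → ℝ) (x : ℝ) :
    ∀ᶠ y in 𝓝[≠] x, y ∉ Set.range ξ := by
  have h : (Set.range ξ \ {x})ᶜ ∈ 𝓝 x :=
    ((Set.finite_range ξ).subset Set.sdiff_subset).isClosed.isOpen_compl.mem_nhds (by simp)
  filter_upwards [mem_nhdsWithin_of_mem_nhds h, self_mem_nhdsWithin] with y hy hyx hyr
  exact hy ⟨hyr, hyx⟩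

theorem continuousAt_drift (hA : CoefficientAssumption b σ ξ Lb Kb Lσ γ η)
    {x : ℝ} (hx : x ∉ Set.range ξ) : ContinuousAt b x := by
  obtain ⟨ε, hε, hball⟩ := Metric.eventually_nhds_iff.1 (notMem_range_eventually ξ hx)
  obtain ⟨g, hg, hgb⟩ := hA.exists_continuous_eqOn (p := x - ε) (q := x + ε) fun i hi ↦
    hball (y := ξ i) (by rw [Real.dist_eq, abs_lt]; constructor <;> linarith [hi.1, hi.2]) ⟨i, rfl⟩
  refine hg.continuousAt.congr ?_
  filter_upwards [Ioo_mem_nhds (by linarith : x - ε < x) (by linarith : x < x + ε)] with y hy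
    using (hgb hy).symm

theorem tendsto_Gcurv_aux {l : Filter ℝ} {x s : ℝ} (hl : l ≤ 𝓝 x) {i : Fin m}
    (hs : ∀ᶠ y in l, (SignType.sign (y - ξ i) : ℝ) = s) :
    Tendsto (fun y ↦ jumpCoeff b σ (ξ i) *
      (SignType.sign (y - ξ i) * profileCurv ((y - ξ i) / c₀))) l
      (𝓝 (jumpCoeff b σ (ξ i) * (s * profileCurv ((x - ξ i) / c₀)))) := by
  have h1 : Continuous fun y ↦ jumpCoeff b σ (ξ i) * (s * profileCurv ((y - ξ i) / c₀)) := by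
    have := continuous_profileCurv
    fun_prop
  refine ((h1.tendsto x).mono_left hl).congr' ?_
  filter_upwards [hs] with y hy
  rw [hy]

theorem eventually_sign_eq {x z : ℝ} (h : x ≠ z) :
    ∀ᶠ y in 𝓝 x, (SignType.sign (y - z) : ℝ) = SignType.sign (x - z) := by
  rcases lt_or_gt_of_ne h with h | h
  · filter_upwards [Iio_mem_nhds h] with y hy
    rw [sign_neg (sub_neg.2 h), sign_neg (sub_neg.2 hy)]
  · filter_upwards [Ioi_mem_nhds h] with y hy
    rw [sign_pos (sub_pos.2 h), sign_pos (sub_pos.2 hy)]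

theorem continuousAt_Gcurv {x : ℝ} (hx : x ∉ Set.range ξ) : ContinuousAt (Gcurv b σ ξ c₀) x :=
  tendsto_finsetSum _ fun i _ ↦ tendsto_Gcurv_aux le_rfl
    (eventually_sign_eq fun h ↦ hx ⟨i, h.symm⟩)

/-- The limit of the second derivative of `G` at `ξ k` along a filter `l` on one side, with `s = ±1`
the sign of `y - ξ k` along `l`. -/
theorem tendsto_Gcurv (hA : CoefficientAssumption b σ ξ Lb Kb Lσ γ η)
    (hc : AdmissibleRadius b σ ξ c₀) (k : Fin m) {l : Filter ℝ} {s : ℝ}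
    (hl : l ≤ 𝓝 (ξ k)) (hs : ∀ᶠ y in l, (SignType.sign (y - ξ k) : ℝ) = s) :
    Tendsto (Gcurv b σ ξ c₀) l (𝓝 (jumpCoeff b σ (ξ k) * (s * 2))) := by
  have h : ∀ i, Tendsto (fun y ↦ jumpCoeff b σ (ξ i) *
      (SignType.sign (y - ξ i) * profileCurv ((y - ξ i) / c₀))) l
      (𝓝 (if i = k then jumpCoeff b σ (ξ k) * (s * 2) else 0)) := by
    intro i
    split_ifs with hik
    · subst hik
      have := tendsto_Gcurv_aux (b := b) (σ := σ) (c₀ := c₀) hl hs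
      rwa [sub_self, zero_div, show profileCurv 0 = 2 by simp [profileCurv, cap]] at this
    · have hne : ξ k ≠ ξ i := fun h ↦ hik (hA.strictMono.injective h.symm)
      have := tendsto_Gcurv_aux (b := b) (σ := σ) (c₀ := c₀) hl (hl (eventually_sign_eq hne))
      rwa [profileCurv_eq_zero (one_lt_abs_div hA.strictMono hc (Ne.symm hik)
        (by simpa using hc.pos.le)).le, mul_zero, mul_zero] at this
  have := tendsto_finsetSum Finset.univ fun i _ ↦ h i
  rw [Finset.sum_ite_eq' Finset.univ k, if_pos (Finset.mem_univ k)] at this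
  exact this

theorem Gderiv_exceptional (hA : CoefficientAssumption b σ ξ Lb Kb Lσ γ η)
    (hc : AdmissibleRadius b σ ξ c₀) (k : Fin m) :
    Gderiv b σ ξ c₀ (ξ k) = 1 := by
  rw [Gderiv, Finset.sum_eq_zero fun i _ ↦ ?_, add_zero]
  rcases eq_or_ne k i with rfl | hik
  · simp [profileDeriv]
  · rw [profileDeriv_eq_zero (one_lt_abs_div hA.strictMono hc hik (by simpa using hc.pos.le)).le]
    simp

/-- The choice of `jumpCoeff` makes the jump of `½ σ² G''` at `ξ k` cancel the jump of `b`. -/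
theorem tendsto_preDrift (hA : CoefficientAssumption b σ ξ Lb Kb Lσ γ η)
    (hc : AdmissibleRadius b σ ξ c₀) (k : Fin m) :
    Tendsto (preDrift b σ ξ c₀) (𝓝[≠] (ξ k))
      (𝓝 ((Function.leftLim b (ξ k) + Function.rightLim b (ξ k)) / 2)) := by
  have hσ := hA.continuous_diffusion
  have hσk := hA.diffusion_ne_zero k
  have hcong : (fun y ↦ b y * Gderiv b σ ξ c₀ y + 1 / 2 * (σ y ^ 2 * Gcurv b σ ξ c₀ y))
      =ᶠ[𝓝[≠] (ξ k)] preDrift b σ ξ c₀ := by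
    filter_upwards [eventually_nhdsNE_notMem_range ξ (ξ k)] with y hy
    exact (preDrift_eq hc.pos hy).symm
  refine Tendsto.congr' hcong ?_
  have main : ∀ (l : Filter ℝ) (s r : ℝ), l ≤ 𝓝 (ξ k) →
      (∀ᶠ y in l, (SignType.sign (y - ξ k) : ℝ) = s) → Tendsto b l (𝓝 r) →
      Tendsto (fun y ↦ b y * Gderiv b σ ξ c₀ y + 1 / 2 * (σ y ^ 2 * Gcurv b σ ξ c₀ y)) l
        (𝓝 (r * 1 + 1 / 2 * (σ (ξ k) ^ 2 * (jumpCoeff b σ (ξ k) * (s * 2))))) := by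
    intro l s r hl hs hr
    have h1 : Tendsto (Gderiv b σ ξ c₀) l (𝓝 1) := by
      rw [← hA.Gderiv_exceptional hc k]
      exact (continuous_Gderiv.tendsto _).mono_left hl
    have h2 : Tendsto (fun y ↦ σ y ^ 2) l (𝓝 (σ (ξ k) ^ 2)) :=
      ((hσ.pow 2).tendsto _).mono_left hl
    exact (hr.mul h1).add ((h2.mul (hA.tendsto_Gcurv hc k hl hs)).const_mul _)
  rw [← Set.Iio_union_Ioi, nhdsWithin_union, tendsto_sup]
  constructor
  · convert main (𝓝[<] (ξ k)) (-1) _ nhdsWithin_le_nhds ?_ (hA.tendsto_leftLim (ξ k)) using 2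
    · rw [jumpCoeff]; field_simp; ring
    · filter_upwards [self_mem_nhdsWithin] with y hy
      rw [sign_neg (sub_neg.2 hy)]; simp
  · convert main (𝓝[>] (ξ k)) 1 _ nhdsWithin_le_nhds ?_ (hA.tendsto_rightLim (ξ k)) using 2
    · rw [jumpCoeff]; field_simp; ring
    · filter_upwards [self_mem_nhdsWithin] with y hy
      rw [sign_pos (sub_pos.2 hy)]; simp

theorem extendedDrift_eq (hc : 0 < c₀) {x : ℝ} (hx : x ∉ Set.range ξ) :
    extendedDrift b σ ξ c₀ x =
      b x * Gderiv b σ ξ c₀ x + 1 / 2 * (σ x ^ 2 * Gcurv b σ ξ c₀ x) := by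
  rw [extendedDrift, if_neg hx, preDrift_eq hc hx]

theorem continuous_extendedDrift (hA : CoefficientAssumption b σ ξ Lb Kb Lσ γ η)
    (hc : AdmissibleRadius b σ ξ c₀) :
    Continuous (extendedDrift b σ ξ c₀) := by
  rw [continuous_iff_continuousAt]
  intro x
  by_cases hx : x ∈ Set.range ξ
  · obtain ⟨k, rfl⟩ := hx
    have h := hA.tendsto_preDrift hc k
    rw [continuousAt_iff_punctured_nhds]
    have hv : extendedDrift b σ ξ c₀ (ξ k) = _ := (if_pos ⟨k, rfl⟩).trans h.limUnder_eq
    rw [hv]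
    refine h.congr' ?_
    filter_upwards [eventually_nhdsNE_notMem_range ξ (ξ k)] with y hy
    rw [extendedDrift, if_neg hy]
  · have hσ := hA.continuous_diffusion
    have h : ContinuousAt (fun x ↦ b x * Gderiv b σ ξ c₀ x
        + 1 / 2 * (σ x ^ 2 * Gcurv b σ ξ c₀ x)) x :=
      ((hA.continuousAt_drift hx).mul continuous_Gderiv.continuousAt).add
        (((hσ.pow 2).continuousAt.mul (continuousAt_Gcurv hx)).const_mul _)
    refine h.congr ?_
    filter_upwards [notMem_range_eventually ξ hx] with y hy
    exact (extendedDrift_eq hc.pos hy).symm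

/-- The one-sided Lipschitz condition for the extended drift, for points that are close together and
not separated by an exceptional point. If both points are outside a large ball then the extended
drift is `b`, and otherwise both lie in a bounded set. -/
theorem exists_extendedDrift_sub_le_of_notMem (hA : CoefficientAssumption b σ ξ Lb Kb Lσ γ η)
    (hc : AdmissibleRadius b σ ξ c₀) :
    ∃ L : ℝ, ∀ x y, x ≤ y → y - x ≤ 1 → (∀ i, ξ i ∉ Set.Icc x y) →
      extendedDrift b σ ξ c₀ y - extendedDrift b σ ξ c₀ x ≤ L * (y - x) := by
  obtain ⟨R, hR, -, hout⟩ := exists_radius ξ hc.pos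
  obtain ⟨B, hB, hbB⟩ := hA.exists_abs_drift_le (R + 1)
  obtain ⟨K₁, hK₁, hG₁⟩ := exists_lipschitz_Gderiv b σ ξ hc.pos
  obtain ⟨K₂, hK₂, hG₂b, hG₂⟩ := exists_lipschitz_Gcurv b σ ξ hc.pos
  obtain ⟨S, hS⟩ := (isCompact_Icc (a := -(R + 1)) (b := R + 1)).exists_bound_of_continuousOn
    hA.continuous_diffusion.continuousOn
  have hLb := hA.Lb_pos
  have hLσ := hA.Lσ_pos
  have hS0 : 0 ≤ S := (norm_nonneg _).trans (hS 0 ⟨by linarith, by linarith⟩)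
  refine ⟨2 * Lb + B * K₁ + 1 / 2 * (2 * S * Lσ * K₂ + S ^ 2 * K₂), fun x y hxy hyx hI ↦ ?_⟩
  have hxr : x ∉ Set.range ξ := by rintro ⟨i, rfl⟩; exact hI i ⟨le_rfl, hxy⟩
  have hyr : y ∉ Set.range ξ := by rintro ⟨i, rfl⟩; exact hI i ⟨hxy, le_rfl⟩
  have hb := hA.drift_sub_le hxy hI
  have hyx0 : 0 ≤ y - x := sub_nonneg.2 hxy
  rw [extendedDrift_eq hc.pos hxr, extendedDrift_eq hc.pos hyr]
  by_cases hboth : R ≤ |x| ∧ R ≤ |y|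
  · rw [Gderiv_eq_one (hout x hboth.1), Gderiv_eq_one (hout y hboth.2),
      Gcurv_eq_zero (hout x hboth.1), Gcurv_eq_zero (hout y hboth.2)]
    have : 0 ≤ (Lb + B * K₁ + 1 / 2 * (2 * S * Lσ * K₂ + S ^ 2 * K₂)) * (y - x) := by positivity
    nlinarith
  · have hdist : |y - x| ≤ 1 := by rwa [abs_of_nonneg hyx0]
    have hd1 := abs_sub_abs_le_abs_sub y x
    have hd2 := abs_sub_abs_le_abs_sub x y
    rw [abs_sub_comm x y] at hd2
    have hxR : |x| ≤ R + 1 := by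
      by_contra hcon
      exact hboth ⟨by linarith [not_le.1 hcon], by linarith [not_le.1 hcon]⟩
    have hyR : |y| ≤ R + 1 := by
      by_contra hcon
      exact hboth ⟨by linarith [not_le.1 hcon], by linarith [not_le.1 hcon]⟩
    have hσx : σ x ≤ S := (le_abs_self _).trans (hS x (abs_le.1 hxR))
    have hσy : σ y ≤ S := (le_abs_self _).trans (hS y (abs_le.1 hyR))
    have hσx0 := hA.diffusion_nonneg x
    have hσy0 := hA.diffusion_nonneg y
    have hg0 := Gderiv_nonneg hA.strictMono hc y
    have hg2 := Gderiv_le_two hA.strictMono hc y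
    have t1 : (b y - b x) * Gderiv b σ ξ c₀ y ≤ 2 * Lb * (y - x) := by
      have h1 := mul_le_mul_of_nonneg_right hb hg0
      have h2 := mul_le_mul_of_nonneg_left hg2 (by positivity : 0 ≤ Lb * (y - x))
      linarith
    have t2 : b x * (Gderiv b σ ξ c₀ y - Gderiv b σ ξ c₀ x) ≤ B * K₁ * (y - x) := by
      refine (le_abs_self _).trans ?_
      rw [abs_mul, mul_assoc]
      have := hG₁ y x
      rw [abs_of_nonneg hyx0] at this
      exact mul_le_mul (hbB x hxr hxR) this (abs_nonneg _) hB
    have t3 : (σ y ^ 2 - σ x ^ 2) * Gcurv b σ ξ c₀ y ≤ 2 * S * Lσ * K₂ * (y - x) := by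
      refine (le_abs_self _).trans ?_
      have h1 := hA.diffusion_lipschitz y x
      rw [abs_of_nonneg hyx0] at h1
      have h2 : |σ y ^ 2 - σ x ^ 2| ≤ 2 * S * (Lσ * (y - x)) := by
        rw [sq_sub_sq, abs_mul, abs_of_nonneg (add_nonneg hσy0 hσx0)]
        exact mul_le_mul (by linarith) h1 (abs_nonneg _) (by positivity)
      rw [abs_mul]
      have := mul_le_mul h2 (hG₂b y) (abs_nonneg _) (by positivity)
      linarith
    have t4 : σ x ^ 2 * (Gcurv b σ ξ c₀ y - Gcurv b σ ξ c₀ x) ≤ S ^ 2 * K₂ * (y - x) := by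
      refine (le_abs_self _).trans ?_
      rw [abs_mul, abs_of_nonneg (sq_nonneg (σ x)), mul_assoc]
      exact mul_le_mul (pow_le_pow_left₀ hσx0 hσx 2) (hG₂ x y hxy hI) (abs_nonneg _) (by positivity)
    linarith

/-- The local one-sided Lipschitz bound propagates across the exceptional points by continuity: the
right difference quotients are bounded at every point. -/
theorem exists_extendedDrift_sub_le (hA : CoefficientAssumption b σ ξ Lb Kb Lσ γ η)
    (hc : AdmissibleRadius b σ ξ c₀) :
    ∃ L : ℝ, 0 ≤ L ∧ ∀ x y, x ≤ y →
      extendedDrift b σ ξ c₀ y - extendedDrift b σ ξ c₀ x ≤ L * (y - x) := by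
  obtain ⟨L, hL⟩ := hA.exists_extendedDrift_sub_le_of_notMem hc
  have hcont := hA.continuous_extendedDrift hc
  refine ⟨max L 0, le_max_right _ _, fun x y hxy ↦ ?_⟩
  have hLx : ∀ t : ℝ, 0 ≤ t → L * t ≤ max L 0 * t := fun t ht ↦
    mul_le_mul_of_nonneg_right (le_max_left _ _) ht
  suffices h : extendedDrift b σ ξ c₀ y ≤ extendedDrift b σ ξ c₀ x + L * (y - x) by
    linarith [hLx (y - x) (sub_nonneg.2 hxy)]
  refine image_le_of_liminf_slope_right_le_deriv_boundary (a := x) (b := y)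
    (B := fun z ↦ extendedDrift b σ ξ c₀ x + L * (z - x)) (B' := fun _ ↦ L) hcont.continuousOn
    (by simp) (by fun_prop) (fun z _ ↦ ?_) (fun z _ r hr ↦ Eventually.frequently ?_)
    (Set.right_mem_Icc.2 hxy)
  · have := (((hasDerivAt_id' z).sub_const x).const_mul L).const_add (extendedDrift b σ ξ c₀ x)
    simpa using this.hasDerivWithinAt
  · have h1 : Set.Ioo z (z + 1) ∈ 𝓝[>] z := Ioo_mem_nhdsGT (by linarith)
    filter_upwards [eventually_nhdsGT_notMem ξ z, h1] with w hw hzw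
    refine lt_of_le_of_lt ?_ hr
    rw [slope_def_field, div_le_iff₀ (sub_pos.2 hzw.1)]
    have hlim : Tendsto (fun v ↦ extendedDrift b σ ξ c₀ w - extendedDrift b σ ξ c₀ v) (𝓝[>] z)
        (𝓝 (extendedDrift b σ ξ c₀ w - extendedDrift b σ ξ c₀ z)) :=
      ((continuous_const.sub hcont).tendsto z).mono_left nhdsWithin_le_nhds
    have hlim' : Tendsto (fun v ↦ L * (w - v)) (𝓝[>] z) (𝓝 (L * (w - z))) :=
      Tendsto.mono_left ((by fun_prop : Continuous fun v ↦ L * (w - v)).tendsto z)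
        nhdsWithin_le_nhds
    refine le_of_tendsto_of_tendsto hlim hlim' ?_
    filter_upwards [Ioo_mem_nhdsGT hzw.1] with v hv
    exact hL v w hv.2.le (by linarith [hv.1, hzw.2]) fun i hi ↦ hw i ⟨hv.1.trans_le hi.1, hi.2⟩

end CoefficientAssumption

end

/-! ### Structural bounds for the transformed coefficients -/

section

variable {b σ : ℝ → ℝ} {m : ℕ} {ξ : Fin m → ℝ} {c₀ Lb Kb Lσ γ η α β : ℝ}

namespace CoefficientAssumption

theorem measurable_transformedDiffusion (hA : CoefficientAssumption b σ ξ Lb Kb Lσ γ η)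
    (hc : AdmissibleRadius b σ ξ c₀) : Measurable (transformedDiffusion b σ ξ c₀) := by
  have hG := (monotone_GInv hA.strictMono hc).measurable
  exact (hA.continuous_diffusion.measurable.comp hG).mul ((measurable_deriv _).comp hG)

theorem exists_transformedDrift_sub_le (hA : CoefficientAssumption b σ ξ Lb Kb Lσ γ η)
    (hc : AdmissibleRadius b σ ξ c₀) : ∃ L : ℝ, ∀ x y, x ≤ y →
      transformedDrift b σ ξ c₀ y - transformedDrift b σ ξ c₀ x ≤ L * (y - x) := by
  obtain ⟨L, hL0, hL⟩ := hA.exists_extendedDrift_sub_le hc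
  obtain ⟨c, hc0, hcG⟩ := exists_mul_sub_le_G_sub hA.strictMono hc
  refine ⟨L / c, fun x y hxy ↦ ?_⟩
  have hmono := monotone_GInv hA.strictMono hc hxy
  have h1 := hcG _ _ hmono
  rw [G_GInv hc.pos, G_GInv hc.pos] at h1
  refine (hL _ _ hmono).trans ?_
  rw [div_mul_eq_mul_div, le_div_iff₀ hc0, mul_assoc, mul_comm _ c]
  exact mul_le_mul_of_nonneg_left h1 hL0

/-- The monotonicity condition survives the transformation with the same `β`, as `G` is the
identity outside a bounded set. The restriction on the step size is stated in terms of this `β`. -/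
theorem exists_mul_transformedDrift_le (hA : CoefficientAssumption b σ ξ Lb Kb Lσ γ η)
    (hc : AdmissibleRadius b σ ξ c₀) (hα : 0 < α) (hβ : 0 < β)
    (hmono : MonotonicityCondition b σ α β) :
    ∃ a : ℝ, 0 ≤ a ∧ ∀ z, z * transformedDrift b σ ξ c₀ z ≤ a + β * z ^ 2 := by
  obtain ⟨R, hR, hξR, hout⟩ := exists_radius ξ hc.pos
  obtain ⟨C, hC, hGC⟩ := exists_abs_G_sub_le (b := b) (σ := σ) (ξ := ξ) hc.pos
  obtain ⟨M, hM⟩ := (isCompact_Icc (a := -R) (b := R)).exists_bound_of_continuousOn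
    (hA.continuous_extendedDrift hc).continuousOn
  have hM0 : 0 ≤ M := (norm_nonneg _).trans (hM 0 ⟨by linarith, hR.le⟩)
  refine ⟨α + (R + C) * M, by positivity, fun z ↦ ?_⟩
  obtain ⟨x, rfl⟩ := surjective_G (b := b) (σ := σ) (ξ := ξ) hc.pos z
  rw [transformedDrift, GInv_G hA.strictMono hc]
  have hRC : 0 ≤ (R + C) * M := by positivity
  rcases le_total R |x| with h | h
  · have hx : x ∉ Set.range ξ := by
      rintro ⟨i, rfl⟩
      exact absurd (hξR i) (not_lt.2 h)
    rw [G_eq_self hc.pos (hout x h), extendedDrift_eq hc.pos hx, Gderiv_eq_one (hout x h),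
      Gcurv_eq_zero (hout x h)]
    have := (le_max_left _ _).trans (hmono x)
    rw [sq_abs] at this
    linarith
  · have h1 : |G b σ ξ c₀ x| ≤ R + C := by
      have := abs_sub_abs_le_abs_sub (G b σ ξ c₀ x) x
      linarith [hGC x]
    have h2 := hM x (abs_le.1 h)
    rw [Real.norm_eq_abs] at h2
    have h3 : G b σ ξ c₀ x * extendedDrift b σ ξ c₀ x ≤ (R + C) * M := by
      refine (le_abs_self _).trans ?_
      rw [abs_mul]
      exact mul_le_mul h1 h2 (abs_nonneg _) (by positivity)
    have : 0 ≤ β * G b σ ξ c₀ x ^ 2 := by positivity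
    linarith

theorem exists_sq_transformedDiffusion_le (hA : CoefficientAssumption b σ ξ Lb Kb Lσ γ η)
    (hc : AdmissibleRadius b σ ξ c₀) (hα : 0 < α) (hβ : 0 < β)
    (hmono : MonotonicityCondition b σ α β) :
    ∃ A : ℝ, ∀ z, transformedDiffusion b σ ξ c₀ z ^ 2 ≤ A * (1 + z ^ 2) := by
  obtain ⟨C, hC, hGC⟩ := exists_abs_G_sub_le (b := b) (σ := σ) (ξ := ξ) hc.pos
  refine ⟨4 * (α + 2 * β + 2 * β * C ^ 2), fun z ↦ ?_⟩
  obtain ⟨x, rfl⟩ := surjective_G (b := b) (σ := σ) (ξ := ξ) hc.pos z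
  rw [transformedDiffusion, GInv_G hA.strictMono hc, deriv_G hc.pos, mul_pow]
  have h1 := (le_max_right _ _).trans (hmono x)
  rw [sq_abs, sq_abs] at h1
  have h2 : Gderiv b σ ξ c₀ x ^ 2 ≤ 2 ^ 2 := pow_le_pow_left₀
    (Gderiv_nonneg hA.strictMono hc x) (Gderiv_le_two hA.strictMono hc x) 2
  set z := G b σ ξ c₀ x
  have h3 : (z - x) ^ 2 ≤ C ^ 2 := sq_le_sq' (by linarith [(abs_le.1 (hGC x)).1])
    (abs_le.1 (hGC x)).2
  have h4 : x ^ 2 ≤ 2 * z ^ 2 + 2 * C ^ 2 := by nlinarith [sq_nonneg (2 * z - x)]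
  have h5 : σ x ^ 2 * Gderiv b σ ξ c₀ x ^ 2 ≤ (α + β * x ^ 2) * 2 ^ 2 :=
    mul_le_mul h1 h2 (sq_nonneg _) (by positivity)
  have h6 := mul_le_mul_of_nonneg_left h4 hβ.le
  have h7 : 0 ≤ α * z ^ 2 := by positivity
  have h8 : 0 ≤ β * C ^ 2 * z ^ 2 := by positivity
  nlinarith

end CoefficientAssumption

end

/-! ### Stopped walks and exit times on dyadic grids -/

section

theorem pow_succ_add_mul_le {y v : ℝ} (hy : 0 ≤ y) (hv : 0 ≤ v) (i : ℕ) :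
    y ^ (i + 1) + (i + 1) * y ^ i * (v - y) ≤ v ^ (i + 1) := by
  induction i with
  | zero => simp
  | succ i ih =>
    have h1 := mul_le_mul_of_nonneg_left ih hv
    have h2 : 0 ≤ (i + 1) * y ^ i * (v - y) ^ 2 := by positivity
    have e : v * (y ^ (i + 1) + (i + 1) * y ^ i * (v - y)) = y ^ (i + 1 + 1)
        + ((i : ℝ) + 1 + 1) * y ^ (i + 1) * (v - y) + (i + 1) * y ^ i * (v - y) ^ 2 := by ring
    rw [pow_succ' v]
    push_cast
    linarith

/-- The supporting line of the convex function `x ↦ |x| ^ (i + 1)` lies below its graph. -/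
theorem abs_pow_succ_add_le (x g : ℝ) (i : ℕ) :
    |x| ^ (i + 1) + ((i + 1) * (SignType.sign x * |x| ^ i)) * g ≤ |x + g| ^ (i + 1) := by
  have hs : SignType.sign x * g ≤ |x + g| - |x| := by
    rcases lt_trichotomy x 0 with h | h | h
    · rw [sign_neg h, abs_of_neg h]
      have := neg_le_abs (x + g)
      simp; linarith
    · simp [h]
    · rw [sign_pos h, abs_of_pos h]
      have := le_abs_self (x + g)
      simp; linarith
  have h1 := pow_succ_add_mul_le (abs_nonneg x) (abs_nonneg (x + g)) i
  have h2 := mul_le_mul_of_nonneg_left hs (by positivity : 0 ≤ ((i : ℝ) + 1) * |x| ^ i)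
  linarith

/-- The random walk with steps `g`, stopped when its absolute value first exceeds `A`. -/
def stoppedWalk (A : ℝ) (g : ℕ → ℝ) : ℕ → ℝ
  | 0 => 0
  | n + 1 => if |stoppedWalk A g n| ≤ A then stoppedWalk A g n + g n else stoppedWalk A g n

theorem stoppedWalk_congr {A : ℝ} {g g' : ℕ → ℝ} {n : ℕ} (h : ∀ i < n, g i = g' i) :
    stoppedWalk A g n = stoppedWalk A g' n := by
  induction n with
  | zero => rfl
  | succ n ih =>
    rw [stoppedWalk, stoppedWalk, ih fun i hi ↦ h i (by omega), h n (by omega)]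

theorem exists_stoppedWalk_eq (A : ℝ) (g : ℕ → ℝ) (n : ℕ) :
    ∃ j ≤ n, stoppedWalk A g n = ∑ l ∈ Finset.range j, g l ∧
      (∀ i < j, |∑ l ∈ Finset.range i, g l| ≤ A) ∧
      (j = n ∨ A < |∑ l ∈ Finset.range j, g l|) := by
  induction n with
  | zero => exact ⟨0, le_rfl, by simp [stoppedWalk], by simp, Or.inl rfl⟩
  | succ n ih =>
    obtain ⟨j, hj, he, hlt, hor⟩ := ih
    by_cases hle : |stoppedWalk A g n| ≤ A
    · have hjn : j = n := hor.resolve_right (by rw [← he]; exact not_lt.2 hle)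
      subst hjn
      refine ⟨j + 1, le_rfl, ?_, fun i hi ↦ ?_, Or.inl rfl⟩
      · rw [stoppedWalk, if_pos hle, he, Finset.sum_range_succ]
      · rcases Nat.lt_succ_iff_lt_or_eq.1 hi with h | rfl
        · exact hlt i h
        · rwa [← he]
    · refine ⟨j, hj.trans (Nat.le_succ n), ?_, hlt, Or.inr ?_⟩
      · rw [stoppedWalk, if_neg hle, he]
      · rw [← he]; exact not_le.1 hle

theorem measurable_stoppedWalk {Ω : Type*} {m : MeasurableSpace Ω} (A : ℝ) {g : ℕ → Ω → ℝ} {n : ℕ}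
    (hg : ∀ i < n, Measurable (g i)) : Measurable fun ω ↦ stoppedWalk A (g · ω) n := by
  induction n with
  | zero => exact measurable_const
  | succ n ih =>
    have h1 := ih fun i hi ↦ hg i (by omega)
    simp only [stoppedWalk]
    exact Measurable.ite (measurableSet_le h1.abs measurable_const) (h1.add (hg n (by omega))) h1

/-- Let `θ` be the first time at which `f` leaves the band of width `A` around `f s`, or `s + h` if
there is none. If `j n` is the first index at which `f` is seen outside the band on the grid of mesh
`h / 2 ^ n`, then the values of `f` at these grid times converge to `f θ`. -/
theorem tendsto_gridExit {f : ℝ → ℝ} {s h A θ : ℝ} (hh : 0 < h)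
    (hf : ContinuousOn f (Set.Icc s (s + h))) (hsθ : s ≤ θ) (hθ : θ ≤ s + h)
    (hbefore : ∀ t, s ≤ t → t < θ → |f t - f s| ≤ A)
    (hafter : θ < s + h → ∀ c, θ < c → ∃ t, θ ≤ t ∧ t < c ∧ A < |f t - f s|)
    {j : ℕ → ℕ} (hj : ∀ n, j n ≤ 2 ^ n)
    (hjlt : ∀ n, ∀ i < j n, |f (s + i * (h / 2 ^ n)) - f s| ≤ A)
    (hjor : ∀ n, j n = 2 ^ n ∨ A < |f (s + j n * (h / 2 ^ n)) - f s|) :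
    Tendsto (fun n ↦ f (s + j n * (h / 2 ^ n))) atTop (𝓝 (f θ)) := by
  have hle : ∀ n, s + j n * (h / 2 ^ n) ≤ s + h := fun n ↦ by
    have h1 : (j n : ℝ) ≤ 2 ^ n := by exact_mod_cast hj n
    have h2 := mul_le_mul_of_nonneg_right h1 (by positivity : 0 ≤ h / 2 ^ n)
    have h3 : (2 : ℝ) ^ n * (h / 2 ^ n) = h := by field_simp
    linarith
  have hge : ∀ n, s ≤ s + j n * (h / 2 ^ n) := fun n ↦ by
    have : 0 ≤ j n * (h / 2 ^ n) := by positivity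
    linarith
  have hθle : ∀ n, θ ≤ s + j n * (h / 2 ^ n) := fun n ↦ by
    rcases hjor n with h1 | h1
    · rw [h1]; push_cast
      have h3 : (2 : ℝ) ^ n * (h / 2 ^ n) = h := by field_simp
      linarith
    · exact not_lt.1 fun hlt ↦ absurd (hbefore _ (hge n) hlt) (not_le.2 h1)
  have hτ : Tendsto (fun n ↦ s + j n * (h / 2 ^ n)) atTop (𝓝 θ) := by
    refine tendsto_order.2 ⟨fun a ha ↦ Eventually.of_forall fun n ↦ ha.trans_le (hθle n),
      fun c hc ↦ ?_⟩
    rcases hθ.eq_or_lt with heq | hlt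
    · exact Eventually.of_forall fun n ↦ (hle n).trans_lt (heq ▸ hc)
    · obtain ⟨t, htθ, htc, htA⟩ := hafter hlt (min c (s + h)) (lt_min hc hlt)
      have htc1 : t < c := htc.trans_le (min_le_left _ _)
      have htc2 : t < s + h := htc.trans_le (min_le_right _ _)
      have hst : s ≤ t := hsθ.trans htθ
      have hcont : Tendsto (fun u ↦ |f u - f s|) (𝓝[Set.Icc s (s + h)] t) (𝓝 |f t - f s|) :=
        ((hf t ⟨hst, htc2.le⟩).sub tendsto_const_nhds).abs
      obtain ⟨ε, hε, hball⟩ := Metric.mem_nhdsWithin_iff.1 (hcont (Ioi_mem_nhds htA))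
      set w := min ε (min (c - t) (s + h - t)) with hw
      have hw0 : 0 < w := lt_min hε (lt_min (by linarith) (by linarith))
      have hδ : Tendsto (fun n : ℕ ↦ h / 2 ^ n) atTop (𝓝 0) :=
        tendsto_const_nhds.div_atTop (tendsto_pow_atTop_atTop_of_one_lt one_lt_two)
      filter_upwards [hδ.eventually (Iio_mem_nhds hw0)] with n hn
      have hn' : h / 2 ^ n < w := hn
      have hδ0 : 0 < h / 2 ^ n := by positivity
      set δ := h / 2 ^ n with hδdef
      have hi1 : (t - s) / δ ≤ ⌈(t - s) / δ⌉₊ := Nat.le_ceil _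
      have hi2 : (⌈(t - s) / δ⌉₊ : ℝ) < (t - s) / δ + 1 :=
        Nat.ceil_lt_add_one (div_nonneg (by linarith) hδ0.le)
      -- The first grid point after `t` is so close to `t` that `f` is outside the band there.
      set i := ⌈(t - s) / δ⌉₊
      have hi1' : t ≤ s + i * δ := by
        rw [div_le_iff₀ hδ0] at hi1; linarith
      have hi2' : s + i * δ < t + w := by
        have := mul_lt_mul_of_pos_right hi2 hδ0
        rw [add_mul, div_mul_cancel₀ _ hδ0.ne'] at this
        linarith
      have hwε : w ≤ ε := min_le_left _ _
      have hwc : w ≤ c - t := (min_le_right _ _).trans (min_le_left _ _)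
      have hwh : w ≤ s + h - t := (min_le_right _ _).trans (min_le_right _ _)
      have hmem : A < |f (s + i * δ) - f s| := hball ⟨by
        rw [Metric.mem_ball, Real.dist_eq, abs_lt]; constructor <;> linarith,
        by constructor <;> linarith⟩
      have hji : j n ≤ i := not_lt.1 fun hlt ↦ absurd (hjlt n i hlt) (not_le.2 hmem)
      have : (j n : ℝ) * δ ≤ i * δ := mul_le_mul_of_nonneg_right (by exact_mod_cast hji) hδ0.le
      linarith
  exact (hf θ ⟨hsθ, hθ⟩).tendsto.comp (tendsto_nhdsWithin_iff.2
    ⟨hτ, Eventually.of_forall fun n ↦ ⟨hge n, hle n⟩⟩)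

end

/-! ### Brownian increments -/

section

namespace IsBrownianMotionOn

variable {Ω : Type*} [MeasurableSpace Ω] {P : Measure Ω} {T : ℝ≥0} {W : ℝ≥0 → Ω → ℝ}

/-- Time is capped at `T`, since nothing is known about `W` beyond. -/
theorem isGaussianProcess (hW : IsBrownianMotionOn T W P) :
    IsGaussianProcess (fun t ↦ W (min t T)) P where
  hasGaussianLaw I := by
    classical
    set J : Finset ℝ≥0 := I.image (min · T) with hJ
    have hmem : ∀ i : I, min (i : ℝ≥0) T ∈ J := fun i ↦ Finset.mem_image_of_mem _ i.2
    have h1 : HasGaussianLaw (fun ω ↦ J.restrict (W · ω)) P := (hW.hasLaw J fun t ht ↦ by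
      obtain ⟨s, -, rfl⟩ := Finset.mem_image.1 ht
      exact min_le_right _ _).hasGaussianLaw
    exact h1.map (ContinuousLinearMap.pi fun i : I ↦
      ContinuousLinearMap.proj (R := ℝ) (φ := fun _ : J ↦ ℝ) ⟨_, hmem i⟩)

theorem aemeasurable (hW : IsBrownianMotionOn T W P) {t : ℝ≥0} (ht : t ≤ T) :
    AEMeasurable (W t) P := by
  simpa [min_eq_left ht] using hW.isGaussianProcess.aemeasurable t

theorem hasLaw_sub (hW : IsBrownianMotionOn T W P) {s t : ℝ≥0} (hs : s ≤ T) (ht : t ≤ T) :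
    HasLaw (fun ω ↦ W t ω - W s ω) (gaussianReal 0 (nndist (t : ℝ) s)) P := by
  classical
  exact (BrownianReal.measurePreserving_eval_sub_eval_projectiveFamily
    {t, s} ⟨t, by simp⟩ ⟨s, by simp⟩).hasLaw.comp (hW.hasLaw {t, s} (by simp [hs, ht]))

theorem covariance_eval (hW : IsBrownianMotionOn T W P) {s t : ℝ≥0} (hs : s ≤ T) (ht : t ≤ T) :
    cov[fun ω ↦ W s ω, fun ω ↦ W t ω; P] = min s t := by
  classical
  convert (hW.hasLaw {s, t} (by simp [hs, ht])).covariance_fun_comp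
    (f := Function.eval ⟨s, by simp⟩) (g := fun x ↦ x ⟨t, by simp⟩) ?_ ?_
  · simp
  · simp
  · rw [BrownianReal.covariance_eval_projectiveFamily]
  all_goals exact Measurable.aemeasurable (by fun_prop)

theorem hasIndepIncrements (hW : IsBrownianMotionOn T W P) :
    HasIndepIncrements (fun t ↦ W (min t T)) P := by
  have : IsProbabilityMeasure P := hW.isGaussianProcess.isProbabilityMeasure
  refine fun n t ht ↦ hW.isGaussianProcess.hasGaussianLaw_increments.iIndepFun_of_covariance_eq_zero
    fun i j hij ↦ ?_
  rw [covariance_fun_sub_fun_sub]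
  · simp_rw [hW.covariance_eval (min_le_right _ T) (min_le_right _ T)]
    wlog h : i < j generalizing i j
    · have := this j i hij.symm (by grind)
      simp_rw [min_comm (min (t (Fin.succ j)) T), min_comm (min (t (Fin.castSucc j)) T)] at this
      linarith
    have h1 : i.succ ≤ j.succ := Fin.strictMono_succ h |>.le
    have h2 : i.castSucc ≤ j.succ := Fin.le_of_lt h1
    have h3 : i.castSucc ≤ j.castSucc := Fin.le_castSucc_iff.mpr h1
    have hm : ∀ {a b : Fin (n + 1)}, a ≤ b → min (t a) T ≤ min (t b) T :=
      fun hab ↦ min_le_min_right _ (ht hab)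
    rw [min_eq_left (hm h1), min_eq_left (hm h), min_eq_left (hm h2), min_eq_left (hm h3)]
    simp
  all_goals exact (hW.isGaussianProcess.hasGaussianLaw_eval _).memLp_two

end IsBrownianMotionOn

/-- The `2j`-th moment of the standard normal distribution. -/
def normalMoment (j : ℕ) : ℝ := ∫ x, x ^ (2 * j) ∂gaussianReal 0 1

theorem normalMoment_nonneg (j : ℕ) : 0 ≤ normalMoment j :=
  integral_nonneg fun x ↦ by rw [pow_mul]; positivity

theorem integrable_pow_of_hasLaw_gaussianReal {Ω : Type*} [MeasurableSpace Ω] {P : Measure Ω}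
    {X : Ω → ℝ} {v : ℝ≥0} (hX : HasLaw X (gaussianReal 0 v) P) (j : ℕ) :
    Integrable (fun ω ↦ X ω ^ j) P := by
  have : IsProbabilityMeasure P := hX.isProbabilityMeasure
  rcases eq_or_ne j 0 with rfl | hj
  · simp
  have h1 : MemLp X j P := by
    have := memLp_id_gaussianReal (μ := 0) (v := v) j
    rw [← hX.map_eq] at this
    exact this.comp_of_map hX.aemeasurable
  refine h1.integrable_norm_pow hj |>.mono' (hX.aemeasurable.pow_const j).aestronglyMeasurable ?_
  filter_upwards with ω
  simp

theorem integral_pow_of_hasLaw_gaussianReal {Ω : Type*} [MeasurableSpace Ω] {P : Measure Ω}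
    {X : Ω → ℝ} {v : ℝ≥0} (hX : HasLaw X (gaussianReal 0 v) P) (j : ℕ) :
    ∫ ω, X ω ^ (2 * j) ∂P = normalMoment j * v ^ j := by
  have h1 : ∫ ω, X ω ^ (2 * j) ∂P = ∫ x, x ^ (2 * j) ∂gaussianReal 0 v :=
    hX.integral_comp (f := fun x ↦ x ^ (2 * j)) (by fun_prop)
  have h2 : gaussianReal 0 v = (gaussianReal 0 1).map (√(v : ℝ) * ·) := by
    rw [gaussianReal_map_const_mul]
    congr 1
    · simp
    · ext; simp
  rw [h1, h2, integral_map (by fun_prop) (by fun_prop), normalMoment]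
  simp_rw [mul_pow, integral_const_mul]
  rw [pow_mul, Real.sq_sqrt (NNReal.coe_nonneg v), mul_comm]

end

/-! ### Moments and independence of stopped walks -/

section

variable {Ω : Type*} [MeasurableSpace Ω] {P : Measure Ω}

theorem indepFun_fin_of_iIndepFun {g : ℕ → Ω → ℝ} (hi : iIndepFun g P)
    (hg : ∀ i, Measurable (g i)) (n : ℕ) : IndepFun (fun ω (i : Fin n) ↦ g i ω) (g n) P := by
  have h := hi.indepFun_finset₀ (Finset.range n) {n} (by simp) fun i ↦ (hg i).aemeasurable
  have h1 : Measurable fun (y : Finset.range n → ℝ) (i : Fin n) ↦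
    y ⟨i, Finset.mem_range.2 i.2⟩ := by fun_prop
  have h2 : Measurable fun y : ({n} : Finset ℕ) → ℝ ↦ y ⟨n, Finset.mem_singleton_self n⟩ :=
    measurable_pi_apply _
  exact h.comp h1 h2

theorem memLp_two_abs_pow [IsProbabilityMeasure P] {X : Ω → ℝ} (hX : ∀ q : ℕ, MemLp X q P) (j : ℕ) :
    MemLp (fun ω ↦ |X ω| ^ j) 2 P := by
  have hm : AEStronglyMeasurable X P := (hX 0).1
  rw [memLp_two_iff_integrable_sq (by fun_prop)]
  refine ((hX (j * 2)).integrable_norm_pow').congr ?_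
  filter_upwards with ω
  rw [Real.norm_eq_abs, pow_mul]

theorem memLp_sum [IsProbabilityMeasure P] {g : ℕ → Ω → ℝ} (hm : ∀ i (q : ℕ), MemLp (g i) q P)
    (n : ℕ) (q : ℕ) : MemLp (fun ω ↦ ∑ l ∈ Finset.range n, g l ω) q P :=
  memLp_finsetSum _ fun i _ ↦ hm i q

/-- Doob's inequality for the submartingale `|x| ^ j`, where `x` is a centred random walk. -/
theorem integral_sq_partialSups_walk_le [IsProbabilityMeasure P] {g : ℕ → Ω → ℝ}
    (hg : ∀ i, Measurable (g i)) (hi : iIndepFun g P) (hm : ∀ i (q : ℕ), MemLp (g i) q P)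
    (hmean : ∀ i, ∫ ω, g i ω ∂P = 0) (n j : ℕ) :
    MemLp (fun ω ↦ partialSups (fun i ↦ |∑ l ∈ Finset.range i, g l ω| ^ j) n) 2 P ∧
      ∫ ω, (partialSups (fun i ↦ |∑ l ∈ Finset.range i, g l ω| ^ j) n) ^ 2 ∂P ≤
        4 * ∫ ω, (|∑ l ∈ Finset.range n, g l ω| ^ j) ^ 2 ∂P := by
  have hint : ∀ k < n, Integrable (g k) P := fun k _ ↦ (hm k 1).integrable (by simp)
  have hx : ∀ k, Measurable[past g k] fun ω ↦ ∑ l ∈ Finset.range k, g l ω := fun k ↦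
    Finset.measurable_fun_sum _ fun l hl ↦ measurable_past (Finset.mem_range.1 hl)
  have hsign : Measurable fun x : ℝ ↦ (SignType.sign x : ℝ) :=
    Monotone.measurable fun x y hxy ↦ by
      have := SignType.sign.monotone hxy
      revert this
      cases SignType.sign x <;> cases SignType.sign y <;>
        first | exact fun h ↦ absurd h (by decide) | (intro; norm_num)
  have habs : Measurable fun x : ℝ ↦ |x| ^ j := by fun_prop
  have hS : ∀ k ≤ n, Measurable[past g k] fun ω ↦ |∑ l ∈ Finset.range k, g l ω| ^ j :=
    fun k _ ↦ habs.comp (hx k)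
  have hS2 := fun k (_ : k ≤ n) ↦ memLp_two_abs_pow (memLp_sum hm k) j
  rcases j with _ | j
  · exact integral_sq_partialSups_le hg (fun k _ ↦ indepFun_fin_of_iIndepFun hi hg k) hint
      (fun k _ ↦ hmean k) hS (a := fun _ _ ↦ 0) (fun _ _ ↦ measurable_const)
      (fun _ _ ↦ by positivity) hS2 (fun _ _ ↦ MemLp.zero) (fun k _ ω ↦ by simp)
  · have hfac : Measurable fun x : ℝ ↦ (SignType.sign x : ℝ) * |x| ^ j := hsign.mul (by fun_prop)
    refine integral_sq_partialSups_le hg (fun k _ ↦ indepFun_fin_of_iIndepFun hi hg k) hint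
      (fun k _ ↦ hmean k) hS
      (a := fun k ω ↦ (j + 1) * (SignType.sign (∑ l ∈ Finset.range k, g l ω) *
        |∑ l ∈ Finset.range k, g l ω| ^ j)) (fun k _ ↦ ?_)
      (fun _ _ ↦ by positivity) hS2 (fun k hk ↦ ?_) (fun k _ ω ↦ ?_)
    · exact (hfac.comp (hx k)).const_mul _
    · refine ((memLp_two_abs_pow (memLp_sum hm k) j).mono ?_ (ae_of_all _ fun ω ↦ ?_)).const_mul _
      · exact ((hfac.comp (hx k)).mono (past_le hg k) le_rfl).aestronglyMeasurable
      · rw [norm_mul]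
        refine mul_le_of_le_one_left (norm_nonneg _) ?_
        cases SignType.sign (∑ l ∈ Finset.range k, g l ω) <;> simp
    · simp only [Finset.sum_range_succ]
      exact_mod_cast abs_pow_succ_add_le _ _ j

theorem abs_stoppedWalk_pow_le (A : ℝ) (g : ℕ → ℝ) (n j : ℕ) :
    |stoppedWalk A g n| ^ j ≤ partialSups (fun i ↦ |∑ l ∈ Finset.range i, g l| ^ j) n := by
  obtain ⟨i, hi, he, -, -⟩ := exists_stoppedWalk_eq A g n
  rw [he]
  exact le_partialSups_of_le (fun i ↦ |∑ l ∈ Finset.range i, g l| ^ j) hi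

theorem integral_stoppedWalk_pow_le [IsProbabilityMeasure P] {g : ℕ → Ω → ℝ}
    (hg : ∀ i, Measurable (g i)) (hi : iIndepFun g P) (hm : ∀ i (q : ℕ), MemLp (g i) q P)
    (hmean : ∀ i, ∫ ω, g i ω ∂P = 0) (A : ℝ) (n j : ℕ) :
    Integrable (fun ω ↦ stoppedWalk A (g · ω) n ^ (2 * j)) P ∧
      ∫ ω, stoppedWalk A (g · ω) n ^ (2 * j) ∂P ≤
        4 * ∫ ω, (∑ l ∈ Finset.range n, g l ω) ^ (2 * j) ∂P := by
  obtain ⟨h1, h2⟩ := integral_sq_partialSups_walk_le hg hi hm hmean n j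
  have hmeas := measurable_stoppedWalk (n := n) A fun i _ ↦ hg i
  have hle : ∀ ω, stoppedWalk A (g · ω) n ^ (2 * j) ≤
      (partialSups (fun i ↦ |∑ l ∈ Finset.range i, g l ω| ^ j) n) ^ 2 := fun ω ↦ by
    have := pow_le_pow_left₀ (by positivity) (abs_stoppedWalk_pow_le A (g · ω) n j) 2
    rwa [← abs_pow, sq_abs, ← pow_mul, mul_comm j] at this
  have h0 : ∀ ω, 0 ≤ stoppedWalk A (g · ω) n ^ (2 * j) := fun ω ↦ by rw [pow_mul]; positivity
  have hint : Integrable (fun ω ↦ stoppedWalk A (g · ω) n ^ (2 * j)) P := by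
    refine h1.integrable_sq.mono' (hmeas.pow_const _).aestronglyMeasurable (ae_of_all _ fun ω ↦ ?_)
    rw [Real.norm_of_nonneg (h0 ω)]
    exact hle ω
  refine ⟨hint, (integral_mono hint h1.integrable_sq hle).trans (h2.trans_eq ?_)⟩
  congr 2
  ext ω
  rw [← abs_pow, sq_abs, ← pow_mul, mul_comm j]

/-- Optional stopping: the stopped walk is a martingale transform of a centred random walk. -/
theorem integral_stoppedWalk [IsProbabilityMeasure P] {g : ℕ → Ω → ℝ}
    (hg : ∀ i, Measurable (g i)) (hi : iIndepFun g P) (hint : ∀ i, Integrable (g i) P)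
    (hmean : ∀ i, ∫ ω, g i ω ∂P = 0) (A : ℝ) (n : ℕ) :
    Integrable (fun ω ↦ stoppedWalk A (g · ω) n) P ∧
      ∫ ω, stoppedWalk A (g · ω) n ∂P = 0 := by
  induction n with
  | zero => simp [stoppedWalk]
  | succ n ih =>
    have he : ∀ ω, stoppedWalk A (g · ω) (n + 1) = stoppedWalk A (g · ω) n +
        (if |stoppedWalk A (g · ω) n| ≤ A then 1 else 0) * g n ω := fun ω ↦ by
      rw [stoppedWalk]; split_ifs <;> simp
    have hr : Measurable[past g n] fun ω ↦ stoppedWalk A (g · ω) n :=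
      measurable_stoppedWalk A fun i hin ↦ measurable_past hin
    have hind : Measurable[past g n]
        fun ω ↦ if |stoppedWalk A (g · ω) n| ≤ A then (1 : ℝ) else 0 :=
      Measurable.comp (g := fun x : ℝ ↦ if |x| ≤ A then (1 : ℝ) else 0)
        (Measurable.ite (measurableSet_le (by fun_prop) measurable_const) measurable_const
          measurable_const) hr
    have hindep := indepFun_of_past (indepFun_fin_of_iIndepFun hi hg n) hind
    have hi1 : Integrable (fun ω ↦ if |stoppedWalk A (g · ω) n| ≤ A then (1 : ℝ) else 0) P :=
      Integrable.of_bound (hind.mono (past_le hg n) le_rfl).aestronglyMeasurable 1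
        (ae_of_all _ fun ω ↦ by split_ifs <;> simp)
    have hi2 : Integrable (fun ω ↦ (if |stoppedWalk A (g · ω) n| ≤ A then (1 : ℝ) else 0) * g n ω)
        P := hindep.integrable_mul hi1 (hint n)
    have hm2 := hindep.integral_fun_mul_eq_mul_integral hi1.1 (hint n).1
    simp only [he]
    refine ⟨ih.1.add hi2, ?_⟩
    rw [integral_add ih.1 hi2, ih.2, hm2, hmean n, mul_zero, add_zero]

/-- Stopped walks over consecutive blocks of `B` steps are each independent of those before. -/
theorem indepFun_stoppedWalk_blocks {g : ℕ → Ω → ℝ}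
    (hg : ∀ i, Measurable (g i)) (hi : iIndepFun g P) (A : ℝ) (B k : ℕ) :
    IndepFun (fun ω (i : Fin k) ↦ stoppedWalk A (fun l ↦ g (i * B + l) ω) B)
      (fun ω ↦ stoppedWalk A (fun l ↦ g (k * B + l) ω) B) P := by
  set S := Finset.range (k * B) with hS
  set S' := Finset.Ico (k * B) ((k + 1) * B) with hS'
  have h := hi.indepFun_finset₀ S S' (by
    rw [Finset.disjoint_left]; intro a ha hb
    exact absurd (Finset.mem_range.1 ha) (not_lt.2 (Finset.mem_Ico.1 hb).1))
    fun i ↦ (hg i).aemeasurable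
  -- The walk over a block as a function of the variables in `R`, with zero for missing ones.
  have hmeas : ∀ (R : Finset ℕ) (c : ℕ), Measurable fun y : R → ℝ ↦
      stoppedWalk A (fun l ↦ if hl : c + l ∈ R then y ⟨c + l, hl⟩ else 0) B := fun R c ↦
    measurable_stoppedWalk A (g := fun l (y : R → ℝ) ↦ if hl : c + l ∈ R then y ⟨c + l, hl⟩ else 0)
      fun l _ ↦ by by_cases hl : c + l ∈ R <;> simp only [hl, dite_true, dite_false] <;> fun_prop
  have h2 := h.comp
    (φ := fun y (i : Fin k) ↦ stoppedWalk A
      (fun l ↦ if hl : i * B + l ∈ S then y ⟨i * B + l, hl⟩ else 0) B)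
    (ψ := fun y ↦ stoppedWalk A
      (fun l ↦ if hl : k * B + l ∈ S' then y ⟨k * B + l, hl⟩ else 0) B)
    (measurable_pi_lambda _ fun i ↦ hmeas S (i * B)) (hmeas S' (k * B))
  convert h2 using 1
  · ext ω i
    refine stoppedWalk_congr fun l hl ↦ ?_
    have : i * B + l ∈ S := Finset.mem_range.2 (by
      have : ((i : ℕ) + 1) * B ≤ k * B := Nat.mul_le_mul_right _ i.2
      rw [add_mul] at this; omega)
    simp [this]
  · ext ω
    refine stoppedWalk_congr fun l hl ↦ ?_
    have : k * B + l ∈ S' := Finset.mem_Ico.2 (by rw [add_mul]; omega)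
    simp [this]

end

/-! ### Limits of noises -/

section

variable {Ω : Type*} [MeasurableSpace Ω] {P : Measure Ω}

/-- The moment constants of the Brownian noises in the sense of `IsNoise`. -/
def noiseConst (Q : ℕ) : ℝ :=
  2 ^ Q * (1 + 4 * normalMoment 1 + 4 * normalMoment Q + 4 * normalMoment (Q + 1))

/-- Bounds for the even moments of Gaussian type, up to the factor `4` of Doob's inequality, suffice
for a noise, by `(1 + y²) ^ Q ≤ 2 ^ Q * (1 + y ^ (2 * Q))`. -/
theorem isNoise_of_moment_le [IsProbabilityMeasure P] {N : ℕ} {h : ℝ} (h0 : 0 ≤ h) (h1 : h ≤ 1)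
    {D : ℕ → Ω → ℝ} (hD : ∀ k < N, AEMeasurable (D k) P)
    (hi : ∀ k < N, IndepFun (fun ω (i : Fin k) ↦ D i ω) (D k) P)
    (hmean : ∀ k < N, ∫ ω, D k ω ∂P = 0)
    (hmom : ∀ k < N, ∀ j, Integrable (fun ω ↦ D k ω ^ (2 * j)) P ∧
      ∫ ω, D k ω ^ (2 * j) ∂P ≤ 4 * normalMoment j * h ^ j) :
    IsNoise P N h noiseConst D := by
  have hle : ∀ (Q : ℕ) (y : ℝ), (1 + y ^ 2) ^ Q ≤ 2 ^ Q * (1 + y ^ (2 * Q)) := fun Q y ↦ by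
    have h2 := add_pow_le zero_le_one (sq_nonneg y) Q
    have h3 : (2 : ℝ) ^ (Q - 1) ≤ 2 ^ Q := pow_le_pow_right₀ one_le_two (Nat.sub_le _ _)
    rw [one_pow, ← pow_mul] at h2
    refine h2.trans (mul_le_mul_of_nonneg_right h3 ?_)
    rw [pow_mul]; positivity
  refine ⟨hD, hi, fun k hk Q ↦ ?_, hmean, fun k hk Q ↦ ?_⟩
  · have hm := hD k hk
    refine (((integrable_const (1 : ℝ)).add (hmom k hk Q).1).const_mul (2 ^ Q)).mono'
      (by fun_prop) (ae_of_all _ fun ω ↦ ?_)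
    rw [Real.norm_of_nonneg (by positivity)]
    exact hle Q (D k ω)
  · obtain ⟨i1, m1⟩ := hmom k hk 1
    obtain ⟨iQ, mQ⟩ := hmom k hk Q
    obtain ⟨iQ1, mQ1⟩ := hmom k hk (Q + 1)
    have hmono : ∀ ω, (h + D k ω ^ 2) * (1 + D k ω ^ 2) ^ Q ≤
        2 ^ Q * (h + D k ω ^ (2 * 1) + h * D k ω ^ (2 * Q) + D k ω ^ (2 * (Q + 1))) := fun ω ↦ by
      have := mul_le_mul_of_nonneg_left (hle Q (D k ω)) (by positivity : 0 ≤ h + D k ω ^ 2)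
      refine this.trans_eq ?_
      ring
    have ia : Integrable (fun ω ↦ h + D k ω ^ (2 * 1)) P := (integrable_const h).add i1
    have iab : Integrable (fun ω ↦ h + D k ω ^ (2 * 1) + h * D k ω ^ (2 * Q)) P :=
      ia.add (iQ.const_mul h)
    have ib : Integrable (fun ω ↦ 2 ^ Q * (h + D k ω ^ (2 * 1) + h * D k ω ^ (2 * Q) +
        D k ω ^ (2 * (Q + 1)))) P := (iab.add iQ1).const_mul _
    refine (integral_mono_of_nonneg (ae_of_all _ fun ω ↦ by positivity) ib
      (ae_of_all _ hmono)).trans ?_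
    have e : ∫ ω, 2 ^ Q * (h + D k ω ^ (2 * 1) + h * D k ω ^ (2 * Q) + D k ω ^ (2 * (Q + 1))) ∂P =
        2 ^ Q * (h + ∫ ω, D k ω ^ (2 * 1) ∂P + h * ∫ ω, D k ω ^ (2 * Q) ∂P +
          ∫ ω, D k ω ^ (2 * (Q + 1)) ∂P) := by
      rw [integral_const_mul, integral_add iab iQ1, integral_add ia (iQ.const_mul h),
        integral_add (integrable_const h) i1, integral_const_mul]
      simp
    rw [e, noiseConst, mul_assoc]
    refine mul_le_mul_of_nonneg_left ?_ (by positivity)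
    have hp : ∀ Q : ℕ, h ^ Q ≤ 1 := fun Q ↦ pow_le_one₀ h0 h1
    have n1 := normalMoment_nonneg Q
    have n2 := normalMoment_nonneg (Q + 1)
    have b1 : h * ∫ ω, D k ω ^ (2 * Q) ∂P ≤ 4 * normalMoment Q * h := by
      refine (mul_le_mul_of_nonneg_left (mQ.trans (mul_le_of_le_one_right (by positivity)
        (hp Q))) h0).trans_eq (mul_comm _ _)
    have b2 : ∫ ω, D k ω ^ (2 * (Q + 1)) ∂P ≤ 4 * normalMoment (Q + 1) * h := by
      refine mQ1.trans (mul_le_mul_of_nonneg_left ?_ (by positivity))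
      rw [pow_succ]
      exact mul_le_of_le_one_left h0 (hp Q)
    rw [pow_one] at m1
    linarith

/-- Fatou's lemma for even moments. -/
theorem integral_pow_le_of_tendsto {X : ℕ → Ω → ℝ} {Y : Ω → ℝ}
    (hX : ∀ n, AEMeasurable (X n) P) (hlim : ∀ᵐ ω ∂P, Tendsto (X · ω) atTop (𝓝 (Y ω))) {j : ℕ}
    {c : ℝ} (hmom : ∀ n, Integrable (fun ω ↦ X n ω ^ (2 * j)) P ∧ ∫ ω, X n ω ^ (2 * j) ∂P ≤ c) :
    Integrable (fun ω ↦ Y ω ^ (2 * j)) P ∧ ∫ ω, Y ω ^ (2 * j) ∂P ≤ c := by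
  have hY : AEMeasurable Y P := aemeasurable_of_tendsto_metrizable_ae atTop hX hlim
  have hpos : ∀ y : ℝ, 0 ≤ y ^ (2 * j) := fun y ↦ by rw [pow_mul]; positivity
  have hc : 0 ≤ c := (integral_nonneg fun ω ↦ hpos (X 0 ω)).trans (hmom 0).2
  have h1 : ∫⁻ ω, ENNReal.ofReal (Y ω ^ (2 * j)) ∂P ≤ ENNReal.ofReal c := by
    have h2 : ∫⁻ ω, ENNReal.ofReal (Y ω ^ (2 * j)) ∂P =
        ∫⁻ ω, liminf (fun n ↦ ENNReal.ofReal (X n ω ^ (2 * j))) atTop ∂P := by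
      refine lintegral_congr_ae ?_
      filter_upwards [hlim] with ω hω
      exact (ENNReal.tendsto_ofReal (hω.pow _)).liminf_eq.symm
    rw [h2]
    refine (lintegral_liminf_le' fun n ↦ ((hX n).pow_const _).ennreal_ofReal).trans ?_
    refine liminf_le_of_le (by isBoundedDefault) fun b hb ↦ ?_
    obtain ⟨n, hn⟩ := hb.exists
    refine hn.trans ?_
    rw [← ofReal_integral_eq_lintegral_ofReal (hmom n).1 (ae_of_all _ fun ω ↦ hpos _)]
    exact ENNReal.ofReal_le_ofReal (hmom n).2
  have hint : Integrable (fun ω ↦ Y ω ^ (2 * j)) P := by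
    refine ⟨(hY.pow_const _).aestronglyMeasurable, ?_⟩
    rw [hasFiniteIntegral_iff_ofReal (ae_of_all _ fun ω ↦ hpos _)]
    exact h1.trans_lt ENNReal.ofReal_lt_top
  refine ⟨hint, ?_⟩
  rw [← ofReal_integral_eq_lintegral_ofReal hint (ae_of_all _ fun ω ↦ hpos _)] at h1
  exact (ENNReal.ofReal_le_ofReal_iff hc).1 h1

/-- Bounded second moments give uniform integrability, so means pass to the limit. -/
theorem integral_eq_zero_of_tendsto [IsProbabilityMeasure P] {X : ℕ → Ω → ℝ} {Y : Ω → ℝ}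
    (hX : ∀ n, AEMeasurable (X n) P) (hlim : ∀ᵐ ω ∂P, Tendsto (X · ω) atTop (𝓝 (Y ω)))
    (hmean : ∀ n, ∫ ω, X n ω ∂P = 0) {c : ℝ}
    (hmom : ∀ n, Integrable (fun ω ↦ X n ω ^ 2) P ∧ ∫ ω, X n ω ^ 2 ∂P ≤ c) :
    ∫ ω, Y ω ∂P = 0 := by
  have hY : AEMeasurable Y P := aemeasurable_of_tendsto_metrizable_ae atTop hX hlim
  obtain ⟨hY2, hYc⟩ := integral_pow_le_of_tendsto (j := 1) hX hlim (by simpa using hmom)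
  simp only [mul_one] at hY2 hYc
  have hXi : ∀ n, Integrable (X n) P := fun n ↦
    ((memLp_two_iff_integrable_sq (hX n).aestronglyMeasurable).2 (hmom n).1).integrable one_le_two
  have hYi : Integrable Y P :=
    ((memLp_two_iff_integrable_sq hY.aestronglyMeasurable).2 hY2).integrable one_le_two
  -- Splitting `|x| ≤ min |x| R + x² / R` for `x = X n - Y`: the first part tends to `0` by
  -- dominated convergence, and the second one is of order `1 / R`.
  have key : ∀ R : ℝ, 0 < R → |∫ ω, Y ω ∂P| ≤ 4 * c / R := fun R hR ↦ by
    have hlim0 : Tendsto (fun n ↦ ∫ ω, min |X n ω - Y ω| R ∂P) atTop (𝓝 0) := by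
      have := tendsto_integral_of_dominated_convergence (μ := P)
        (F := fun n ω ↦ min |X n ω - Y ω| R) (f := fun _ ↦ 0) (fun _ ↦ R)
        (fun n ↦ ((((hX n).sub hY).abs).min aemeasurable_const).aestronglyMeasurable)
        (integrable_const R)
        (fun n ↦ ae_of_all _ fun ω ↦ by
          rw [Real.norm_of_nonneg (le_min (abs_nonneg _) hR.le)]
          exact min_le_right _ _)
        (by
          filter_upwards [hlim] with ω hω
          have h1 := ((hω.sub_const (Y ω)).abs).min (tendsto_const_nhds (x := R))
          simpa [hR.le] using h1)
      simpa using this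
    have hb : ∀ n, |∫ ω, Y ω ∂P| ≤ ∫ ω, min |X n ω - Y ω| R ∂P + 4 * c / R := fun n ↦ by
      have hmi : Integrable (fun ω ↦ min |X n ω - Y ω| R) P :=
        ((hXi n).sub hYi).abs.inf (integrable_const R)
      have hsq : Integrable (fun ω ↦ 2 * X n ω ^ 2 + 2 * Y ω ^ 2) P :=
        ((hmom n).1.const_mul 2).add (hY2.const_mul 2)
      have e1 : |∫ ω, Y ω ∂P| = |∫ ω, (X n ω - Y ω) ∂P| := by
        rw [integral_sub (hXi n) hYi, hmean n, zero_sub, abs_neg]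
      have e2 : ∫ ω, (2 * X n ω ^ 2 + 2 * Y ω ^ 2) ∂P ≤ 4 * c := by
        rw [integral_add ((hmom n).1.const_mul 2) (hY2.const_mul 2), integral_const_mul,
          integral_const_mul]
        linarith [(hmom n).2]
      have e3 : ∫ ω, |X n ω - Y ω| ∂P ≤
          ∫ ω, (min |X n ω - Y ω| R + (2 * X n ω ^ 2 + 2 * Y ω ^ 2) / R) ∂P := by
        refine integral_mono ((hXi n).sub hYi).abs (hmi.add (hsq.div_const R)) fun ω ↦ ?_
        simp only
        have hd : (X n ω - Y ω) ^ 2 ≤ 2 * X n ω ^ 2 + 2 * Y ω ^ 2 := by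
          nlinarith [sq_nonneg (X n ω + Y ω)]
        rcases le_total |X n ω - Y ω| R with hle | hle
        · rw [min_eq_left hle]
          have : 0 ≤ (2 * X n ω ^ 2 + 2 * Y ω ^ 2) / R := by positivity
          linarith
        · rw [min_eq_right hle]
          have : |X n ω - Y ω| ≤ (2 * X n ω ^ 2 + 2 * Y ω ^ 2) / R := by
            rw [le_div_iff₀ hR]
            have := mul_le_mul_of_nonneg_left hle (abs_nonneg (X n ω - Y ω))
            rw [← sq, sq_abs] at this
            linarith
          linarith
      rw [integral_add hmi (hsq.div_const R), integral_div] at e3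
      rw [e1]
      refine (abs_integral_le_integral_abs).trans (e3.trans ?_)
      gcongr
    have := hlim0.add_const (4 * c / R)
    rw [zero_add] at this
    exact ge_of_tendsto' this hb
  have hz : |∫ ω, Y ω ∂P| ≤ 0 :=
    ge_of_tendsto (tendsto_const_nhds.div_atTop tendsto_id)
      ((eventually_gt_atTop 0).mono fun R hR ↦ key R hR)
  exact abs_nonpos_iff.1 hz

/-- Independence is preserved under almost sure limits. -/
theorem indepFun_of_tendsto [IsProbabilityMeasure P] {k : ℕ} {X : ℕ → Fin k → Ω → ℝ}
    {U : ℕ → Ω → ℝ} {Y : Fin k → Ω → ℝ} {V : Ω → ℝ} (hX : ∀ n i, AEMeasurable (X n i) P)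
    (hU : ∀ n, AEMeasurable (U n) P)
    (hXY : ∀ᵐ ω ∂P, ∀ i, Tendsto (X · i ω) atTop (𝓝 (Y i ω)))
    (hUV : ∀ᵐ ω ∂P, Tendsto (U · ω) atTop (𝓝 (V ω)))
    (hi : ∀ n, IndepFun (fun ω i ↦ X n i ω) (U n) P) : IndepFun (fun ω i ↦ Y i ω) V P := by
  have hY : ∀ i, AEMeasurable (Y i) P := fun i ↦
    aemeasurable_of_tendsto_metrizable_ae atTop (hX · i) (hXY.mono fun ω hω ↦ hω i)
  have hV : AEMeasurable V P := aemeasurable_of_tendsto_metrizable_ae atTop hU hUV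
  refine pi_indepFun_of_bcf hY hV fun f g ↦ ?_
  have hf : ∀ᵐ ω ∂P, Tendsto (fun n ↦ f (X n · ω)) atTop (𝓝 (f (Y · ω))) := by
    filter_upwards [hXY] with ω hω
    exact (f.continuous.tendsto _).comp (tendsto_pi_nhds.2 hω)
  have hg : ∀ᵐ ω ∂P, Tendsto (fun n ↦ g (U n ω)) atTop (𝓝 (g (V ω))) := by
    filter_upwards [hUV] with ω hω
    exact (g.continuous.tendsto _).comp hω
  have mf : ∀ n, AEStronglyMeasurable (fun ω ↦ f (X n · ω)) P := fun n ↦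
    (f.continuous.measurable.comp_aemeasurable
      (aemeasurable_pi_lambda _ (hX n))).aestronglyMeasurable
  have mg : ∀ n, AEStronglyMeasurable (fun ω ↦ g (U n ω)) P := fun n ↦
    (g.continuous.measurable.comp_aemeasurable (hU n)).aestronglyMeasurable
  have l1 := tendsto_integral_of_dominated_convergence (fun _ ↦ ‖f‖) mf (integrable_const _)
    (fun n ↦ ae_of_all _ fun ω ↦ f.norm_coe_le_norm _) hf
  have l2 := tendsto_integral_of_dominated_convergence (fun _ ↦ ‖g‖) mg (integrable_const _)
    (fun n ↦ ae_of_all _ fun ω ↦ g.norm_coe_le_norm _) hg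
  have l3 := tendsto_integral_of_dominated_convergence (fun _ ↦ ‖f‖ * ‖g‖)
    (fun n ↦ (mf n).mul (mg n)) (integrable_const _)
    (fun n ↦ ae_of_all _ fun ω ↦ by
      rw [Pi.mul_apply, norm_mul]
      exact mul_le_mul (f.norm_coe_le_norm _) (g.norm_coe_le_norm _) (norm_nonneg _)
        (norm_nonneg _)) (by filter_upwards [hf, hg] with ω h1 h2 using h1.mul h2)
  have e : ∀ n, ∫ ω, ((fun ω ↦ f (X n · ω)) * fun ω ↦ g (U n ω)) ω ∂P =
      (∫ ω, f (X n · ω) ∂P) * ∫ ω, g (U n ω) ∂P := fun n ↦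
    ((hi n).comp f.continuous.measurable g.continuous.measurable).integral_fun_mul_eq_mul_integral
      (mf n) (mg n)
  exact tendsto_nhds_unique l3 ((l1.mul l2).congr fun n ↦ (e n).symm)

end

/-! ### The increments of Brownian motion form a noise -/

section

variable {Ω : Type*}

/-- The increment of `W`, capped at time `T`, over the `i`-th interval of the grid of mesh
`h / 2 ^ n`. The cap makes this a sequence over all `i : ℕ`, whose terms beyond `T` vanish. -/
def gridIncrement (W : ℝ≥0 → Ω → ℝ) (T h : ℝ≥0) (n i : ℕ) (ω : Ω) : ℝ :=
  W (min ((i + 1 : ℕ) * (h / 2 ^ n)) T) ω - W (min (i * (h / 2 ^ n)) T) ω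

theorem sum_gridIncrement {W : ℝ≥0 → Ω → ℝ} {T h : ℝ≥0} {n k j : ℕ} (hj : j ≤ 2 ^ n)
    (hk : (k + 1) * h ≤ T) (ω : Ω) :
    ∑ l ∈ Finset.range j, gridIncrement W T h n (k * 2 ^ n + l) ω =
      W (k * h + j * (h / 2 ^ n)) ω - W (k * h) ω := by
  have e : ∀ i : ℕ, ((k * 2 ^ n + i : ℕ) : ℝ≥0) * (h / 2 ^ n) = k * h + i * (h / 2 ^ n) :=
    fun i ↦ by push_cast; field_simp
  have hle : ∀ i : ℕ, i ≤ 2 ^ n → (k * h + i * (h / 2 ^ n) : ℝ≥0) ≤ T := fun i hi ↦ by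
    refine le_trans ?_ hk
    have h1 : (i : ℝ≥0) * (h / 2 ^ n) ≤ 2 ^ n * (h / 2 ^ n) := by
      gcongr; exact_mod_cast hi
    have h2 : (2 : ℝ≥0) ^ n * (h / 2 ^ n) = h := by field_simp
    rw [h2] at h1
    rw [add_mul, one_mul]
    gcongr
  have := Finset.sum_range_sub
    (fun l : ℕ ↦ W (min (((k * 2 ^ n + l : ℕ) : ℝ≥0) * (h / 2 ^ n)) T) ω) j
  simp only [gridIncrement, add_assoc]
  rw [this, e, e, min_eq_left (hle j hj), min_eq_left (hle 0 (by positivity))]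
  simp

/-- The truncated increment is the limit of dyadic random walks over `[k h, (k + 1) h]` that are
stopped when they exceed the truncation level. -/
theorem tendsto_stoppedWalk_truncIncrement {W : ℝ≥0 → Ω → ℝ} {T h : ℝ≥0} (hh : 0 < h) {k : ℕ}
    (hk : (k + 1) * h ≤ T) {ω : Ω} (hc : ContinuousOn (W · ω) (Set.Icc 0 T)) :
    Tendsto (fun n ↦ stoppedWalk (truncLevel h)
      (fun l ↦ gridIncrement W T h n (k * 2 ^ n + l) ω) (2 ^ n)) atTop
      (𝓝 (truncIncrement W h k ω)) := by
  set A := truncLevel h with hA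
  set τ := truncTime W h k ω with hτ
  set θ : ℝ≥0 := (min (((k + 1) * h : ℝ≥0) : ℝ≥0∞) τ).toNNReal with hθ
  have hθτ : (θ : ℝ≥0∞) = min (((k + 1) * h : ℝ≥0) : ℝ≥0∞) τ :=
    ENNReal.coe_toNNReal (ne_top_of_le_ne_top ENNReal.coe_ne_top (min_le_left _ _))
  have hθ1 : θ ≤ (k + 1) * h := by
    rw [← ENNReal.coe_le_coe, hθτ]; exact min_le_left _ _
  have hsτ : ((k * h : ℝ≥0) : ℝ≥0∞) ≤ τ :=
    le_iInf₂ fun t ht ↦ by exact_mod_cast ht.1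
  have hskh : (k * h : ℝ≥0) ≤ (k + 1) * h := by gcongr; simp
  have hθ0 : k * h ≤ θ := by
    rw [← ENNReal.coe_le_coe, hθτ]
    exact le_min (by exact_mod_cast hskh) hsτ
  choose j hj he hjlt hjor using fun n ↦ exists_stoppedWalk_eq A
    (fun l ↦ gridIncrement W T h n (k * 2 ^ n + l) ω) (2 ^ n)
  set f : ℝ → ℝ := fun t ↦ W t.toNNReal ω with hf
  have hfs : f ((k : ℝ) * h) = W (k * h) ω := by
    have : ((k : ℝ) * h).toNNReal = k * h := by
      rw [← NNReal.coe_natCast, ← NNReal.coe_mul, Real.toNNReal_coe]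
    simp only [hf, this]
  have hft : ∀ n (i : ℕ), f ((k : ℝ) * h + i * (h / 2 ^ n)) = W (k * h + i * (h / 2 ^ n)) ω := by
    intro n i
    have : ((k : ℝ) * h + i * (h / 2 ^ n)).toNNReal = k * h + i * (h / 2 ^ n) := by
      have : ((k : ℝ) * h + i * (h / 2 ^ n)) = ((k * h + i * (h / 2 ^ n) : ℝ≥0) : ℝ) := by
        push_cast; rfl
      rw [this, Real.toNNReal_coe]
    simp only [hf, this]
  have hsum : ∀ n, ∀ i ≤ 2 ^ n, ∑ l ∈ Finset.range i, gridIncrement W T h n (k * 2 ^ n + l) ω =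
      f ((k : ℝ) * h + i * (h / 2 ^ n)) - f ((k : ℝ) * h) := fun n i hi ↦ by
    rw [hfs, hft, sum_gridIncrement hi hk]
  have hsh : (k : ℝ) * h + h = ((k + 1) * h : ℝ≥0) := by push_cast; ring
  have hmain := tendsto_gridExit (f := f) (s := k * h) (h := h) (A := A) (θ := θ) (j := j)
    (by exact_mod_cast hh) ?_ (by exact_mod_cast hθ0) (by rw [hsh]; exact_mod_cast hθ1) ?_ ?_ hj
    (fun n i hi ↦ by rw [← hsum n i (hi.le.trans (hj n))]; exact hjlt n i hi)
    (fun n ↦ by rw [← hsum n (j n) (hj n)]; exact hjor n)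
  · have hlim := hmain.sub_const (f ((k : ℝ) * h))
    have e1 : f θ - f ((k : ℝ) * h) = truncIncrement W h k ω := by
      rw [hfs, truncIncrement, ← hτ, ← hθ]
      simp [hf]
    rw [e1] at hlim
    refine hlim.congr fun n ↦ ?_
    rw [he, hsum n (j n) (hj n)]
  · refine hc.comp continuous_real_toNNReal.continuousOn fun t ht ↦ ⟨zero_le, ?_⟩
    refine le_trans ?_ hk
    rw [Real.toNNReal_le_iff_le_coe]
    exact ht.2.trans_eq hsh
  · intro t hst htθ
    by_contra! hlt
    have ht0 : 0 ≤ t := le_trans (by positivity) hst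
    have h1 : τ ≤ (t.toNNReal : ℝ≥0∞) := by
      refine iInf₂_le t.toNNReal ⟨?_, ?_⟩
      · rw [← NNReal.coe_le_coe, Real.coe_toNNReal _ ht0]; exact_mod_cast hst
      · rwa [hfs] at hlt
    have h2 : θ ≤ t.toNNReal := by
      rw [← ENNReal.coe_le_coe, hθτ]; exact (min_le_right _ _).trans h1
    rw [← NNReal.coe_le_coe, Real.coe_toNNReal _ ht0] at h2
    exact absurd htθ (not_lt.2 h2)
  · intro hlt c hc
    have hlt' : θ < (k + 1) * h := by
      rw [hsh] at hlt; exact_mod_cast hlt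
    have hτθ : τ = θ := by
      rw [hθτ, eq_comm, min_eq_right_iff]
      by_contra! hh
      rw [min_eq_left hh.le] at hθτ
      exact hlt'.ne (by exact_mod_cast hθτ)
    have hc0 : 0 ≤ c := θ.2.trans hc.le
    have h1 : τ < (c.toNNReal : ℝ≥0∞) := by
      rw [hτθ, ENNReal.coe_lt_coe, ← NNReal.coe_lt_coe, Real.coe_toNNReal _ hc0]; exact hc
    obtain ⟨t, ht⟩ := iInf_lt_iff.1 h1
    obtain ⟨⟨ht1, ht2⟩, ht3⟩ := iInf_lt_iff.1 ht
    refine ⟨t, ?_, ?_, ?_⟩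
    · have : τ ≤ t := iInf₂_le t ⟨ht1, ht2⟩
      rw [hτθ] at this
      exact_mod_cast this
    · rwa [ENNReal.coe_lt_coe, ← NNReal.coe_lt_coe, Real.coe_toNNReal _ hc0] at ht3
    · rw [hfs]; simpa [hf] using ht2

namespace IsBrownianMotionOn

variable [MeasurableSpace Ω] {P : Measure Ω} {T : ℝ≥0} {W : ℝ≥0 → Ω → ℝ}

theorem iIndepFun_gridIncrement (hW : IsBrownianMotionOn T W P) (h : ℝ≥0) (n : ℕ) :
    iIndepFun (gridIncrement W T h n) P :=
  hW.hasIndepIncrements.nat (t := fun i : ℕ ↦ i * (h / 2 ^ n))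
    (fun i j hij ↦ by dsimp only; gcongr)

theorem hasLaw_gridIncrement (hW : IsBrownianMotionOn T W P) (h : ℝ≥0) (n i : ℕ) :
    ∃ v, HasLaw (gridIncrement W T h n i) (gaussianReal 0 v) P :=
  ⟨_, hW.hasLaw_sub (min_le_right _ _) (min_le_right _ _)⟩

theorem hasLaw_increment (hW : IsBrownianMotionOn T W P) {h : ℝ≥0} {k : ℕ}
    (hk : (k + 1) * h ≤ T) : HasLaw (increment W h k) (gaussianReal 0 h) P := by
  have hskh : (k * h : ℝ≥0) ≤ (k + 1) * h := by gcongr; simp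
  have := hW.hasLaw_sub (hskh.trans hk) hk
  have e : nndist (((k + 1) * h : ℝ≥0) : ℝ) ((k * h : ℝ≥0) : ℝ) = h := by
    ext
    rw [coe_nndist, Real.dist_eq]
    push_cast
    rw [show ((k : ℝ) + 1) * h - k * h = h by ring, abs_of_nonneg (NNReal.coe_nonneg h)]
  rwa [e] at this

theorem isNoise_increment [IsProbabilityMeasure P] (hW : IsBrownianMotionOn T W P) {h : ℝ≥0}
    {N : ℕ} (h1 : h ≤ 1) (hN : ∀ k < N, (k + 1) * h ≤ T) :
    IsNoise P N h noiseConst (increment W h) := by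
  have hL := fun k hk ↦ hW.hasLaw_increment (hN k hk)
  refine isNoise_of_moment_le h.2 (by exact_mod_cast h1) (fun k hk ↦ (hL k hk).aemeasurable)
    (fun k hk ↦ ?_) (fun k hk ↦ ?_) (fun k hk j ↦
    ⟨integrable_pow_of_hasLaw_gaussianReal (hL k hk) _, ?_⟩)
  · have hi := hW.iIndepFun_gridIncrement h 0
    have h2 := hi.indepFun_finset₀ (Finset.range k) {k} (by simp)
      fun i ↦ (hW.hasLaw_gridIncrement h 0 i).choose_spec.aemeasurable
    have m1 : Measurable fun (y : Finset.range k → ℝ) (i : Fin k) ↦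
      y ⟨i, Finset.mem_range.2 i.2⟩ := by fun_prop
    have m2 : Measurable fun y : ({k} : Finset ℕ) → ℝ ↦ y ⟨k, Finset.mem_singleton_self k⟩ :=
      measurable_pi_apply _
    have e : ∀ i < N, increment W h i = gridIncrement W T h 0 i := fun i hi ↦ by
      ext ω
      have hskh : (i * h : ℝ≥0) ≤ (i + 1) * h := by gcongr; simp
      simp [increment, gridIncrement, min_eq_left (hN i hi), min_eq_left (hskh.trans (hN i hi))]
    convert h2.comp m1 m2 using 1
    · ext ω i
      rw [e i (i.2.trans hk)]; rfl
    · rw [e k hk]; rfl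
  · rw [(hL k hk).integral_eq, integral_id_gaussianReal]
  · rw [integral_pow_of_hasLaw_gaussianReal (hL k hk)]
    have := mul_nonneg (normalMoment_nonneg j) (pow_nonneg h.2 j)
    change normalMoment j * (h : ℝ) ^ j ≤ 4 * normalMoment j * (h : ℝ) ^ j
    change 0 ≤ normalMoment j * (h : ℝ) ^ j at this
    linarith

/-- The truncated increments inherit the properties of a noise from the stopped dyadic walks that
approximate them, whose moments are controlled by Doob's inequality. No strong Markov property and
no explicit law of the exit time is needed. -/
theorem isNoise_truncIncrement [IsProbabilityMeasure P] (hW : IsBrownianMotionOn T W P) {h : ℝ≥0}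
    {N : ℕ} (h0 : 0 < h) (h1 : h ≤ 1) (hN : ∀ k < N, (k + 1) * h ≤ T) :
    IsNoise P N h noiseConst (truncIncrement W h) := by
  have hL := fun n i ↦ (hW.hasLaw_gridIncrement h n i).choose_spec
  have hae := fun n i ↦ (hL n i).aemeasurable
  -- Measurable versions, as the results on random walks use the σ-algebras `past (g n)`.
  set g : ℕ → ℕ → Ω → ℝ := fun n i ↦ (hae n i).mk with hg
  have hgm : ∀ n i, Measurable (g n i) := fun n i ↦ (hae n i).measurable_mk
  have hge : ∀ n i, gridIncrement W T h n i =ᵐ[P] g n i := fun n i ↦ (hae n i).ae_eq_mk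
  have hgi : ∀ n, iIndepFun (g n) P := fun n ↦ (hW.iIndepFun_gridIncrement h n).congr (hge n)
  have hgL : ∀ n i, ∃ v, HasLaw (g n i) (gaussianReal 0 v) P := fun n i ↦
    ⟨_, (hL n i).congr (hge n i).symm⟩
  have hgmean : ∀ n i, ∫ ω, g n i ω ∂P = 0 := fun n i ↦ by
    obtain ⟨v, hv⟩ := hgL n i
    rw [hv.integral_eq, integral_id_gaussianReal]
  have hglp : ∀ n i (q : ℕ), MemLp (g n i) q P := fun n i q ↦ by
    obtain ⟨v, hv⟩ := hgL n i
    have := memLp_id_gaussianReal (μ := 0) (v := v) q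
    rw [← hv.map_eq] at this
    exact this.comp_of_map hv.aemeasurable
  have hall : ∀ᵐ ω ∂P, ∀ n i, gridIncrement W T h n i ω = g n i ω :=
    ae_all_iff.2 fun n ↦ ae_all_iff.2 fun i ↦ hge n i
  set D : ℕ → ℕ → Ω → ℝ := fun n k ω ↦
    stoppedWalk (truncLevel h) (fun l ↦ g n (k * 2 ^ n + l) ω) (2 ^ n) with hD
  have hDm : ∀ n k, Measurable (D n k) := fun n k ↦ measurable_stoppedWalk _ fun i _ ↦ hgm n _
  have hinj : ∀ n k, Function.Injective fun l ↦ k * 2 ^ n + l := fun n k ↦ add_right_injective _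
  have hlim : ∀ k < N, ∀ᵐ ω ∂P, Tendsto (D · k ω) atTop (𝓝 (truncIncrement W h k ω)) := by
    intro k hk
    filter_upwards [hall, hW.continuous_paths] with ω hω hc
    have := tendsto_stoppedWalk_truncIncrement h0 (hN k hk) hc
    simpa only [hω] using this
  have hmom : ∀ k < N, ∀ j n, Integrable (fun ω ↦ D n k ω ^ (2 * j)) P ∧
      ∫ ω, D n k ω ^ (2 * j) ∂P ≤ 4 * normalMoment j * h ^ j := by
    intro k hk j n
    obtain ⟨i1, i2⟩ := integral_stoppedWalk_pow_le (g := fun l ↦ g n (k * 2 ^ n + l))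
      (fun _ ↦ hgm n _) ((hgi n).precomp (hinj n k)) (fun _ q ↦ hglp n _ q) (fun _ ↦ hgmean n _)
      (truncLevel h) (2 ^ n) j
    refine ⟨i1, i2.trans_eq ?_⟩
    rw [mul_assoc, ← integral_pow_of_hasLaw_gaussianReal (hW.hasLaw_increment (hN k hk))]
    congr 1
    refine integral_congr_ae ?_
    filter_upwards [hall] with ω hω
    simp only [← hω]
    rw [sum_gridIncrement le_rfl (hN k hk), increment]
    have : (k : ℝ≥0) * h + (2 ^ n : ℕ) * (h / 2 ^ n) = (k + 1) * h := by
      push_cast; field_simp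
    rw [this]
  have hmean : ∀ n k, ∫ ω, D n k ω ∂P = 0 := fun n k ↦
    (integral_stoppedWalk (g := fun l ↦ g n (k * 2 ^ n + l)) (fun _ ↦ hgm n _)
      ((hgi n).precomp (hinj n k)) (fun _ ↦ (hglp n _ 1).integrable (by simp))
      (fun _ ↦ hgmean n _) _ _).2
  refine isNoise_of_moment_le h.2 (by exact_mod_cast h1) (fun k hk ↦ ?_)
    (fun k hk ↦ ?_) (fun k hk ↦ ?_) (fun k hk j ↦ ?_)
  · exact aemeasurable_of_tendsto_metrizable_ae atTop (fun n ↦ (hDm n k).aemeasurable) (hlim k hk)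
  · exact indepFun_of_tendsto (X := fun n i ↦ D n i) (U := fun n ↦ D n k)
      (fun n i ↦ (hDm n i).aemeasurable) (fun n ↦ (hDm n k).aemeasurable)
      (ae_all_iff.2 fun i ↦ hlim i (i.2.trans hk)) (hlim k hk)
      fun n ↦ indepFun_stoppedWalk_blocks (hgm n) (hgi n) _ _ _
  · exact integral_eq_zero_of_tendsto (fun n ↦ (hDm n k).aemeasurable) (hlim k hk)
      (fun n ↦ hmean n k) (fun n ↦ by simpa only [mul_one] using hmom k hk 1 n)
  · exact integral_pow_le_of_tendsto (fun n ↦ (hDm n k).aemeasurable) (hlim k hk) (hmom k hk j)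

end IsBrownianMotionOn

end

/-! ### The moment bound -/

section

theorem exists_one_add_sq_le {b σ : ℝ → ℝ} {m : ℕ} {ξ : Fin m → ℝ} {c₀ : ℝ} (hc : 0 < c₀) :
    ∃ M, 0 ≤ M ∧ ∀ x, 1 + x ^ 2 ≤ M * (1 + G b σ ξ c₀ x ^ 2) := by
  obtain ⟨c, hc0, hcG⟩ := exists_abs_G_sub_le (b := b) (σ := σ) (ξ := ξ) hc
  refine ⟨2 + 2 * c ^ 2, by positivity, fun x ↦ ?_⟩
  have h1 := sq_le_sq' (abs_le.1 (hcG x)).1 (abs_le.1 (hcG x)).2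
  nlinarith [sq_nonneg (2 * G b σ ξ c₀ x - x),
    mul_nonneg (sq_nonneg c) (sq_nonneg (G b σ ξ c₀ x))]

theorem abs_rpow_le_one_add_sq_pow {p : ℝ} (hp : 0 ≤ p) {q : ℕ} (hq : p ≤ 4 * q) (x : ℝ) :
    |x| ^ p ≤ (1 + x ^ 2) ^ (2 * q) := by
  have h1 : |x| ≤ √(1 + x ^ 2) := Real.abs_le_sqrt (by linarith)
  have h2 : 1 ≤ √(1 + x ^ 2) := Real.one_le_sqrt.2 (by nlinarith [sq_nonneg x])
  calc |x| ^ p ≤ √(1 + x ^ 2) ^ p := Real.rpow_le_rpow (abs_nonneg x) h1 hp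
    _ ≤ √(1 + x ^ 2) ^ (4 * q : ℝ) := Real.rpow_le_rpow_of_exponent_le h2 hq
    _ = (1 + x ^ 2) ^ (2 * q) := by
      rw [show (4 * q : ℝ) = ((2 * (2 * q) : ℕ) : ℝ) by push_cast; ring, Real.rpow_natCast, pow_mul,
        Real.sq_sqrt (by positivity)]

/-- The moment bound for `G(X)` gives one for `X`, since `1 + x²` is comparable to `1 + G(x)²`. -/
theorem integral_iSup_abs_rpow_le {Ω : Type*} [MeasurableSpace Ω] {P : Measure Ω}
    {b σ : ℝ → ℝ} {m : ℕ} {ξ : Fin m → ℝ} {c₀ M p C : ℝ} (hM0 : 0 ≤ M)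
    (hM : ∀ x, 1 + x ^ 2 ≤ M * (1 + G b σ ξ c₀ x ^ 2)) {q : ℕ} (hp : 0 ≤ p) (hq : p ≤ 4 * q)
    (hC : 0 ≤ C) {N : ℕ} {X : ℕ → Ω → ℝ} (hX : ∀ k ≤ N, AEMeasurable (X k) P)
    (h : ∫⁻ ω, ⨆ k : Fin (N + 1), ENNReal.ofReal ((1 + G b σ ξ c₀ (X k ω) ^ 2) ^ (2 * q)) ∂P ≤
      ENNReal.ofReal C) :
    Integrable (fun ω ↦ ⨆ k : Fin (N + 1), |X k ω| ^ p) P ∧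
      ∫ ω, (⨆ k : Fin (N + 1), |X k ω| ^ p) ∂P ≤ M ^ (2 * q) * C := by
  have hm : AEMeasurable (fun ω ↦ ⨆ k : Fin (N + 1), |X k ω| ^ p) P :=
    AEMeasurable.iSup fun k ↦ by
      have := hX k (Nat.lt_succ_iff.1 k.2)
      fun_prop
  have h0 : ∀ ω, 0 ≤ ⨆ k : Fin (N + 1), |X k ω| ^ p := fun ω ↦
    Real.iSup_nonneg fun k ↦ by positivity
  have hle : ∀ ω, ENNReal.ofReal (⨆ k : Fin (N + 1), |X k ω| ^ p) ≤ ENNReal.ofReal (M ^ (2 * q)) *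
      ⨆ k : Fin (N + 1), ENNReal.ofReal ((1 + G b σ ξ c₀ (X k ω) ^ 2) ^ (2 * q)) := fun ω ↦ by
    obtain ⟨k, hk⟩ := exists_eq_ciSup_of_finite (f := fun k : Fin (N + 1) ↦ |X k ω| ^ p)
    rw [← hk]
    refine le_trans ?_ (mul_le_mul_right (le_iSup _ k) _)
    rw [← ENNReal.ofReal_mul (by positivity), ← mul_pow]
    refine ENNReal.ofReal_le_ofReal ((abs_rpow_le_one_add_sq_pow hp hq _).trans ?_)
    exact pow_le_pow_left₀ (by positivity) (hM _) _
  have hb : ∫⁻ ω, ENNReal.ofReal (⨆ k : Fin (N + 1), |X k ω| ^ p) ∂P ≤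
      ENNReal.ofReal (M ^ (2 * q) * C) := by
    refine (lintegral_mono hle).trans ?_
    rw [lintegral_const_mul' _ _ ENNReal.ofReal_ne_top, ENNReal.ofReal_mul (by positivity)]
    gcongr
  have hint : Integrable (fun ω ↦ ⨆ k : Fin (N + 1), |X k ω| ^ p) P := by
    refine ⟨hm.aestronglyMeasurable, ?_⟩
    rw [hasFiniteIntegral_iff_ofReal (ae_of_all _ h0)]
    exact hb.trans_lt ENNReal.ofReal_lt_top
  refine ⟨hint, ?_⟩
  rw [← ofReal_integral_eq_lintegral_ofReal hint (ae_of_all _ h0)] at hb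
  exact (ENNReal.ofReal_le_ofReal_iff (by positivity)).1 hb

end

end

end TransformedEuler

theorem proposition4p10 (b σ : ℝ → ℝ) (m : ℕ) (ξ : Fin m → ℝ) (Lb Kb Lσ γ η α β c₀ x₀ : ℝ)
    (hcoeff : TransformedEuler.CoefficientAssumption b σ ξ Lb Kb Lσ γ η)
    (hα : 0 < α) (hβ : 0 < β)
    (hmono : TransformedEuler.MonotonicityCondition b σ α β)
    (hc₀ : TransformedEuler.AdmissibleRadius b σ ξ c₀)
    (T : ℝ≥0) (hT : 0 < T) (p : ℝ) (hp : 1 ≤ p) :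
    ∃ C : ℝ, 0 < C ∧
      ∀ N : ℕ, (T : ℝ) < N → max (4 * β * T) (2 * Lb * T) < N →
      ∀ (Ω : Type*) [MeasurableSpace Ω] (P : Measure Ω) [IsProbabilityMeasure P]
        (W : ℝ≥0 → Ω → ℝ), TransformedEuler.IsBrownianMotionOn T W P →
        (∀ X : ℕ → Ω → ℝ,
          TransformedEuler.IsTransformedScheme P b σ ξ c₀ x₀ N (T / N)
            (TransformedEuler.truncIncrement W (T / N)) X →
          Integrable (fun ω ↦ ⨆ k : Fin (N + 1), |X k ω| ^ p) P ∧
            ∫ ω, (⨆ k : Fin (N + 1), |X k ω| ^ p) ∂P ≤ C) ∧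
        (∀ X : ℕ → Ω → ℝ,
          TransformedEuler.IsTransformedScheme P b σ ξ c₀ x₀ N (T / N)
            (TransformedEuler.increment W (T / N)) X →
          Integrable (fun ω ↦ ⨆ k : Fin (N + 1), |X k ω| ^ p) P ∧
            ∫ ω, (⨆ k : Fin (N + 1), |X k ω| ^ p) ∂P ≤ C) := by
  open TransformedEuler in
  obtain ⟨L, hL⟩ := hcoeff.exists_transformedDrift_sub_le hc₀
  obtain ⟨a₀, ha₀, ha⟩ := hcoeff.exists_mul_transformedDrift_le hc₀ hα hβ hmono
  obtain ⟨A, hA⟩ := hcoeff.exists_sq_transformedDiffusion_le hc₀ hα hβ hmono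
  obtain ⟨M, hM0, hM⟩ := exists_one_add_sq_le (b := b) (σ := σ) (ξ := ξ) hc₀.pos
  obtain ⟨q, hq⟩ := exists_nat_ge p
  obtain ⟨C, hC, hmain⟩ := exists_lintegral_iSup_implicitScheme_le noiseConst
    (hcoeff.measurable_transformedDiffusion hc₀) ha₀ hβ.le (by exact_mod_cast hT : (0 : ℝ) < T)
    ha hA hL (G b σ ξ c₀ x₀) q
  refine ⟨M ^ (2 * q) * C + 1, by positivity, fun N hTN hN Ω _ P _ W hW ↦ ?_⟩
  have hN0 : (0 : ℝ) < N := T.2.trans_lt hTN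
  have hNne : (N : ℝ≥0) ≠ 0 := by exact_mod_cast hN0.ne'
  have hh0 : 0 < T / (N : ℝ≥0) := div_pos hT (by exact_mod_cast hN0)
  have hh1 : T / (N : ℝ≥0) ≤ 1 := by
    rw [div_le_one (by exact_mod_cast hN0)]; exact_mod_cast hTN.le
  have hkT : ∀ k < N, ((k : ℝ≥0) + 1) * (T / N) ≤ T := fun k hk ↦ by
    have h1 : (k : ℝ≥0) + 1 ≤ N := by exact_mod_cast hk
    calc ((k : ℝ≥0) + 1) * (T / N) ≤ N * (T / N) := by gcongr
      _ = T := by field_simp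
  have hcast : (((T / N : ℝ≥0)) : ℝ) = T / N := by push_cast; rfl
  -- `Z = G(X)` solves an implicit scheme, whatever the noise.
  have key : ∀ D : ℕ → Ω → ℝ, IsNoise P N ((T / N : ℝ≥0) : ℝ) noiseConst D → ∀ X : ℕ → Ω → ℝ,
      IsTransformedScheme P b σ ξ c₀ x₀ N (T / N) D X →
      Integrable (fun ω ↦ ⨆ k : Fin (N + 1), |X k ω| ^ p) P ∧
        ∫ ω, (⨆ k : Fin (N + 1), |X k ω| ^ p) ∂P ≤ M ^ (2 * q) * C + 1 := by
    intro D hD X hX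
    rw [hcast] at hD
    have h1 := hmain Ω P N D hTN ((le_max_left _ _).trans_lt hN) hD (fun k ω ↦ G b σ ξ c₀ (X k ω))
      (hX.initial.mono fun ω hω ↦ by rw [hω])
      (fun k hk ↦ (hX.step k hk).mono fun ω hω ↦ by
        have h2 := congrArg (G b σ ξ c₀) hω
        rw [G_GInv hc₀.pos, hcast] at h2
        exact h2)
    have hq' : p ≤ 4 * q := by linarith
    obtain ⟨i1, i2⟩ := integral_iSup_abs_rpow_le hM0 hM (by linarith) hq' hC hX.aemeasurable h1
    exact ⟨i1, i2.trans (by linarith)⟩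
  exact ⟨key _ (hW.isNoise_truncIncrement hh0 hh1 hkT), key _ (hW.isNoise_increment hh1 hkT)⟩
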